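/- Assume the Generalized Riemann Hypothesis for Dirichlet $L$-functions: for every Dirichlet character $\chi$, all zeros of $L(s,\chi)$ with $0<\mathrm{Re}(s)<1$ satisfy $\mathrm{Re}(s)=1/2$. For an odd prime $p$ let $\chi_p=\left(\frac{\cdot}{p}\right)$ be the Legendre symbol modulo $p$. There is an absolute constant $c>0$ such that the following holds. Let $s=\sigma+it$ be fixed, where $1/2<\sigma<1$ and $t\in\mathbb{R}$, and put $$\beta(s)=\frac{(2\log 2)^{\sigma-1}}{1-\sigma}\ \text{ if } t=0,\qquad \beta(s)=\frac{(2\log 2)^{\sigma-1}}{1-\sigma}\cdot\frac{t^2}{(1-\sigma)^2+4t^2}\ \text{ if } t\neq 0.$$ Then for all sufficiently large real $x$ (in terms of $s$) there are at least $c\,x^{1/2}$ odd primes $p\le x$ such that $$\log|L(s,\chi_p)|\ge(\beta(s)+o(1))(\log x)^{1-\sigma}(\log\log x)^{-\sigma},$$ and at least $c\,x^{1/2}$ odd primes $q\le x$ such that $$\log|L(s,\chi_q)|\le-(\beta(s)+o(1))(\log x)^{1-\sigma}(\log\log x)^{-\sigma},$$ where each $o(1)$ denotes a function of $x$ (depending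 on $s$, but not on the primes) that tends to $0$ as $x\to\infty$. -/

import Mathlib

/-- The Generalized Riemann Hypothesis for Dirichlet `L`-functions: for every Dirichlet character,
every zero of its `L`-function in the critical strip `0 < Re s < 1` lies on `Re s = 1/2`.
(The modulus `1` gives the Riemann zeta function; the zeros that an imprimitive character acquires
from its missing Euler factors lie on `Re s = 0`, outside the open strip.) -/
def GeneralizedRH : Prop :=
  ∀ (N : ℕ) [NeZero N] (χ : DirichletCharacter ℂ N) (s : ℂ),
    DirichletCharacter.LFunction χ s = 0 → 0 < s.re → s.re < 1 → s.re = 1 / 2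

/-- The Legendre symbol modulo a prime `p`, as a complex valued Dirichlet character modulo `p`. -/
noncomputable def legendreChar (p : ℕ) [Fact p.Prime] : DirichletCharacter ℂ p :=
  (quadraticChar (ZMod p)).ringHomComp (Int.castRingHom ℂ)

theorem legendreChar_intCast (p : ℕ) [Fact p.Prime] (a : ℤ) :
    legendreChar p (a : ZMod p) = (legendreSym p a : ℂ) := rfl

/-- The constant `β(s)`, `s = σ + it`: it is `β(σ) = (2 log 2) ^ (σ - 1) / (1 - σ)` for `t = 0`,
and `β(σ) t² / ((1 - σ)² + 4 t²)` for `t ≠ 0`. -/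
noncomputable def betaConst (σ t : ℝ) : ℝ :=
  if t = 0 then (2 * Real.log 2) ^ (σ - 1) / (1 - σ)
  else (2 * Real.log 2) ^ (σ - 1) / (1 - σ) * (t ^ 2 / ((1 - σ) ^ 2 + 4 * t ^ 2))

/-!
For a fixed Dirichlet character `χ ≠ 1` GRH makes `log L(s, χ)` holomorphic on `1 / 2 < Re s`, and
`log |L(s, χ)|` is then a short sum over primes: shifting a contour with the kernel
`1 / (w (w + 1))` gives, for `p ≤ x` and `z` a suitable power of `log x`,
`log |L(s, χ_p)| = ∑_{q ≤ z} Re (χ_p(q) q ^ (-s)) (1 - q / z) + O(1)`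
(`GeneralizedRH.abs_log_norm_LFunction_sub_le`). So `log |L(s, χ_p)|` is large as soon as
`χ_p(q) = (q / p)` has the sign of `cos (t log q)` for all primes `q ≤ y`, with `y` as large as
possible, while the primes `y < q ≤ z` contribute a bounded amount; the opposite signs make it
small.

Primes `p ≤ x` with prescribed symbols are detected by `∏_{q ≤ y} (1 + ε_q (q / p))`. Expanding
this product leads to the symbols `(m / p)` with `m` squarefree; by quadratic reciprocity
`n ↦ (m / n)` is a nonprincipal character modulo `4 m`, so that under GRH its sum against
`Λ(n) (1 - n / x)` is `O(x ^ (1 / 2 + δ) log m)` (`GeneralizedRH.abs_sum_jacobiSym_le`). Hence the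
main term `x / 2` of the first moment survives as long as the number `2 ^ π(y)` of sign patterns
is below `x ^ (1 / 2 - 2 δ)`, which allows `y` close to `log x log log x / (2 log 2)` and leaves
at least `x ^ (1 / 2)` primes. The second moment of the sum over `y < q ≤ z` on the detected set
is `O(1)`, because only the diagonal terms remain and `∑ q ^ (-2 σ)` converges; by Chebyshev's
inequality most detected primes therefore have a bounded sum over this range
(`GeneralizedRH.exists_eventually_le_card`).

Finally `∑_{q ≤ y} |cos (t log q)| q ^ (-σ) ≥ ∑_{q ≤ y} cos² (t log q) q ^ (-σ)`, and the latter
is evaluated by partial summation from the prime number theorem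
(`GeneralizedRH.eventually_le_sum_cos_sq`). Its main term is
`½ ∫ (1 + cos (2 t log u)) u ^ (-σ) du / log y`, and a lower bound for the integral valid at all
`y` is where the constant `β(s)` comes from.
-/

/-! ### Logarithmic derivatives and vertical lines of integration -/

section

open Complex Filter Topology MeasureTheory Set Metric

/-- A function without zeros on a disc that exceeds its value at the centre by at most a factor
`exp M` has logarithmic derivative `O(M)` on smaller discs: Borel-Carathéodory for a branch of its
logarithm, followed by Cauchy's estimate. -/
theorem norm_logDeriv_le_of_norm_le {F : ℂ → ℂ} {c : ℂ} {R r M : ℝ} (hr : 0 < r) (hrR : r < R)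
    (hM : 0 < M) (hF : DifferentiableOn ℂ F (ball c R)) (h0 : ∀ z ∈ ball c R, F z ≠ 0)
    (hb : ∀ z ∈ ball c R, ‖F z‖ ≤ Real.exp M * ‖F c‖) {z : ℂ} (hz : dist z c ≤ r) :
    ‖deriv F z / F z‖ ≤ 8 * R / (R - r) ^ 2 * M := by
  have hR : 0 < R := hr.trans hrR
  have hcR : c ∈ ball c R := mem_ball_self hR
  have hd : DifferentiableOn ℂ (fun w => deriv F w / F w) (ball c R) :=
    (hF.deriv isOpen_ball).div hF h0
  obtain ⟨g, hgc, hg⟩ := hd.isExactOn_ball.with_val_at c 0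
  have hFd : ∀ w ∈ ball c R, HasDerivAt F (deriv F w) w := fun w hw =>
    (hF.differentiableAt (isOpen_ball.mem_nhds hw)).hasDerivAt
  -- `F * exp (-g)` has zero derivative, so `F = F c * exp g` on the disc.
  have hexp : ∀ w ∈ ball c R, F w = F c * exp (g w) := by
    intro w hw
    have hder : ∀ v ∈ ball c R, HasDerivAt (fun v => F v * exp (-g v)) 0 v := by
      intro v hv
      have h1 := (hFd v hv).mul ((hg v hv).neg.cexp)
      have hFv := h0 v hv
      have h2 : F v * (deriv F v / F v) = deriv F v := mul_div_cancel₀ _ hFv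
      refine HasDerivAt.congr_deriv (f := fun v => F v * exp (-g v)) h1 ?_
      linear_combination -exp (-g v) * h2
    have hconst := (convex_ball c R).is_const_of_fderivWithin_eq_zero (𝕜 := ℂ)
      (f := fun v => F v * exp (-g v))
      (fun v hv => (hder v hv).differentiableAt.differentiableWithinAt)
      (fun v hv => by
        rw [fderivWithin_of_isOpen isOpen_ball hv]
        ext
        simp [(hder v hv).deriv]) hw hcR
    simp only [hgc, neg_zero, exp_zero, mul_one] at hconst
    rw [← hconst, mul_assoc, ← exp_add]
    simp
  have hre : ∀ w ∈ ball c R, (g w).re ≤ M := by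
    intro w hw
    have h1 := hb w hw
    rw [hexp w hw, norm_mul, norm_exp, mul_comm] at h1
    have h2 := le_of_mul_le_mul_right h1 (norm_pos_iff.2 (h0 c hcR))
    exact Real.exp_le_exp.1 h2
  have hmaps : ∀ w : ℂ, w ∈ ball (0 : ℂ) R → c + w ∈ ball c R := by
    intro w hw; simpa [mem_ball, dist_eq_norm] using hw
  have hgd : DifferentiableOn ℂ g (ball c R) := fun w hw =>
    (hg w hw).differentiableAt.differentiableWithinAt
  have hBC : ∀ w ∈ closedBall z ((R - r) / 2), ‖g w‖ ≤ 4 * M * R / (R - r) := by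
    intro w hw
    have hwc : ‖w - c‖ ≤ (R + r) / 2 := by
      rw [← dist_eq_norm]
      have := dist_triangle w z c
      rw [mem_closedBall] at hw
      linarith
    have := borelCaratheodory_zero (f := fun v => g (c + v)) (z := w - c) (R := R) hM
      (hgd.comp (by fun_prop) (fun v hv => hmaps v hv)) (fun v hv => hre _ (hmaps v hv)) hR
      (by rw [mem_ball_zero_iff]; linarith) (by simpa using hgc)
    simp only [add_sub_cancel] at this
    refine this.trans ?_
    rw [div_le_div_iff₀ (by linarith) (by linarith)]
    have h1 : 2 * M * ‖w - c‖ * (R - r) ≤ 2 * M * R * (R - r) := by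
      have : 0 < R - r := by linarith
      gcongr
      linarith
    have h2 : 4 * M * R * ((R - r) / 2) ≤ 4 * M * R * (R - ‖w - c‖) := by
      gcongr; linarith
    linarith
  have hsub : closedBall z ((R - r) / 2) ⊆ ball c R := by
    intro w hw
    have := dist_triangle w z c
    rw [mem_closedBall] at hw
    rw [mem_ball]
    linarith
  have hfin := norm_deriv_le_of_forall_mem_sphere_norm_le (f := g) (c := z) (R := (R - r) / 2)
    (C := 4 * M * R / (R - r)) (by linarith) ((hgd.mono hsub).diffContOnCl_ball subset_rfl)
    (fun w hw => hBC w (sphere_subset_closedBall hw))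
  rw [(hg z (hsub (mem_closedBall_self (by linarith)))).deriv] at hfin
  refine hfin.trans (le_of_eq ?_)
  have : R - r ≠ 0 := by linarith
  field_simp
  ring

theorem integrable_one_add_abs_rpow : Integrable (fun y : ℝ => (1 + |y|) ^ (-(3 / 2) : ℝ)) := by
  have := integrable_one_add_norm (E := ℝ) (μ := volume) (r := 3 / 2) (by simp; norm_num)
  simpa using this

theorem integrable_vertical {H : ℂ → ℂ} {a K : ℝ}
    (hH : Continuous fun y : ℝ => H (a + y * I))
    (hb : ∀ y : ℝ, ‖H (a + y * I)‖ ≤ K * (1 + |y|) ^ (-(3 / 2) : ℝ)) :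
    Integrable fun y : ℝ => H (a + y * I) :=
  (integrable_one_add_abs_rpow.const_mul K).mono' hH.aestronglyMeasurable
    (Eventually.of_forall hb)

theorem norm_integral_vertical_le {H : ℂ → ℂ} {a K : ℝ}
    (hb : ∀ y : ℝ, ‖H (a + y * I)‖ ≤ K * (1 + |y|) ^ (-(3 / 2) : ℝ)) :
    ‖∫ y : ℝ, H (a + y * I)‖ ≤ K * ∫ y : ℝ, (1 + |y|) ^ (-(3 / 2) : ℝ) := by
  rw [← integral_const_mul]
  exact norm_integral_le_of_norm_le (integrable_one_add_abs_rpow.const_mul K)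
    (Eventually.of_forall hb)

/-- Shifting a vertical line of integration inside a strip where the integrand is holomorphic and
`O((1 + |Im w|) ^ (-3 / 2))`. This exponent is what a kernel of order `|w| ^ (-2)` leaves when it is
multiplied by a function of order `|Im w| ^ (1 / 2)`. -/
theorem integral_vertical_eq {H : ℂ → ℂ} {a b K : ℝ} (hab : a ≤ b)
    (hH : DifferentiableOn ℂ H {w | a ≤ w.re ∧ w.re ≤ b})
    (hK : ∀ w : ℂ, a ≤ w.re → w.re ≤ b → ‖H w‖ ≤ K * (1 + |w.im|) ^ (-(3 / 2) : ℝ)) :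
    ∫ y : ℝ, H (a + y * I) = ∫ y : ℝ, H (b + y * I) := by
  have hcont : ∀ x : ℝ, a ≤ x → x ≤ b → Integrable fun y : ℝ => H (x + y * I) := by
    intro x h1 h2
    refine integrable_vertical (K := K) ?_ (fun y => ?_)
    · exact hH.continuousOn.comp_continuous (by fun_prop) (fun y => by simp [h1, h2])
    · simpa using hK (x + y * I) (by simpa using h1) (by simpa using h2)
  have hrect : ∀ T : ℝ, (∫ y in (-T)..T, H (b + y * I)) - ∫ y in (-T)..T, H (a + y * I) =
      I * ((∫ x in a..b, H (x + (-T : ℝ) * I)) - ∫ x in a..b, H (x + T * I)) := by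
    intro T
    have := integral_boundary_rect_eq_zero_of_differentiableOn H (a + (-T : ℝ) * I) (b + T * I)
      (hH.mono (by
        intro w hw
        have h1 := hw.1
        simp only [add_re, ofReal_re, mul_re, I_re, mul_zero, ofReal_im, I_im, mul_one, sub_self,
          add_zero, mem_preimage, uIcc_of_le hab] at h1
        exact h1))
    simp only [add_re, ofReal_re, mul_re, I_re, mul_zero, ofReal_im, I_im, mul_one, sub_self,
      add_zero, add_im, mul_im, zero_add, smul_eq_mul] at this
    linear_combination (-I) * this + ((∫ y in (-T)..T, H (b + y * I)) -
      ∫ y in (-T)..T, H (a + y * I)) * I_mul_I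
  have hhor : ∀ᶠ T : ℝ in atTop, ‖(∫ y in (-T)..T, H (b + y * I)) -
      ∫ y in (-T)..T, H (a + y * I)‖ ≤ 2 * (K * (1 + T) ^ (-(3 / 2) : ℝ) * (b - a)) := by
    filter_upwards [eventually_ge_atTop 0] with T hT
    rw [hrect T, norm_mul, norm_I, one_mul, two_mul]
    refine (norm_sub_le _ _).trans (add_le_add ?_ ?_)
    · have := intervalIntegral.norm_integral_le_of_norm_le_const (a := a) (b := b)
        (f := fun x : ℝ => H (x + (-T : ℝ) * I)) (C := K * (1 + T) ^ (-(3 / 2) : ℝ)) (by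
          intro x hx
          rw [uIoc_of_le hab] at hx
          have := hK (x + (-T : ℝ) * I) (by simpa using hx.1.le) (by simpa using hx.2)
          simpa [abs_of_nonneg hT] using this)
      rwa [abs_of_nonneg (by linarith)] at this
    · have := intervalIntegral.norm_integral_le_of_norm_le_const (a := a) (b := b)
        (f := fun x : ℝ => H (x + T * I)) (C := K * (1 + T) ^ (-(3 / 2) : ℝ)) (by
          intro x hx
          rw [uIoc_of_le hab] at hx
          have := hK (x + T * I) (by simpa using hx.1.le) (by simpa using hx.2)
          simpa [abs_of_nonneg hT] using this)
      rwa [abs_of_nonneg (by linarith)] at this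
  have hlim0 : Tendsto (fun T : ℝ => 2 * (K * (1 + T) ^ (-(3 / 2) : ℝ) * (b - a))) atTop (𝓝 0) := by
    have h1 : Tendsto (fun T : ℝ => (1 + T) ^ (-(3 / 2) : ℝ)) atTop (𝓝 0) :=
      (tendsto_rpow_neg_atTop (by norm_num : (0 : ℝ) < 3 / 2)).comp
        (tendsto_atTop_add_const_left _ 1 tendsto_id)
    simpa using ((h1.const_mul K).mul_const (b - a)).const_mul 2
  have hA := intervalIntegral_tendsto_integral (hcont a le_rfl hab) tendsto_neg_atTop_atBot
    tendsto_id
  have hB := intervalIntegral_tendsto_integral (hcont b hab le_rfl) tendsto_neg_atTop_atBot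
    tendsto_id
  have h0 := squeeze_zero_norm' hhor hlim0
  have := tendsto_nhds_unique (hB.sub hA) h0
  exact (sub_eq_zero.1 this).symm

theorem one_add_abs_im_le {s : ℂ} {d : ℝ} (hd : 0 < d) (hs : d ≤ |s.re|) :
    1 + |s.im| ≤ (1 + d) / d * ‖s‖ := by
  have h1 := abs_re_le_norm s
  have h2 := abs_im_le_norm s
  rw [div_mul_eq_mul_div, le_div_iff₀ hd]
  nlinarith

theorem norm_inv_mul_add_one_le {w : ℂ} {d : ℝ} (hd : 0 < d) (h1 : d ≤ |w.re|)
    (h2 : d ≤ |w.re + 1|) :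
    ‖(w * (w + 1))⁻¹‖ ≤ ((1 + d) / d) ^ 2 * (1 + |w.im|) ^ (-2 : ℝ) := by
  have e1 := one_add_abs_im_le hd h1
  have e2 : 1 + |w.im| ≤ (1 + d) / d * ‖w + 1‖ := by
    simpa using one_add_abs_im_le (s := w + 1) hd (by simpa using h2)
  have hp : 0 < 1 + |w.im| := by positivity
  have hc : 0 < (1 + d) / d := by positivity
  have n1 : 0 < ‖w‖ := by
    by_contra h
    have : ‖w‖ = 0 := le_antisymm (not_lt.1 h) (norm_nonneg _)
    rw [this] at e1; linarith
  have n2 : 0 < ‖w + 1‖ := by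
    by_contra h
    have : ‖w + 1‖ = 0 := le_antisymm (not_lt.1 h) (norm_nonneg _)
    rw [this] at e2; linarith
  rw [Real.rpow_neg hp.le, Real.rpow_two, norm_inv, norm_mul, ← div_eq_mul_inv,
    inv_eq_one_div, div_le_div_iff₀ (by positivity) (by positivity)]
  nlinarith [mul_le_mul e1 e2 hp.le (by positivity)]

end

/-! ### Perron's formula with the Fejér weight -/

section

open Complex Filter Topology MeasureTheory Set Metric

theorem norm_kernel_le {w : ℂ} {d : ℝ} (hd : 0 < d) (h1 : d ≤ |w.re|) (h2 : d ≤ |w.re + 1|) :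
    ‖(w * (w + 1))⁻¹‖ ≤ ((1 + d) / d) ^ 2 * (1 + |w.im|) ^ (-(3 / 2) : ℝ) := by
  refine (norm_inv_mul_add_one_le hd h1 h2).trans ?_
  gcongr
  · linarith [abs_nonneg w.im]
  · norm_num

theorem ne_zero_of_re_ne_zero {w : ℂ} (h : w.re ≠ 0) : w ≠ 0 := by
  rintro rfl; simp at h

theorem hasMellin_max_one_sub {s : ℂ} (hs : 0 < s.re) :
    HasMellin (fun u : ℝ => Set.indicator (Ioc 0 1) (fun _ => (1 : ℂ)) u -
      Set.indicator (Ioc 0 1) (fun t : ℝ => (t : ℂ) ^ (1 : ℂ)) u) s (s * (s + 1))⁻¹ := by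
  have h1 := hasMellin_one_Ioc hs
  have h2 := hasMellin_cpow_Ioc 1 (s := s) (by simp; linarith)
  have h3 := hasMellin_sub h1.1 h2.1
  rw [h1.2, h2.2] at h3
  have e1 : s ≠ 0 := ne_zero_of_re_ne_zero hs.ne'
  have e2 : s + 1 ≠ 0 := ne_zero_of_re_ne_zero (by simp; linarith)
  have e : (s * (s + 1))⁻¹ = 1 / s - 1 / (s + 1) := by
    field_simp
    ring
  rw [e]
  exact h3

theorem continuous_kernel {c : ℝ} (h1 : c ≠ 0) (h2 : c + 1 ≠ 0) :
    Continuous fun y : ℝ => (((c : ℂ) + y * I) * ((c : ℂ) + y * I + 1))⁻¹ := by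
  refine Continuous.inv₀ (by fun_prop) (fun y => mul_ne_zero ?_ ?_)
  · exact ne_zero_of_re_ne_zero (by simpa using h1)
  · exact ne_zero_of_re_ne_zero (by simpa using h2)

theorem integrable_kernel {c : ℝ} (h1 : c ≠ 0) (h2 : c + 1 ≠ 0) :
    Integrable fun y : ℝ => (((c : ℂ) + y * I) * ((c : ℂ) + y * I + 1))⁻¹ := by
  refine integrable_vertical (H := fun w => (w * (w + 1))⁻¹)
    (K := ((1 + min |c| |c + 1|) / (min |c| |c + 1|)) ^ 2) (continuous_kernel h1 h2) (fun y => ?_)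
  have := norm_kernel_le (w := c + y * I) (d := min |c| |c + 1|)
    (lt_min (abs_pos.2 h1) (abs_pos.2 h2)) (by simp) (by simp)
  simpa using this

/-- Perron's formula with the Fejér weight: the Mellin transform of `u ↦ max 0 (1 - u)` is
`1 / (s (s + 1))`. -/
theorem integral_cpow_kernel {c x : ℝ} (hc : 0 < c) (hx : 0 < x) :
    ∫ y : ℝ, (x : ℂ) ^ ((c : ℂ) + y * I) * (((c : ℂ) + y * I) * ((c : ℂ) + y * I + 1))⁻¹ =
      2 * Real.pi * ((max 0 (1 - 1 / x) : ℝ) : ℂ) := by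
  set f : ℝ → ℂ := fun u : ℝ => Set.indicator (Ioc 0 1) (fun _ => (1 : ℂ)) u -
      Set.indicator (Ioc 0 1) (fun t : ℝ => (t : ℂ) ^ (1 : ℂ)) u with hf
  have hx' : 0 < 1 / x := by positivity
  have hfeq : ∀ u : ℝ, 0 < u → f u = ((max 0 (1 - u) : ℝ) : ℂ) := by
    intro u hu
    simp only [hf, Set.indicator, Set.mem_Ioc, hu, true_and, cpow_one]
    split_ifs with h
    · rw [max_eq_right (by linarith)]; simp
    · rw [max_eq_left (by linarith)]; simp
  have hmel : ∀ y : ℝ, mellin f ((c : ℂ) + y * I) =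
      (((c : ℂ) + y * I) * ((c : ℂ) + y * I + 1))⁻¹ := fun y =>
    (hasMellin_max_one_sub (s := (c : ℂ) + y * I) (by simpa using hc)).2
  have h := mellinInv_mellin_eq c f hx' (hasMellin_max_one_sub (by simpa using hc)).1
    (by
      unfold VerticalIntegrable
      simp_rw [hmel]
      exact integrable_kernel hc.ne' (by linarith))
    (by
      have hev : f =ᶠ[𝓝 (1 / x)] fun u => ((max 0 (1 - u) : ℝ) : ℂ) := by
        filter_upwards [lt_mem_nhds hx'] with u hu using hfeq u hu
      refine ContinuousAt.congr ?_ hev.symm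
      fun_prop)
  rw [mellinInv, hfeq _ hx'] at h
  simp_rw [hmel] at h
  have hpow : ∀ y : ℝ, ((1 / x : ℝ) : ℂ) ^ (-((c : ℂ) + y * I)) = (x : ℂ) ^ ((c : ℂ) + y * I) := by
    intro y
    rw [one_div, ofReal_inv, inv_cpow, cpow_neg, inv_inv]
    rw [arg_ofReal_of_nonneg hx.le]
    exact Real.pi_pos.ne
  simp_rw [hpow, smul_eq_mul] at h
  rw [← h]
  rw [real_smul]
  push_cast
  have hpi : (Real.pi : ℂ) ≠ 0 := by exact_mod_cast Real.pi_ne_zero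
  rw [← mul_assoc, mul_one_div_cancel (by simp), one_mul]

theorem hasMellin_sq_one_sub_div {s : ℂ} (hs : 1 < s.re) :
    HasMellin (fun u : ℝ =>
      (1 / 2 : ℂ) • Set.indicator (Ioc 0 1) (fun t : ℝ => (t : ℂ) ^ (-1 : ℂ)) u -
      Set.indicator (Ioc 0 1) (fun _ => (1 : ℂ)) u +
      (1 / 2 : ℂ) • Set.indicator (Ioc 0 1) (fun t : ℝ => (t : ℂ) ^ (1 : ℂ)) u) s
      ((s - 1) * (s * (s + 1)))⁻¹ := by
  have h0 := hasMellin_cpow_Ioc (-1) (s := s) (by simp; linarith)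
  have h1 := hasMellin_one_Ioc (s := s) (by linarith)
  have h2 := hasMellin_cpow_Ioc 1 (s := s) (by simp; linarith)
  have h3 := hasMellin_sub (h0.1.const_smul (1 / 2 : ℂ)) h1.1
  have h4 := hasMellin_add h3.1 (h2.1.const_smul (1 / 2 : ℂ))
  rw [h3.2, mellin_const_smul, mellin_const_smul, h0.2, h1.2, h2.2] at h4
  have e0 : s - 1 ≠ 0 := ne_zero_of_re_ne_zero (by simp; linarith)
  have e0' : s + -1 ≠ 0 := ne_zero_of_re_ne_zero (by simp; linarith)
  have e1 : s ≠ 0 := ne_zero_of_re_ne_zero (by linarith)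
  have e2 : s + 1 ≠ 0 := ne_zero_of_re_ne_zero (by simp; linarith)
  have e : ((s - 1) * (s * (s + 1)))⁻¹ =
      (1 / 2 : ℂ) • (1 / (s + -1)) - 1 / s + (1 / 2 : ℂ) • (1 / (s + 1)) := by
    rw [smul_eq_mul, smul_eq_mul, ← sub_eq_add_neg]
    field_simp
    ring
  rw [e]
  exact h4

theorem integrable_kernel_pole {c : ℝ} (hc : 1 < c) :
    Integrable fun y : ℝ => (((c : ℂ) + y * I - 1) *
      (((c : ℂ) + y * I) * ((c : ℂ) + y * I + 1)))⁻¹ := by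
  refine integrable_vertical (H := fun w => ((w - 1) * (w * (w + 1)))⁻¹)
    (K := (c - 1)⁻¹ * ((1 + c) / c) ^ 2) ?_ (fun y => ?_)
  · refine Continuous.inv₀ (by fun_prop) (fun y => mul_ne_zero ?_ (mul_ne_zero ?_ ?_))
    · exact ne_zero_of_re_ne_zero (by simp; linarith)
    · exact ne_zero_of_re_ne_zero (by simp; linarith)
    · exact ne_zero_of_re_ne_zero (by simp; linarith)
  · have h1 := norm_kernel_le (w := c + y * I) (d := c) (by linarith)
      (by simp [le_abs_self]) (by simp; rw [abs_of_pos (by linarith)]; linarith)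
    have h2 : ‖((c : ℂ) + y * I - 1)⁻¹‖ ≤ (c - 1)⁻¹ := by
      rw [norm_inv]
      refine inv_anti₀ (by linarith) ?_
      refine le_trans ?_ (abs_re_le_norm _)
      simp [le_abs_self]
    rw [mul_inv, norm_mul, mul_assoc]
    exact mul_le_mul h2 (by simpa using h1) (norm_nonneg _) (by positivity)

/-- The contribution of a simple pole at `1` to Perron's formula with the Fejér weight:
`1 / ((s - 1) s (s + 1))` is the Mellin transform of `u ↦ u⁻¹ (1 - u) ^ 2 / 2` on `(0, 1]`. -/
theorem integral_cpow_kernel_pole {c x : ℝ} (hc : 1 < c) (hx : 1 < x) :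
    ∫ y : ℝ, (x : ℂ) ^ ((c : ℂ) + y * I) * (((c : ℂ) + y * I - 1) *
      (((c : ℂ) + y * I) * ((c : ℂ) + y * I + 1)))⁻¹ =
      2 * Real.pi * ((x / 2 * (1 - 1 / x) ^ 2 : ℝ) : ℂ) := by
  set f : ℝ → ℂ := fun u : ℝ =>
      (1 / 2 : ℂ) • Set.indicator (Ioc 0 1) (fun t : ℝ => (t : ℂ) ^ (-1 : ℂ)) u -
      Set.indicator (Ioc 0 1) (fun _ => (1 : ℂ)) u +
      (1 / 2 : ℂ) • Set.indicator (Ioc 0 1) (fun t : ℝ => (t : ℂ) ^ (1 : ℂ)) u with hf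
  have hx0 : 0 < x := by linarith
  have hx' : 0 < 1 / x := by positivity
  have hx1 : 1 / x < 1 := by rw [div_lt_one hx0]; exact hx
  have hfeq : ∀ u : ℝ, 0 < u → u < 1 → f u = ((u⁻¹ / 2 - 1 + u / 2 : ℝ) : ℂ) := by
    intro u hu hu1
    have hm : u ∈ Ioc (0 : ℝ) 1 := ⟨hu, hu1.le⟩
    simp only [hf, Set.indicator_of_mem hm, cpow_one, cpow_neg_one, smul_eq_mul]
    push_cast
    ring
  have hmel : ∀ y : ℝ, mellin f ((c : ℂ) + y * I) =
      (((c : ℂ) + y * I - 1) * (((c : ℂ) + y * I) * ((c : ℂ) + y * I + 1)))⁻¹ := fun y =>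
    (hasMellin_sq_one_sub_div (s := (c : ℂ) + y * I) (by simpa using hc)).2
  have h := mellinInv_mellin_eq c f hx' (hasMellin_sq_one_sub_div (by simpa using hc)).1
    (by
      unfold VerticalIntegrable
      simp_rw [hmel]
      exact integrable_kernel_pole hc)
    (by
      have hev : f =ᶠ[𝓝 (1 / x)] fun u => ((u⁻¹ / 2 - 1 + u / 2 : ℝ) : ℂ) := by
        filter_upwards [lt_mem_nhds hx', gt_mem_nhds hx1] with u hu hu1 using hfeq u hu hu1
      refine ContinuousAt.congr ?_ hev.symm
      have : ContinuousAt (fun u : ℝ => u⁻¹) (1 / x) := continuousAt_inv₀ hx'.ne'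
      exact continuous_ofReal.continuousAt.comp (by fun_prop))
  rw [mellinInv, hfeq _ hx' hx1] at h
  simp_rw [hmel] at h
  have hpow : ∀ y : ℝ, ((1 / x : ℝ) : ℂ) ^ (-((c : ℂ) + y * I)) = (x : ℂ) ^ ((c : ℂ) + y * I) := by
    intro y
    rw [one_div, ofReal_inv, inv_cpow, cpow_neg, inv_inv]
    rw [arg_ofReal_of_nonneg hx0.le]
    exact Real.pi_pos.ne
  simp_rw [hpow, smul_eq_mul] at h
  have e : (x / 2 * (1 - 1 / x) ^ 2 : ℝ) = (1 / x)⁻¹ / 2 - 1 + 1 / x / 2 := by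
    field_simp; ring
  rw [e, ← h, real_smul]
  push_cast
  have hpi : (Real.pi : ℂ) ≠ 0 := by exact_mod_cast Real.pi_ne_zero
  rw [← mul_assoc, mul_one_div_cancel (by simp), one_mul]

/-- To the left of the pole `0` the kernel integrates to minus the residue. -/
theorem integral_kernel_left {a : ℝ} (ha : 0 < a) (ha2 : a ≤ 1 / 2) :
    ∫ y : ℝ, (((-a : ℝ) + y * I) * (((-a : ℝ) : ℂ) + y * I + 1))⁻¹ = -(2 * Real.pi : ℂ) := by
  have hshift := integral_vertical_eq (H := fun w => (w * (w + 1))⁻¹) (a := -(1 / 2)) (b := -a)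
    (K := ((1 + a) / a) ^ 2) (by linarith)
    (by
      intro w hw
      have h1 : w ≠ 0 := ne_zero_of_re_ne_zero (by have := hw.2; intro h; linarith)
      have h2 : w + 1 ≠ 0 := ne_zero_of_re_ne_zero (by
        have := hw.1; intro h; simp at h; linarith)
      exact DifferentiableAt.differentiableWithinAt
        (DifferentiableAt.inv (by fun_prop) (mul_ne_zero h1 h2)))
    (fun w h1 h2 => norm_kernel_le ha (by rw [abs_of_neg (by linarith)]; linarith)
      (by rw [abs_of_pos (by linarith)]; linarith))
  rw [← hshift]
  have hpt : ∀ y : ℝ, ((((-(1 / 2) : ℝ) : ℂ) + y * I) * (((-(1 / 2) : ℝ) : ℂ) + y * I + 1))⁻¹ =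
      ((-4 * (1 + (2 * y) ^ 2)⁻¹ : ℝ) : ℂ) := by
    intro y
    have h1 : ((((-(1 / 2) : ℝ) : ℂ) + y * I) * (((-(1 / 2) : ℝ) : ℂ) + y * I + 1)) =
      ((-(1 + (2 * y) ^ 2) / 4 : ℝ) : ℂ) := by
      push_cast
      linear_combination (y : ℂ) ^ 2 * I_sq
    rw [h1, ← ofReal_inv]
    congr 1
    have : (1 + (2 * y) ^ 2) ≠ 0 := by positivity
    field_simp
  simp_rw [hpt]
  rw [integral_complex_ofReal, integral_const_mul,
    Measure.integral_comp_mul_left (fun y : ℝ => (1 + y ^ 2)⁻¹) 2, integral_univ_inv_one_add_sq]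
  push_cast
  rw [abs_of_pos (by norm_num : (0 : ℝ) < 2⁻¹), smul_eq_mul]
  push_cast
  ring

/-- Perron's formula with the Fejér weight for an absolutely convergent Dirichlet series. -/
theorem integral_LSeries_kernel {f : ℕ → ℂ} {s₀ : ℂ} {c x : ℝ} (hc : 0 < c) (hx : 0 < x)
    (hs : LSeriesSummable f (s₀ + c)) :
    ∫ y : ℝ, LSeries f (s₀ + (c + y * I)) * ((x : ℂ) ^ ((c : ℂ) + y * I) *
      (((c : ℂ) + y * I) * ((c : ℂ) + y * I + 1))⁻¹) =
      2 * Real.pi * ∑ n ∈ Finset.Icc 1 ⌊x⌋₊, f n / (n : ℂ) ^ s₀ * ((1 - n / x : ℝ) : ℂ) := by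
  set F : ℕ → ℝ → ℂ := fun n y => LSeries.term f (s₀ + (c + y * I)) n *
    ((x : ℂ) ^ ((c : ℂ) + y * I) * (((c : ℂ) + y * I) * ((c : ℂ) + y * I + 1))⁻¹) with hF
  have hxc : (x : ℂ) ≠ 0 := by exact_mod_cast hx.ne'
  have hcont : ∀ n, Continuous (F n) := by
    intro n
    have hk := continuous_kernel hc.ne' (by linarith : c + 1 ≠ 0)
    refine Continuous.mul ?_ (Continuous.mul ?_ hk)
    · simp only [LSeries.term_def]
      rcases eq_or_ne n 0 with rfl | hn
      · simpa using continuous_const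
      · simp only [hn, if_false]
        have hn' : (n : ℂ) ≠ 0 := by exact_mod_cast hn
        refine Continuous.div continuous_const ?_ (fun y => by simp [cpow_eq_zero_iff, hn'])
        exact Continuous.const_cpow (by fun_prop) (Or.inl hn')
    · exact Continuous.const_cpow (by fun_prop) (Or.inl hxc)
  have hnorm : ∀ n y, ‖F n y‖ = ‖LSeries.term f (s₀ + c) n‖ * x ^ c *
      ‖(((c : ℂ) + y * I) * ((c : ℂ) + y * I + 1))⁻¹‖ := by
    intro n y
    simp only [hF, norm_mul, LSeries.norm_term_eq, norm_cpow_eq_rpow_re_of_pos hx]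
    simp [mul_assoc]
  have hint : ∀ n, Integrable (F n) := by
    intro n
    have hi := ((integrable_kernel hc.ne' (by linarith : c + 1 ≠ 0)).norm.const_mul
      (‖LSeries.term f (s₀ + c) n‖ * x ^ c))
    exact hi.mono' (hcont n).aestronglyMeasurable (Eventually.of_forall fun y => (hnorm n y).le)
  have hsum : Summable fun n => ∫ y, ‖F n y‖ := by
    simp_rw [hnorm, integral_const_mul]
    exact (hs.norm.mul_right _).mul_right _
  have key := hasSum_integral_of_summable_integral_norm hint hsum
  have htot : ∀ y, ∑' n, F n y = LSeries f (s₀ + (c + y * I)) * ((x : ℂ) ^ ((c : ℂ) + y * I) *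
      (((c : ℂ) + y * I) * ((c : ℂ) + y * I + 1))⁻¹) := fun y => by
    simp only [hF, LSeries, tsum_mul_right]
  simp_rw [htot] at key
  rw [← key.tsum_eq]
  have hterm : ∀ n : ℕ, ∫ y, F n y = if n = 0 then 0 else
      2 * Real.pi * (f n / (n : ℂ) ^ s₀ * ((max 0 (1 - n / x) : ℝ) : ℂ)) := by
    intro n
    rcases eq_or_ne n 0 with rfl | hn
    · simp [hF]
    · have hn0 : (0 : ℝ) < n := by exact_mod_cast Nat.pos_of_ne_zero hn
      have hn' : (n : ℂ) ≠ 0 := by exact_mod_cast hn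
      have hq : 0 < x / n := by positivity
      have hpt : ∀ y, F n y = f n / (n : ℂ) ^ s₀ * (((x / n : ℝ) : ℂ) ^ ((c : ℂ) + y * I) *
          (((c : ℂ) + y * I) * ((c : ℂ) + y * I + 1))⁻¹) := by
        intro y
        simp only [hF, LSeries.term_def, hn, if_false]
        rw [cpow_add _ _ hn', ofReal_div, div_cpow_ofReal_nonneg hx.le hn0.le, ofReal_natCast]
        simp only [div_eq_mul_inv, mul_inv]
        ring
      simp_rw [hpt]
      rw [integral_const_mul, integral_cpow_kernel hc hq]
      simp only [hn, if_false, one_div_div]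
      ring
  simp_rw [hterm]
  rw [tsum_eq_sum (s := Finset.Icc 1 ⌊x⌋₊), Finset.mul_sum]
  · refine Finset.sum_congr rfl fun n hn => ?_
    obtain ⟨h1, h2⟩ := Finset.mem_Icc.1 hn
    have hle : (n : ℝ) ≤ x := (Nat.le_floor_iff hx.le).1 h2
    rw [if_neg (by omega), max_eq_right]
    rw [sub_nonneg, div_le_one hx]; exact hle
  · intro n hn
    split_ifs with h0
    · rfl
    · have : x < n := by
        by_contra hcon
        exact hn (Finset.mem_Icc.2 ⟨by omega, Nat.le_floor (not_lt.1 hcon)⟩)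
      rw [max_eq_left]
      · simp
      · rw [sub_nonpos, one_le_div hx]; exact this.le

end

/-! ### Weighted sums of coefficients of Dirichlet series -/

section

open Complex Filter Topology MeasureTheory Set Metric

theorem rpow_half_mul_rpow_neg_two {v : ℝ} (hv : 0 < v) :
    v ^ (1 / 2 : ℝ) * v ^ (-2 : ℝ) = v ^ (-(3 / 2) : ℝ) := by
  rw [← Real.rpow_add hv]; norm_num

/-- The Fejér-weighted partial sums of the coefficients of a Dirichlet series which, up to a pole
at `1`, continues with moderate growth to `b ≤ Re s`. -/
theorem norm_sum_fejer_sub_le {f : ℕ → ℂ} {D : ℂ → ℂ} {κ : ℂ} {b K x : ℝ} (hb : 1 / 2 ≤ b)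
    (hb1 : b ≤ 1) (hD : DifferentiableOn ℂ D {s | b ≤ s.re})
    (hK : ∀ s : ℂ, b ≤ s.re → s.re ≤ 4 → ‖D s‖ ≤ K * (1 + |s.im|) ^ (1 / 2 : ℝ)) (hK0 : 0 ≤ K)
    (hs : ∀ s : ℂ, 1 < s.re → LSeriesSummable f s)
    (hL : ∀ s : ℂ, 1 < s.re → D s = LSeries f s - κ / (s - 1)) (hx : 1 < x) :
    ‖∑ n ∈ Finset.Icc 1 ⌊x⌋₊, f n * ((1 - n / x : ℝ) : ℂ) -
      κ * ((x / 2 * (1 - 1 / x) ^ 2 : ℝ) : ℂ)‖ ≤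
      9 * (∫ y : ℝ, (1 + |y|) ^ (-(3 / 2) : ℝ)) * K * x ^ b := by
  have hx0 : 0 < x := by linarith
  have hxc : (x : ℂ) ≠ 0 := by exact_mod_cast hx0.ne'
  set J := ∫ y : ℝ, (1 + |y|) ^ (-(3 / 2) : ℝ) with hJ
  have hJ0 : 0 ≤ J := integral_nonneg fun y => by positivity
  set H : ℂ → ℂ := fun s => D s * ((x : ℂ) ^ s * (s * (s + 1))⁻¹) with hH
  have hbd : ∀ s : ℂ, b ≤ s.re → s.re ≤ 4 →
      ‖H s‖ ≤ 9 * K * x ^ s.re * (1 + |s.im|) ^ (-(3 / 2) : ℝ) := by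
    intro s h1 h2
    have hv : 0 < 1 + |s.im| := by positivity
    have hk := norm_inv_mul_add_one_le (w := s) (d := b) (by linarith)
      (by rw [abs_of_pos (by linarith)]; exact h1) (by rw [abs_of_pos (by linarith)]; linarith)
    have hc : ((1 + b) / b) ^ 2 ≤ 9 := by
      have : (1 + b) / b ≤ 3 := by rw [div_le_iff₀ (by linarith)]; linarith
      have h0 : 0 ≤ (1 + b) / b := div_nonneg (by linarith) (by linarith)
      nlinarith
    have hk' : ‖(s * (s + 1))⁻¹‖ ≤ 9 * (1 + |s.im|) ^ (-2 : ℝ) := hk.trans (by gcongr)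
    simp only [hH, norm_mul, norm_cpow_eq_rpow_re_of_pos hx0]
    rw [← rpow_half_mul_rpow_neg_two hv]
    calc ‖D s‖ * (x ^ s.re * ‖(s * (s + 1))⁻¹‖)
        ≤ (K * (1 + |s.im|) ^ (1 / 2 : ℝ)) * (x ^ s.re * (9 * (1 + |s.im|) ^ (-2 : ℝ))) := by
          gcongr
          exact hK s h1 h2
      _ = _ := by ring
  have hdiff : DifferentiableOn ℂ H {w | b ≤ w.re ∧ w.re ≤ 2} := by
    refine (hD.mono fun w hw => hw.1).mul ?_
    intro w hw
    have h1 : w ≠ 0 := ne_zero_of_re_ne_zero (by have := hw.1; intro h; linarith)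
    have h2 : w + 1 ≠ 0 := ne_zero_of_re_ne_zero (by have := hw.1; intro h; simp at h; linarith)
    refine DifferentiableAt.differentiableWithinAt (DifferentiableAt.mul ?_ ?_)
    · exact (differentiableAt_id).const_cpow (Or.inl hxc)
    · exact DifferentiableAt.inv (by fun_prop) (mul_ne_zero h1 h2)
  have hshift := integral_vertical_eq (H := H) (a := b) (b := 2) (K := 9 * K * x ^ (2 : ℝ))
    (by linarith) hdiff (fun w h1 h2 => (hbd w h1 (by linarith)).trans (by
      gcongr
      exact hx.le))
  have hleft : ‖∫ y : ℝ, H (b + y * I)‖ ≤ 9 * K * x ^ b * J := by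
    refine norm_integral_vertical_le fun y => ?_
    simpa using hbd (b + y * I) (by simp) (by simp; linarith)
  -- on the line `Re s = 2` the integral is evaluated termwise
  have hi1 : Integrable fun y : ℝ => H ((2 : ℝ) + y * I) := by
    refine integrable_vertical (K := 9 * K * x ^ (2 : ℝ)) ?_ (fun y => ?_)
    · exact hdiff.continuousOn.comp_continuous (by fun_prop) (fun y => by simp; linarith)
    · simpa using hbd ((2 : ℝ) + y * I) (by simp; linarith) (by simp; norm_num)
  have hi2 : Integrable fun y : ℝ => κ * ((x : ℂ) ^ (((2 : ℝ) : ℂ) + y * I) *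
      ((((2 : ℝ) : ℂ) + y * I - 1) *
        ((((2 : ℝ) : ℂ) + y * I) * (((2 : ℝ) : ℂ) + y * I + 1)))⁻¹) := by
    refine Integrable.const_mul ?_ κ
    refine ((integrable_kernel_pole (c := 2) (by norm_num)).norm.const_mul
      (x ^ (2 : ℝ))).mono' ?_ ?_
    · refine (Continuous.aestronglyMeasurable ?_).mul
        (integrable_kernel_pole (c := 2) (by norm_num)).aestronglyMeasurable
      exact Continuous.const_cpow (by fun_prop) (Or.inl hxc)
    · refine Eventually.of_forall fun y => ?_
      rw [norm_mul, norm_cpow_eq_rpow_re_of_pos hx0]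
      simp
  have hP := integral_LSeries_kernel (f := f) (s₀ := 0) (c := 2) (x := x) (by norm_num) hx0
    (hs _ (by simp))
  have hQ := integral_cpow_kernel_pole (c := 2) (by norm_num) hx
  have hsplit : ∫ y : ℝ, LSeries f (0 + (((2 : ℝ) : ℂ) + y * I)) *
      ((x : ℂ) ^ (((2 : ℝ) : ℂ) + y * I) *
      ((((2 : ℝ) : ℂ) + y * I) * (((2 : ℝ) : ℂ) + y * I + 1))⁻¹) =
      (∫ y : ℝ, H ((2 : ℝ) + y * I)) + κ * (2 * Real.pi * ((x / 2 * (1 - 1 / x) ^ 2 : ℝ) : ℂ)) := by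
    rw [← hQ, ← integral_const_mul, ← integral_add hi1 hi2]
    refine integral_congr_ae (Eventually.of_forall fun y => ?_)
    simp only [hH]
    rw [hL _ (by simp), zero_add, mul_inv (((2 : ℝ) : ℂ) + y * I - 1), div_eq_mul_inv]
    ring
  rw [hP, ← hshift] at hsplit
  have hpi : (2 * Real.pi : ℂ) ≠ 0 := by simp
  simp only [cpow_zero, div_one] at hsplit
  have hfin : ∑ n ∈ Finset.Icc 1 ⌊x⌋₊, f n * ((1 - n / x : ℝ) : ℂ) -
      κ * ((x / 2 * (1 - 1 / x) ^ 2 : ℝ) : ℂ) = (2 * Real.pi : ℂ)⁻¹ * ∫ y : ℝ, H (b + y * I) := by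
    rw [eq_inv_mul_iff_mul_eq₀ hpi]
    linear_combination hsplit
  rw [hfin, norm_mul]
  have hp1 : ‖(2 * Real.pi : ℂ)⁻¹‖ ≤ 1 := by
    rw [norm_inv]
    refine inv_le_one_of_one_le₀ ?_
    have := Real.pi_gt_three
    simp only [norm_mul, norm_ofNat, norm_real, Real.norm_eq_abs, abs_of_pos Real.pi_pos]
    linarith
  calc _ ≤ 1 * (9 * K * x ^ b * J) := by gcongr
    _ = _ := by ring

/-- The Fejér-weighted approximation of a Dirichlet series to the left of its half plane of
convergence. -/
theorem norm_sum_cpow_fejer_sub_le {f : ℕ → ℂ} {D : ℂ → ℂ} {a b K x : ℝ} {s₀ : ℂ} (ha : 0 < a)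
    (ha2 : a ≤ 1 / 2) (hb : 1 / 2 ≤ b) (hD : DifferentiableOn ℂ D {s | b ≤ s.re})
    (hK : ∀ s : ℂ, b ≤ s.re → s.re ≤ 4 → ‖D s‖ ≤ K * (1 + |s.im|) ^ (1 / 2 : ℝ)) (hK0 : 0 ≤ K)
    (hs : ∀ s : ℂ, 1 < s.re → LSeriesSummable f s)
    (hL : ∀ s : ℂ, 1 < s.re → D s = LSeries f s) (hs₀ : b + a ≤ s₀.re) (hs₀' : s₀.re ≤ 3)
    (hx : 0 < x) :
    ‖∑ n ∈ Finset.Icc 1 ⌊x⌋₊, f n / (n : ℂ) ^ s₀ * ((1 - n / x : ℝ) : ℂ) - D s₀‖ ≤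
      ((1 + a) / a) ^ 2 * (∫ y : ℝ, (1 + |y|) ^ (-(3 / 2) : ℝ)) * (1 + |s₀.im|) ^ (1 / 2 : ℝ) *
        K * x ^ (-a) := by
  have hxc : (x : ℂ) ≠ 0 := by exact_mod_cast hx.ne'
  set J := ∫ y : ℝ, (1 + |y|) ^ (-(3 / 2) : ℝ) with hJ
  have hJ0 : 0 ≤ J := integral_nonneg fun y => by positivity
  set A := ((1 + a) / a) ^ 2 with hA
  set B := (1 + |s₀.im|) ^ (1 / 2 : ℝ) with hB
  set g : ℂ → ℂ := fun w => D (s₀ + w) * (x : ℂ) ^ w with hg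
  have hgb : ∀ w : ℂ, -a ≤ w.re → w.re ≤ 1 →
      ‖g w‖ ≤ B * K * x ^ w.re * (1 + |w.im|) ^ (1 / 2 : ℝ) := by
    intro w h1 h2
    have h3 := hK (s₀ + w) (by simp; linarith) (by simp; linarith)
    have h4 : (1 + |(s₀ + w).im|) ^ (1 / 2 : ℝ) ≤ B * (1 + |w.im|) ^ (1 / 2 : ℝ) := by
      rw [hB, ← Real.mul_rpow (by positivity) (by positivity)]
      refine Real.rpow_le_rpow (by positivity) ?_ (by norm_num)
      have := abs_add_le s₀.im w.im
      rw [add_im]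
      nlinarith [abs_nonneg s₀.im, abs_nonneg w.im]
    simp only [hg, norm_mul, norm_cpow_eq_rpow_re_of_pos hx]
    calc ‖D (s₀ + w)‖ * x ^ w.re ≤ (K * (B * (1 + |w.im|) ^ (1 / 2 : ℝ))) * x ^ w.re := by
          gcongr
          exact h3.trans (by gcongr)
      _ = _ := by ring
  have hgd : DifferentiableOn ℂ g {w | -a ≤ w.re} := by
    intro w hw
    refine DifferentiableWithinAt.mul ?_
      (DifferentiableAt.differentiableWithinAt (differentiableAt_id.const_cpow (Or.inl hxc)))
    refine DifferentiableWithinAt.comp w (t := {s | b ≤ s.re}) (hD _ ?_) (by fun_prop) ?_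
    · have : -a ≤ w.re := hw
      simp only [mem_ofPred_eq, add_re]; linarith
    · intro v hv
      have : -a ≤ v.re := hv
      simp only [mem_ofPred_eq, add_re]; linarith
  have hnhds : {w : ℂ | -a ≤ w.re} ∈ 𝓝 (0 : ℂ) := by
    refine mem_of_superset ((isOpen_lt continuous_const continuous_re).mem_nhds
      (show (0 : ℂ) ∈ {w : ℂ | -a < w.re} by simpa using ha)) fun w hw => ?_
    exact le_of_lt (show -a < w.re from hw)
  have hg0 : g 0 = D s₀ := by simp [hg]
  -- subtracting the value at `0` removes the pole of the kernel, so no residue theorem is needed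
  set H : ℂ → ℂ := fun w => dslope g 0 w * (w + 1)⁻¹ with hH
  have hHeq : ∀ w : ℂ, w ≠ 0 → H w = g w * (w * (w + 1))⁻¹ - D s₀ * (w * (w + 1))⁻¹ := by
    intro w hw
    simp only [hH, dslope_of_ne _ hw, slope_def_field, hg0, sub_zero, mul_inv]
    field_simp
  have hdiff : DifferentiableOn ℂ H {w | -a ≤ w.re ∧ w.re ≤ 1} := by
    refine DifferentiableOn.mul
      (((differentiableOn_dslope hnhds).2 hgd).mono fun w hw => hw.1) ?_
    intro w hw
    have h2 : w + 1 ≠ 0 := ne_zero_of_re_ne_zero (by have := hw.1; intro h; simp at h; linarith)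
    have h3 : DifferentiableAt ℂ (fun v : ℂ => (v + 1)⁻¹) w := by
      fun_prop (disch := assumption)
    exact h3.differentiableWithinAt
  have hfar : ∀ w : ℂ, -a ≤ w.re → w.re ≤ 1 → 1 ≤ |w.im| →
      ‖H w‖ ≤ 4 * (B * K * max (x ^ (1 : ℝ)) (x ^ (-a)) + ‖D s₀‖) *
        (1 + |w.im|) ^ (-(3 / 2) : ℝ) := by
    intro w h1 h2 h3
    have hw0 : w ≠ 0 := by
      rintro rfl; simp at h3; linarith
    have hv : 0 < 1 + |w.im| := by positivity
    have hxm : x ^ w.re ≤ max (x ^ (1 : ℝ)) (x ^ (-a)) := by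
      rcases le_total 1 x with h | h
      · exact le_max_of_le_left (Real.rpow_le_rpow_of_exponent_le h h2)
      · exact le_max_of_le_right (Real.rpow_le_rpow_of_exponent_ge hx h h1)
    have hker : ‖(w * (w + 1))⁻¹‖ ≤ 4 * (1 + |w.im|) ^ (-2 : ℝ) := by
      have e1 := abs_im_le_norm w
      have e2 : |w.im| ≤ ‖w + 1‖ := by simpa using abs_im_le_norm (w + 1)
      rw [Real.rpow_neg hv.le, Real.rpow_two, norm_inv, norm_mul, ← div_eq_mul_inv, inv_eq_one_div,
        div_le_div_iff₀ (mul_pos (by linarith) (by linarith)) (by positivity)]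
      nlinarith [mul_le_mul e1 e2 (abs_nonneg _) (norm_nonneg _)]
    rw [hHeq w hw0, ← sub_mul, norm_mul]
    have hone : 1 ≤ (1 + |w.im|) ^ (1 / 2 : ℝ) :=
      Real.one_le_rpow (by linarith [abs_nonneg w.im]) (by norm_num)
    rw [← rpow_half_mul_rpow_neg_two hv]
    calc ‖g w - D s₀‖ * ‖(w * (w + 1))⁻¹‖
        ≤ (B * K * max (x ^ (1 : ℝ)) (x ^ (-a)) * (1 + |w.im|) ^ (1 / 2 : ℝ) +
          ‖D s₀‖ * (1 + |w.im|) ^ (1 / 2 : ℝ)) * (4 * (1 + |w.im|) ^ (-2 : ℝ)) := by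
          gcongr
          refine (norm_sub_le _ _).trans (add_le_add ((hgb w h1 h2).trans (by gcongr)) ?_)
          exact le_mul_of_one_le_right (norm_nonneg _) hone
      _ = _ := by ring
  have hcpt : IsCompact (Icc (-a) 1 ×ℂ Icc (-1) 1) := isCompact_Icc.reProdIm isCompact_Icc
  obtain ⟨M, hM⟩ := hcpt.exists_bound_of_continuousOn
    (hdiff.continuousOn.mono fun w hw => ⟨hw.1.1, hw.1.2⟩)
  set K₁ := max (4 * (B * K * max (x ^ (1 : ℝ)) (x ^ (-a)) + ‖D s₀‖)) (4 * |M|) with hK₁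
  have hall : ∀ w : ℂ, -a ≤ w.re → w.re ≤ 1 → ‖H w‖ ≤ K₁ * (1 + |w.im|) ^ (-(3 / 2) : ℝ) := by
    intro w h1 h2
    rcases le_total 1 |w.im| with h3 | h3
    · refine (hfar w h1 h2 h3).trans ?_
      gcongr
      exact le_max_left _ _
    · have h4 := hM w ⟨⟨h1, h2⟩, abs_le.1 h3⟩
      have h5 : (1 / 4 : ℝ) ≤ (1 + |w.im|) ^ (-(3 / 2) : ℝ) := by
        have : (2 : ℝ) ^ (-(2 : ℝ)) ≤ (1 + |w.im|) ^ (-(3 / 2) : ℝ) := by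
          calc (2 : ℝ) ^ (-(2 : ℝ)) ≤ (1 + |w.im|) ^ (-(2 : ℝ)) :=
                Real.rpow_le_rpow_of_nonpos (by positivity) (by linarith) (by norm_num)
            _ ≤ _ := Real.rpow_le_rpow_of_exponent_le (by linarith [abs_nonneg w.im]) (by norm_num)
        refine le_trans (le_of_eq ?_) this
        rw [Real.rpow_neg (by norm_num), Real.rpow_two]; norm_num
      calc ‖H w‖ ≤ 4 * |M| * (1 / 4) := by linarith [le_abs_self M]
        _ ≤ K₁ * (1 + |w.im|) ^ (-(3 / 2) : ℝ) := by
          gcongr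
          exact le_max_right _ _
  have hshift := integral_vertical_eq (H := H) (a := -a) (b := 1) (by linarith) hdiff hall
  have hne1 : ∀ y : ℝ, (((1 : ℝ) : ℂ) + y * I) ≠ 0 := fun y =>
    ne_zero_of_re_ne_zero (by simp)
  have hnea : ∀ y : ℝ, (((-a : ℝ) : ℂ) + y * I) ≠ 0 := fun y =>
    ne_zero_of_re_ne_zero (by simpa using ha.ne')
  have hgk : ∀ c : ℝ, -a ≤ c → c ≤ 1 → c ≠ 0 →
      (∀ y : ℝ, ‖g (c + y * I) * (((c : ℂ) + y * I) * ((c : ℂ) + y * I + 1))⁻¹‖ ≤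
        ((1 + min |c| (1 / 2)) / min |c| (1 / 2)) ^ 2 * (B * K * x ^ c) *
          (1 + |y|) ^ (-(3 / 2) : ℝ)) := by
    intro c h1 h2 h3 y
    have hv : 0 < 1 + |y| := by positivity
    have e1 := norm_inv_mul_add_one_le (w := c + y * I) (d := min |c| (1 / 2))
      (lt_min (abs_pos.2 h3) (by norm_num)) (by simp)
      (by simp only [add_re, ofReal_re, mul_re, I_re, mul_zero, ofReal_im, I_im, mul_one, sub_self,
            add_zero]
          rw [abs_of_pos (by linarith : 0 < c + 1)]
          exact (min_le_right _ _).trans (by linarith))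
    have e2 := hgb (c + y * I) (by simpa using h1) (by simpa using h2)
    simp only [add_re, ofReal_re, mul_re, I_re, mul_zero, ofReal_im, I_im, mul_one, sub_self,
      add_zero, add_im, mul_im, zero_add] at e1 e2
    rw [norm_mul, ← rpow_half_mul_rpow_neg_two hv]
    calc _ ≤ (B * K * x ^ c * (1 + |y|) ^ (1 / 2 : ℝ)) *
          (((1 + min |c| (1 / 2)) / min |c| (1 / 2)) ^ 2 * (1 + |y|) ^ (-2 : ℝ)) := by gcongr
      _ = _ := by ring
  have hgki : ∀ c : ℝ, -a ≤ c → c ≤ 1 → c ≠ 0 → Integrable fun y : ℝ =>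
      g (c + y * I) * (((c : ℂ) + y * I) * ((c : ℂ) + y * I + 1))⁻¹ := by
    intro c h1 h2 h3
    refine integrable_vertical (H := fun w => g w * (w * (w + 1))⁻¹) ?_ (hgk c h1 h2 h3)
    refine Continuous.mul ?_ (continuous_kernel h3 (by linarith))
    exact hgd.continuousOn.comp_continuous (by fun_prop) (fun y => by simpa using h1)
  have hR : ∫ y : ℝ, H ((1 : ℝ) + y * I) = 2 * Real.pi *
      ∑ n ∈ Finset.Icc 1 ⌊x⌋₊, f n / (n : ℂ) ^ s₀ * ((1 - n / x : ℝ) : ℂ) := by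
    have hP := integral_LSeries_kernel (f := f) (s₀ := s₀) (c := 1) (x := x) (by norm_num) hx
      (hs _ (by simp; linarith))
    have hQ := integral_cpow_kernel (c := 1) (x := 1) (by norm_num) (by norm_num)
    simp only [ofReal_one, one_cpow, one_mul] at hQ
    rw [← hP]
    simp_rw [fun y : ℝ => hHeq _ (hne1 y)]
    rw [integral_sub (hgki 1 (by linarith) le_rfl one_ne_zero)
      ((integrable_kernel (c := 1) (by norm_num) (by norm_num)).const_mul _), integral_const_mul]
    simp only [ofReal_one]
    rw [hQ]
    simp only [ne_eq, one_ne_zero, not_false_eq_true, div_self, sub_self, max_self, ofReal_zero,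
      mul_zero, sub_zero, hg]
    refine integral_congr_ae (Eventually.of_forall fun y => ?_)
    simp only
    rw [hL _ (by simp; linarith), mul_assoc]
  have hLft : ∫ y : ℝ, H ((-a : ℝ) + y * I) =
      (∫ y : ℝ, g ((-a : ℝ) + y * I) * ((((-a : ℝ) : ℂ) + y * I) *
        (((-a : ℝ) : ℂ) + y * I + 1))⁻¹) + 2 * Real.pi * D s₀ := by
    simp_rw [fun y : ℝ => hHeq _ (hnea y)]
    rw [integral_sub (hgki (-a) le_rfl (by linarith) (by linarith))
      ((integrable_kernel (c := -a) (by linarith) (by linarith)).const_mul _), integral_const_mul,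
      integral_kernel_left ha ha2]
    ring
  rw [hLft, hR] at hshift
  have hpi : (2 * Real.pi : ℂ) ≠ 0 := by simp
  have hfin : ∑ n ∈ Finset.Icc 1 ⌊x⌋₊, f n / (n : ℂ) ^ s₀ * ((1 - n / x : ℝ) : ℂ) - D s₀ =
      (2 * Real.pi : ℂ)⁻¹ * ∫ y : ℝ, g ((-a : ℝ) + y * I) * ((((-a : ℝ) : ℂ) + y * I) *
        (((-a : ℝ) : ℂ) + y * I + 1))⁻¹ := by
    rw [eq_inv_mul_iff_mul_eq₀ hpi]
    linear_combination -hshift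
  have hp1 : ‖(2 * Real.pi : ℂ)⁻¹‖ ≤ 1 := by
    rw [norm_inv]
    refine inv_le_one_of_one_le₀ ?_
    have := Real.pi_gt_three
    simp only [norm_mul, norm_ofNat, norm_real, Real.norm_eq_abs, abs_of_pos Real.pi_pos]
    linarith
  have hlast := norm_integral_vertical_le (H := fun w => g w * (w * (w + 1))⁻¹)
    (hgk (-a) le_rfl (by linarith) (by linarith))
  rw [abs_neg, abs_of_pos ha, min_eq_left ha2] at hlast
  rw [hfin, norm_mul]
  calc _ ≤ 1 * (A * (B * K * x ^ (-a)) * J) := by gcongr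
    _ = _ := by ring

end

/-! ### Growth of Dirichlet `L`-functions to the right of `0` -/

section

open Complex Filter Topology MeasureTheory Set Metric

/-- A bounded function supported on `[1, ∞)` has a Mellin transform that is holomorphic in the left
half plane; it continues `L(s, χ)` and `(s - 1) ζ(s)` to `0 < Re s` by partial summation. -/
theorem differentiableAt_mellin_neg {g : ℝ → ℂ} {B : ℝ} (hg : Measurable g) (hB : ∀ t, ‖g t‖ ≤ B)
    (h0 : ∀ t, t < 1 → g t = 0) {s : ℂ} (hs : 0 < s.re) :
    DifferentiableAt ℂ (fun s => mellin g (-s)) s := by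
  have hm : DifferentiableAt ℂ (mellin g) (-s) := by
    refine mellin_differentiableAt_of_isBigO_rpow (a := 0) (b := (-s).re - 1) ?_ ?_ (by simpa)
      ?_ (by linarith)
    · refine LocallyIntegrable.locallyIntegrableOn ?_ _
      exact (locallyIntegrable_const B).mono hg.aestronglyMeasurable
        (Eventually.of_forall fun t => (hB t).trans (le_abs_self B))
    · refine Asymptotics.IsBigO.of_bound B (Eventually.of_forall fun t => ?_)
      simpa using hB t
    · have : g =ᶠ[𝓝[>] 0] fun _ => 0 := by
        filter_upwards [nhdsWithin_le_nhds (gt_mem_nhds (zero_lt_one (α := ℝ)))] with t ht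
          using h0 t ht
      exact this.trans_isBigO (Asymptotics.isBigO_zero _ _)
  have hc : DifferentiableAt ℂ (mellin g ∘ fun s => -s) s := hm.comp s (by fun_prop)
  exact hc

theorem mellin_neg_eq {g : ℝ → ℂ} (h0 : ∀ t, t < 1 → g t = 0) (s : ℂ) :
    mellin g (-s) = ∫ t in Ioi (1 : ℝ), g t * (t : ℂ) ^ (-(s + 1)) := by
  rw [mellin, ← integral_indicator measurableSet_Ioi, ← integral_indicator measurableSet_Ioi]
  refine integral_congr_ae ?_
  have h1 : ∀ᵐ t : ℝ, t ≠ 1 := by simp [ae_iff]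
  filter_upwards [h1] with t ht1
  by_cases h : 1 < t
  · rw [indicator_of_mem (show t ∈ Ioi (0 : ℝ) from by simp only [mem_Ioi]; linarith),
      indicator_of_mem (show t ∈ Ioi (1 : ℝ) from h), smul_eq_mul, mul_comm]
    congr 2; ring
  · rw [indicator_of_notMem (show t ∉ Ioi (1 : ℝ) from h)]
    by_cases h2 : 0 < t
    · rw [indicator_of_mem (show t ∈ Ioi (0 : ℝ) from h2),
        h0 t (lt_of_le_of_ne (not_lt.1 h) ht1), smul_zero]
    · rw [indicator_of_notMem (show t ∉ Ioi (0 : ℝ) from h2)]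

theorem norm_mellin_neg_le {g : ℝ → ℂ} {B : ℝ} (hB : ∀ t, ‖g t‖ ≤ B)
    (h0 : ∀ t, t < 1 → g t = 0) {s : ℂ} (hs : 0 < s.re) : ‖mellin g (-s)‖ ≤ B / s.re := by
  rw [mellin_neg_eq h0]
  have hi : IntegrableOn (fun t : ℝ => B * t ^ (-(s.re + 1))) (Ioi 1) :=
    (integrableOn_Ioi_rpow_of_lt (by linarith) one_pos).const_mul B
  have := norm_integral_le_of_norm_le (f := fun t : ℝ => g t * (t : ℂ) ^ (-(s + 1))) hi (by
    filter_upwards [ae_restrict_mem measurableSet_Ioi] with t ht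
    have ht' : (0 : ℝ) < t := lt_trans one_pos ht
    rw [norm_mul, norm_cpow_eq_rpow_re_of_pos ht']
    simp only [neg_re, add_re, one_re]
    gcongr
    exact hB t)
  refine this.trans (le_of_eq ?_)
  rw [integral_const_mul, integral_Ioi_rpow_of_lt (by linarith) one_pos, Real.one_rpow]
  have : -(s.re + 1) + 1 = -s.re := by ring
  rw [this, neg_div_neg_eq, mul_one_div]

theorem eqOn_re_pos_of_eqOn {F G : ℂ → ℂ} (hF : DifferentiableOn ℂ F {s | 0 < s.re})
    (hG : DifferentiableOn ℂ G {s | 0 < s.re}) (h : ∀ s : ℂ, 1 < s.re → F s = G s) {s : ℂ}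
    (hs : 0 < s.re) : F s = G s := by
  have hop : IsOpen {s : ℂ | 0 < s.re} := isOpen_lt continuous_const continuous_re
  refine (hF.analyticOnNhd hop).eqOn_of_preconnected_of_eventuallyEq (hG.analyticOnNhd hop)
    (convex_halfSpace_re_gt 0).isPreconnected (z₀ := 2) (by simp) ?_ hs
  filter_upwards [(isOpen_lt continuous_const continuous_re).mem_nhds
    (show (2 : ℂ) ∈ {s : ℂ | 1 < s.re} by simp)] with z hz using h z hz

section PartialSums

variable {N : ℕ} [NeZero N]

theorem sum_range_periodic (f : ZMod N → ℂ) (n : ℕ) :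
    ∑ k ∈ Finset.range N, f ((n + k : ℕ) : ZMod N) = ∑ a, f a := by
  obtain ⟨m, rfl⟩ : ∃ m, N = m + 1 := ⟨N - 1, (Nat.succ_pred (NeZero.ne N)).symm⟩
  rw [Finset.sum_range, ← Equiv.sum_comp (Equiv.addLeft ((n : ℕ) : ZMod (m + 1)))]
  refine Finset.sum_congr rfl fun i _ => ?_
  simp only [Equiv.coe_addLeft, Nat.cast_add]
  congr 2
  exact Fin.cast_val_eq_self i

/-- Complete periods of a nonprincipal character cancel. -/
theorem norm_sum_range_dirichletCharacter_le {χ : DirichletCharacter ℂ N} (hχ : χ ≠ 1) (n : ℕ) :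
    ‖∑ k ∈ Finset.range n, χ (k : ZMod N)‖ ≤ N := by
  induction n using Nat.strong_induction_on with
  | _ n ih =>
    rcases le_or_gt n N with h | h
    · refine (norm_sum_le _ _).trans ?_
      refine (Finset.sum_le_sum fun k _ => χ.norm_le_one _).trans ?_
      simpa using h
    · have := ih (n - N) (Nat.sub_lt (by omega) (Nat.pos_of_neZero N))
      have e : n = (n - N) + N := by omega
      rw [e, Finset.sum_range_add, sum_range_periodic (fun a => χ a),
        MulChar.sum_eq_zero_of_ne_one hχ, add_zero]
      exact this

theorem norm_sum_Icc_dirichletCharacter_le {χ : DirichletCharacter ℂ N} (hχ : χ ≠ 1) (n : ℕ) :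
    ‖∑ k ∈ Finset.Icc 1 n, χ (k : ZMod N)‖ ≤ N := by
  have hN : N ≠ 1 := by
    rintro rfl
    exact hχ (Subsingleton.elim _ _)
  have h0 : χ (0 : ZMod N) = 0 := by
    have : Nontrivial (ZMod N) := ZMod.nontrivial_iff.2 hN
    exact χ.map_zero
  have : ∑ k ∈ Finset.Icc 1 n, χ (k : ZMod N) = ∑ k ∈ Finset.range (n + 1), χ (k : ZMod N) := by
    rw [Finset.range_eq_Ico, Finset.sum_eq_sum_Ico_succ_bot (by omega)]
    simp only [Nat.cast_zero, h0, zero_add]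
    rfl
  rw [this]
  exact norm_sum_range_dirichletCharacter_le hχ _

theorem measurable_comp_floor (S : ℕ → ℂ) : Measurable fun t : ℝ => S ⌊t⌋₊ :=
  (measurable_from_nat (f := S)).comp Nat.measurable_floor

/-- The trivial bound for a nonprincipal Dirichlet `L`-function, by partial
summation. -/
theorem norm_LFunction_le {χ : DirichletCharacter ℂ N} (hχ : χ ≠ 1) {s : ℂ} (hs : 0 < s.re) :
    ‖DirichletCharacter.LFunction χ s‖ ≤ ‖s‖ * (N / s.re) := by
  set g : ℝ → ℂ := fun t => ∑ k ∈ Finset.Icc 1 ⌊t⌋₊, χ (k : ZMod N) with hg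
  have hm : Measurable g := measurable_comp_floor fun n => ∑ k ∈ Finset.Icc 1 n, χ (k : ZMod N)
  have hB : ∀ t, ‖g t‖ ≤ N := fun t => norm_sum_Icc_dirichletCharacter_le hχ _
  have h0 : ∀ t, t < 1 → g t = 0 := fun t ht => by simp [hg, Nat.floor_eq_zero.2 ht]
  have heq : ∀ z : ℂ, 1 < z.re → DirichletCharacter.LFunction χ z = z * mellin g (-z) := by
    intro z hz
    rw [DirichletCharacter.LFunction_eq_LSeries χ hz, mellin_neg_eq h0]
    refine LSeries_eq_mul_integral _ (r := 0) le_rfl (by linarith)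
      (DirichletCharacter.LSeriesSummable_of_one_lt_re χ hz) ?_
    refine Asymptotics.IsBigO.of_bound N (Eventually.of_forall fun n => ?_)
    simpa using norm_sum_Icc_dirichletCharacter_le hχ n
  have h := eqOn_re_pos_of_eqOn (F := DirichletCharacter.LFunction χ)
    (G := fun z => z * mellin g (-z))
    (DirichletCharacter.differentiable_LFunction hχ).differentiableOn
    (fun z hz => (differentiableAt_id.mul
      (differentiableAt_mellin_neg hm hB h0 hz)).differentiableWithinAt) heq hs
  rw [h, norm_mul]
  gcongr
  exact norm_mellin_neg_le hB h0 hs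

end PartialSums

/-- The bound for `(s - 1) ζ(s)` that corresponds to `norm_LFunction_le`, from
`ζ(s) = s / (s - 1) - s ∫ {t} t ^ (-s - 1) dt`. -/
theorem norm_riemannZeta₁_le {s : ℂ} (hs : 0 < s.re) :
    ‖riemannZeta₁ s‖ ≤ ‖s‖ + ‖s‖ * ‖s - 1‖ / s.re := by
  set g : ℝ → ℂ := fun t => if t < 1 then 0 else (⌊t⌋₊ : ℂ) - t with hg
  have hm : Measurable g := by
    refine Measurable.ite measurableSet_Iio measurable_const (Measurable.sub ?_ (by fun_prop))
    exact measurable_comp_floor fun n => (n : ℂ)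
  have hB : ∀ t, ‖g t‖ ≤ 1 := by
    intro t
    simp only [hg]
    split_ifs with h
    · simp
    · have h0 : 0 ≤ t := by linarith
      have h1 := Nat.floor_le h0
      have h2 := (Nat.lt_floor_add_one t).le
      have : ((⌊t⌋₊ : ℂ) - t) = (((⌊t⌋₊ : ℝ) - t : ℝ) : ℂ) := by push_cast; rfl
      rw [this, norm_real, Real.norm_eq_abs, abs_le]
      constructor <;> linarith
  have h0 : ∀ t, t < 1 → g t = 0 := fun t ht => by simp [hg, ht]
  have heq : ∀ z : ℂ, 1 < z.re → riemannZeta₁ z = z + z * (z - 1) * mellin g (-z) := by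
    intro z hz
    have hz1 : z ≠ 1 := by rintro rfl; simp at hz
    have hz0 : z ≠ 0 := ne_zero_of_re_ne_zero (by linarith)
    have hz1' : z - 1 ≠ 0 := sub_ne_zero.2 hz1
    have hI := LSeries_eq_mul_integral' (fun _ => (1 : ℂ)) (r := 1) zero_le_one hz (by
      refine Asymptotics.IsBigO.of_bound 1 (Eventually.of_forall fun n => ?_)
      simp)
    have hζ : LSeries (fun _ => (1 : ℂ)) z = riemannZeta z := LSeries_one_eq_riemannZeta hz
    have hint1 : IntegrableOn (fun t : ℝ => (t : ℂ) ^ (-z)) (Ioi 1) :=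
      integrableOn_Ioi_cpow_of_lt (by simpa using hz) one_pos
    have hint2 : IntegrableOn (fun t : ℝ => g t * (t : ℂ) ^ (-(z + 1))) (Ioi 1) := by
      have := (integrableOn_Ioi_cpow_of_lt (a := -(z + 1)) (by simp; linarith) one_pos)
      refine Integrable.mono' this.norm ?_ ?_
      · exact hm.aestronglyMeasurable.mul this.aestronglyMeasurable
      · refine Eventually.of_forall fun t => ?_
        rw [norm_mul]
        exact mul_le_of_le_one_left (norm_nonneg _) (hB t)
    have hsplit : ∫ t in Ioi (1 : ℝ), (∑ k ∈ Finset.Icc 1 ⌊t⌋₊, (1 : ℂ)) * (t : ℂ) ^ (-(z + 1)) =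
        (z - 1)⁻¹ + mellin g (-z) := by
      have e1 : ∫ t in Ioi (1 : ℝ), (t : ℂ) ^ (-z) = (z - 1)⁻¹ := by
        rw [integral_Ioi_cpow_of_lt (by simpa using hz) one_pos]
        simp only [ofReal_one, one_cpow]
        rw [show -z + 1 = -(z - 1) by ring, neg_div_neg_eq, one_div]
      rw [mellin_neg_eq h0, ← e1, ← integral_add hint1 hint2]
      refine setIntegral_congr_fun measurableSet_Ioi fun t ht => ?_
      have ht0 : (t : ℂ) ≠ 0 := by
        have : (1 : ℝ) < t := ht
        exact_mod_cast (by linarith : t ≠ 0)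
      have hnl : ¬ t < 1 := not_lt.2 (le_of_lt ht)
      simp only [hg, hnl, if_false, Finset.sum_const, Nat.card_Icc, nsmul_eq_mul, mul_one,
        Nat.add_sub_cancel]
      have : (t : ℂ) ^ (-z) = t * (t : ℂ) ^ (-(z + 1)) := by
        rw [show -z = 1 + -(z + 1) by ring, cpow_add _ _ ht0, cpow_one]
      rw [this]
      ring
    rw [hsplit, hζ, riemannZeta_eq_inv_sub_mul hz1] at hI
    field_simp at hI
    rw [hI]
    ring
  have h := eqOn_re_pos_of_eqOn (F := riemannZeta₁) (G := fun z => z + z * (z - 1) * mellin g (-z))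
    differentiable_riemannZeta₁.differentiableOn
    (fun z hz => DifferentiableAt.differentiableWithinAt <| DifferentiableAt.add (by fun_prop)
      (DifferentiableAt.mul (by fun_prop) (differentiableAt_mellin_neg hm hB h0 hz))) heq hs
  rw [h]
  refine (norm_add_le _ _).trans ?_
  gcongr
  rw [norm_mul, norm_mul, mul_div_assoc, div_eq_mul_inv, ← one_div, mul_assoc]
  gcongr
  exact norm_mellin_neg_le hB h0 hs

end

/-! ### Consequences of GRH for sums over prime powers -/

section

open Complex Filter Topology MeasureTheory Set Metric

/-- A zero-free half plane `1 / 2 < Re s` and polynomial growth bound the logarithmic derivative,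
with only a logarithmic dependence on the size `A` of the function. -/
theorem norm_logDeriv_le_of_growth {F : ℂ → ℂ} {A b : ℝ} (hA : 1 ≤ A) (hb : 1 / 2 < b)
    (hb1 : b ≤ 1) (hF : Differentiable ℂ F) (h0 : ∀ s : ℂ, 1 / 2 < s.re → F s ≠ 0)
    (hg : ∀ s : ℂ, 1 / 2 < s.re → s.re < 6 → ‖F s‖ ≤ A * (1 + |s.im|) ^ 2)
    (h3 : ∀ s : ℂ, s.re = 3 → 1 / 3 ≤ ‖F s‖) {s : ℂ} (hs : b ≤ s.re) (hs4 : s.re ≤ 4) :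
    ‖deriv F s / F s‖ ≤ 180 / (b - 1 / 2) ^ 2 * (1 + Real.log A) * (1 + |s.im|) ^ (1 / 2 : ℝ) := by
  set τ := s.im with hτ
  -- the disc of radius `5 / 2` about `c` touches the line `Re s = 1 / 2`
  set c : ℂ := 3 + τ * I with hc
  have hcre : c.re = 3 := by simp [hc]
  have hcim : c.im = τ := by simp [hc]
  have hv : 0 < 1 + |τ| := by positivity
  have hbase : 1 < 3 * A * (4 + |τ|) ^ 2 := by
    nlinarith [abs_nonneg τ, mul_nonneg (by linarith : (0 : ℝ) ≤ A) (abs_nonneg τ)]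
  have hM : 0 < Real.log (3 * A * (4 + |τ|) ^ 2) := Real.log_pos hbase
  have key := norm_logDeriv_le_of_norm_le (F := F) (c := c) (R := 5 / 2) (r := 3 - b) (z := s)
    (by linarith) (by linarith) hM hF.differentiableOn
    (by
      intro z hz
      refine h0 z ?_
      have h' := (abs_re_le_norm (z - c)).trans_lt (by rw [← dist_eq_norm]; exact mem_ball.1 hz)
      rw [sub_re, hcre, abs_lt] at h'
      linarith [h'.1])
    (by
      intro z hz
      have hz' : ‖z - c‖ < 5 / 2 := by rw [← dist_eq_norm]; exact mem_ball.1 hz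
      have h1 := (abs_re_le_norm (z - c)).trans_lt hz'
      have h2 := (abs_im_le_norm (z - c)).trans_lt hz'
      rw [sub_re, hcre, abs_lt] at h1
      rw [sub_im, hcim] at h2
      rw [Real.exp_log (by linarith)]
      have h4 : |z.im| ≤ |τ| + 5 / 2 := by
        have := abs_sub_abs_le_abs_sub z.im τ; linarith
      have h5 := hg z (by linarith) (by linarith)
      have h6 := h3 c hcre
      calc ‖F z‖ ≤ A * (1 + |z.im|) ^ 2 := h5
        _ ≤ A * (4 + |τ|) ^ 2 := mul_le_mul_of_nonneg_left
            (pow_le_pow_left₀ (by positivity) (by linarith) 2) (by linarith)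
        _ = 3 * A * (4 + |τ|) ^ 2 * (1 / 3) := by ring
        _ ≤ _ := by gcongr)
    (by
      have : s - c = ((s.re - 3 : ℝ) : ℂ) := by
        apply Complex.ext <;> simp [hc, hτ]
      rw [dist_eq_norm, this, norm_real, Real.norm_eq_abs, abs_le]
      constructor <;> linarith)
  refine key.trans ?_
  have hlog : Real.log (3 * A * (4 + |τ|) ^ 2) ≤
      9 * (1 + Real.log A) * (1 + |τ|) ^ (1 / 2 : ℝ) := by
    have hone : 1 ≤ (1 + |τ|) ^ (1 / 2 : ℝ) :=
      Real.one_le_rpow (by linarith [abs_nonneg τ]) (by norm_num)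
    have hlA : 0 ≤ Real.log A := Real.log_nonneg hA
    have e1 : Real.log (3 * A * (4 + |τ|) ^ 2) =
        Real.log 3 + Real.log A + 2 * Real.log (4 + |τ|) := by
      rw [Real.log_mul (by positivity) (by positivity), Real.log_mul (by norm_num) (by positivity),
        Real.log_pow]
      push_cast; ring
    have e2 : Real.log (4 + |τ|) ≤ Real.log 4 + Real.log (1 + |τ|) := by
      rw [← Real.log_mul (by norm_num) (by positivity)]
      exact Real.log_le_log (by positivity) (by linarith [abs_nonneg τ])
    have e3 : Real.log (1 + |τ|) ≤ 2 * (1 + |τ|) ^ (1 / 2 : ℝ) := by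
      have := Real.log_le_rpow_div hv.le (ε := 1 / 2) (by norm_num)
      linarith
    have e4 : Real.log 4 ≤ 1.4 := by
      have : Real.log 4 = 2 * Real.log 2 := by
        rw [show (4 : ℝ) = 2 ^ 2 by norm_num, Real.log_pow]; push_cast; ring
      linarith [Real.log_two_lt_d9]
    have e5 : Real.log 3 ≤ Real.log 4 := Real.log_le_log (by norm_num) (by norm_num)
    nlinarith [mul_nonneg hlA (by linarith : 0 ≤ (1 + |τ|) ^ (1 / 2 : ℝ) - 1)]
  have hb0 : b - 1 / 2 ≠ 0 := by linarith
  calc 8 * (5 / 2) / (5 / 2 - (3 - b)) ^ 2 * Real.log (3 * A * (4 + |τ|) ^ 2)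
      ≤ 8 * (5 / 2) / (5 / 2 - (3 - b)) ^ 2 * (9 * (1 + Real.log A) * (1 + |τ|) ^ (1 / 2 : ℝ)) := by
        gcongr
    _ = 180 / (b - 1 / 2) ^ 2 * (1 + Real.log A) * (1 + |τ|) ^ (1 / 2 : ℝ) := by
        rw [show 5 / 2 - (3 - b) = b - 1 / 2 by ring]; ring

/-- The bound `13 / 20` is `ζ(2) - 1` rounded up. -/
theorem norm_LSeries_sub_one_le {f : ℕ → ℂ} (h1 : f 1 = 1) (hf : ∀ n, ‖f n‖ ≤ 1) {s : ℂ}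
    (hs : s.re = 3) : ‖LSeries f s - 1‖ ≤ 13 / 20 := by
  have hb : ∀ n, ‖LSeries.term f s n‖ ≤ 1 / (n : ℝ) ^ 2 := by
    intro n
    rw [LSeries.norm_term_eq, hs]
    split_ifs with hn
    · positivity
    · have hn1 : (1 : ℝ) ≤ n := by exact_mod_cast Nat.one_le_iff_ne_zero.2 hn
      have : (n : ℝ) ^ 2 ≤ (n : ℝ) ^ (3 : ℝ) := by
        rw [← Real.rpow_two]
        exact Real.rpow_le_rpow_of_exponent_le hn1 (by norm_num)
      exact div_le_div₀ zero_le_one (hf n) (by positivity) this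
  have hsum : Summable fun n : ℕ => 1 / (n : ℝ) ^ 2 := hasSum_zeta_two.summable
  have hts : Summable (LSeries.term f s) := Summable.of_norm_bounded hsum hb
  have e1 : LSeries.term f s 1 = 1 := by simp [h1]
  have e2 : LSeries f s - 1 = ∑' n, if n = 1 then 0 else LSeries.term f s n := by
    rw [LSeries, hts.tsum_eq_add_tsum_ite 1, e1]; ring
  have e3 := hsum.tsum_eq_add_tsum_ite 1
  rw [hasSum_zeta_two.tsum_eq] at e3
  have hs2 : Summable fun n : ℕ => if n = 1 then 0 else 1 / (n : ℝ) ^ 2 := by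
    refine Summable.of_nonneg_of_le (fun n => ?_) (fun n => ?_) hsum
    · split_ifs <;> positivity
    · split_ifs
      · positivity
      · exact le_rfl
  rw [e2]
  refine (tsum_of_norm_bounded hs2.hasSum fun n => ?_).trans ?_
  · split_ifs
    · simp
    · exact hb n
  · have : Real.pi ^ 2 / 6 ≤ 33 / 20 := by nlinarith [Real.pi_lt_d4, Real.pi_gt_three]
    simp only [Nat.cast_one, one_pow, div_one] at e3
    linarith

theorem one_third_le_norm {z : ℂ} (h : ‖z - 1‖ ≤ 13 / 20) : 1 / 3 ≤ ‖z‖ ∧ ‖z‖ ≤ 2 := by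
  have h1 := norm_sub_norm_le (1 : ℂ) z
  have h2 := norm_sub_norm_le z 1
  rw [norm_sub_rev] at h1
  rw [norm_one] at h1 h2
  constructor <;> linarith

section DirichletL

variable {N : ℕ} [NeZero N]

theorem norm_LFunction_sub_one_le (χ : DirichletCharacter ℂ N) {s : ℂ} (hs : s.re = 3) :
    ‖DirichletCharacter.LFunction χ s - 1‖ ≤ 13 / 20 := by
  rw [DirichletCharacter.LFunction_eq_LSeries χ (by linarith)]
  exact norm_LSeries_sub_one_le (by simp) (fun n => χ.norm_le_one _) hs

theorem GeneralizedRH.LFunction_ne_zero (hGRH : GeneralizedRH) {χ : DirichletCharacter ℂ N}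
    (hχ : χ ≠ 1) {s : ℂ} (hs : 1 / 2 < s.re) : DirichletCharacter.LFunction χ s ≠ 0 := by
  rcases lt_or_ge s.re 1 with h | h
  · intro h0
    have := hGRH N χ s h0 (by linarith) h
    linarith
  · exact DirichletCharacter.LFunction_ne_zero_of_one_le_re χ (Or.inl hχ) h

theorem GeneralizedRH.norm_logDeriv_LFunction_le (hGRH : GeneralizedRH)
    {χ : DirichletCharacter ℂ N} (hχ : χ ≠ 1) {b : ℝ} (hb : 1 / 2 < b) (hb1 : b ≤ 1) {s : ℂ}
    (hs : b ≤ s.re) (hs4 : s.re ≤ 4) :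
    ‖-deriv (DirichletCharacter.LFunction χ) s / DirichletCharacter.LFunction χ s‖ ≤
      720 / (b - 1 / 2) ^ 2 * (1 + Real.log N) * (1 + |s.im|) ^ (1 / 2 : ℝ) := by
  have hN : (1 : ℝ) ≤ N := by exact_mod_cast Nat.pos_of_neZero N
  have key := norm_logDeriv_le_of_growth (F := DirichletCharacter.LFunction χ) (A := 12 * N)
    (by linarith) hb hb1 (DirichletCharacter.differentiable_LFunction hχ)
    (fun z hz => hGRH.LFunction_ne_zero hχ hz)
    (by
      intro z hz hz6
      refine (norm_LFunction_le hχ (by linarith)).trans ?_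
      have h1 : ‖z‖ ≤ 6 + |z.im| := by
        have := norm_le_abs_re_add_abs_im z
        rw [abs_of_pos (by linarith : 0 < z.re)] at this
        linarith
      have h2 : (N : ℝ) / z.re ≤ 2 * N := by
        rw [div_le_iff₀ (by linarith)]; nlinarith
      calc ‖z‖ * (N / z.re) ≤ (6 + |z.im|) * (2 * N) := by
            gcongr
        _ ≤ 12 * N * (1 + |z.im|) ^ 2 := by
            nlinarith [abs_nonneg z.im, mul_nonneg (by linarith : (0 : ℝ) ≤ N) (abs_nonneg z.im),
              mul_nonneg (by linarith : (0 : ℝ) ≤ N) (sq_nonneg |z.im|)])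
    (fun z hz => (one_third_le_norm (norm_LFunction_sub_one_le χ hz)).1) hs hs4
  rw [neg_div, norm_neg]
  refine key.trans ?_
  have h12 : 1 + Real.log (12 * N) ≤ 4 * (1 + Real.log N) := by
    rw [Real.log_mul (by norm_num) (by linarith)]
    have h1 : Real.log 12 ≤ 3 := by
      have : Real.log 12 ≤ Real.log (2 ^ 4) := Real.log_le_log (by norm_num) (by norm_num)
      rw [Real.log_pow] at this
      push_cast at this
      linarith [Real.log_two_lt_d9]
    linarith [Real.log_nonneg hN]
  calc _ ≤ 180 / (b - 1 / 2) ^ 2 * (4 * (1 + Real.log N)) * (1 + |s.im|) ^ (1 / 2 : ℝ) := by gcongr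
    _ = _ := by ring

theorem GeneralizedRH.differentiableOn_logDeriv_LFunction (hGRH : GeneralizedRH)
    {χ : DirichletCharacter ℂ N} (hχ : χ ≠ 1) {b : ℝ} (hb : 1 / 2 < b) :
    DifferentiableOn ℂ (fun s => -deriv (DirichletCharacter.LFunction χ) s /
      DirichletCharacter.LFunction χ s) {s | b ≤ s.re} := by
  have hd := DirichletCharacter.differentiable_LFunction hχ
  intro s hs
  have hs' : b ≤ s.re := hs
  refine DifferentiableAt.differentiableWithinAt (DifferentiableAt.div ?_ (hd s)
    (hGRH.LFunction_ne_zero hχ (by linarith)))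
  exact (hd.deriv s).neg

theorem neg_logDeriv_LFunction_eq (χ : DirichletCharacter ℂ N) {s : ℂ} (hs : 1 < s.re) :
    -deriv (DirichletCharacter.LFunction χ) s / DirichletCharacter.LFunction χ s =
      LSeries (fun n => χ n * ArithmeticFunction.vonMangoldt n) s := by
  rw [DirichletCharacter.deriv_LFunction_eq_deriv_LSeries χ hs,
    DirichletCharacter.LFunction_eq_LSeries χ hs,
    ← DirichletCharacter.LSeries_twist_vonMangoldt_eq χ hs]
  rfl

/-- Under GRH the Fejér-weighted sum of `χ Λ` up to `x` is `O_b(x ^ b log N)` for `b > 1 / 2`. -/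
theorem GeneralizedRH.norm_sum_mul_vonMangoldt_le (hGRH : GeneralizedRH)
    {χ : DirichletCharacter ℂ N} (hχ : χ ≠ 1) {b : ℝ} (hb : 1 / 2 < b) (hb1 : b ≤ 1) {x : ℝ}
    (hx : 1 < x) :
    ‖∑ n ∈ Finset.Icc 1 ⌊x⌋₊, χ n * ArithmeticFunction.vonMangoldt n * ((1 - n / x : ℝ) : ℂ)‖ ≤
      9 * (∫ y : ℝ, (1 + |y|) ^ (-(3 / 2) : ℝ)) * (720 / (b - 1 / 2) ^ 2) * (1 + Real.log N) *
        x ^ b := by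
  have hN : (1 : ℝ) ≤ N := by exact_mod_cast Nat.pos_of_neZero N
  have hl := Real.log_nonneg hN
  have := norm_sum_fejer_sub_le (f := fun n => χ n * ArithmeticFunction.vonMangoldt n) (κ := 0)
    (K := 720 / (b - 1 / 2) ^ 2 * (1 + Real.log N)) hb.le hb1
    (hGRH.differentiableOn_logDeriv_LFunction hχ hb)
    (fun s h1 h2 => hGRH.norm_logDeriv_LFunction_le hχ hb hb1 h1 h2) (by positivity)
    (fun s hs => DirichletCharacter.LSeriesSummable_twist_vonMangoldt χ hs)
    (fun s hs => by rw [neg_logDeriv_LFunction_eq χ hs]; simp) hx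
  simp only [zero_mul, sub_zero] at this
  refine this.trans (le_of_eq ?_)
  ring

/-- Under GRH, `-L'/L` is approximated to the right of the critical line by short
Fejér-weighted sums. -/
theorem GeneralizedRH.norm_sum_cpow_add_logDeriv_le (hGRH : GeneralizedRH)
    {χ : DirichletCharacter ℂ N} (hχ : χ ≠ 1) {a b : ℝ} (ha : 0 < a) (ha2 : a ≤ 1 / 2)
    (hb : 1 / 2 < b) (hb1 : b ≤ 1) {s : ℂ} (hs : b + a ≤ s.re) (hs3 : s.re ≤ 3) {x : ℝ}
    (hx : 0 < x) :
    ‖∑ n ∈ Finset.Icc 1 ⌊x⌋₊, χ n * ArithmeticFunction.vonMangoldt n / (n : ℂ) ^ s *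
      ((1 - n / x : ℝ) : ℂ) +
      deriv (DirichletCharacter.LFunction χ) s / DirichletCharacter.LFunction χ s‖ ≤
      ((1 + a) / a) ^ 2 * (∫ y : ℝ, (1 + |y|) ^ (-(3 / 2) : ℝ)) * (1 + |s.im|) ^ (1 / 2 : ℝ) *
        (720 / (b - 1 / 2) ^ 2) * (1 + Real.log N) * x ^ (-a) := by
  have hN : (1 : ℝ) ≤ N := by exact_mod_cast Nat.pos_of_neZero N
  have hl := Real.log_nonneg hN
  have := norm_sum_cpow_fejer_sub_le (f := fun n => χ n * ArithmeticFunction.vonMangoldt n)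
    (K := 720 / (b - 1 / 2) ^ 2 * (1 + Real.log N)) ha ha2 hb.le
    (hGRH.differentiableOn_logDeriv_LFunction hχ hb)
    (fun s h1 h2 => hGRH.norm_logDeriv_LFunction_le hχ hb hb1 h1 h2) (by positivity)
    (fun s hs => DirichletCharacter.LSeriesSummable_twist_vonMangoldt χ hs)
    (fun s hs => neg_logDeriv_LFunction_eq χ hs) hs hs3 hx
  rw [neg_div, sub_neg_eq_add] at this
  refine this.trans (le_of_eq ?_)
  ring

end DirichletL

theorem GeneralizedRH.riemannZeta₁_ne_zero (hGRH : GeneralizedRH) {s : ℂ} (hs : 1 / 2 < s.re) :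
    riemannZeta₁ s ≠ 0 := by
  rcases eq_or_ne s 1 with rfl | h1
  · simp
  · have hz : riemannZeta s ≠ 0 := by
      rcases lt_or_ge s.re 1 with h | h
      · intro h0
        have := hGRH 1 1 s (by rw [DirichletCharacter.LFunction_modOne_eq]; exact h0)
          (by linarith) h
        linarith
      · exact riemannZeta_ne_zero_of_one_le_re h
    rw [riemannZeta_eq_inv_sub_mul h1] at hz
    exact right_ne_zero_of_mul hz

theorem neg_logDeriv_riemannZeta₁_eq {s : ℂ} (hs : 1 < s.re) :
    -deriv riemannZeta₁ s / riemannZeta₁ s =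
      LSeries (fun n => (ArithmeticFunction.vonMangoldt n : ℂ)) s - 1 / (s - 1) := by
  have h1 : s ≠ 1 := by rintro rfl; simp at hs
  have h1' : s - 1 ≠ 0 := sub_ne_zero.2 h1
  have hz := riemannZeta_ne_zero_of_one_le_re hs.le
  rw [ArithmeticFunction.LSeries_vonMangoldt_eq_deriv_riemannZeta_div hs,
    deriv_riemannZeta_eq_neg_inv_sub_sq_mul_add h1]
  rw [riemannZeta_eq_inv_sub_mul h1] at hz ⊢
  have hz1 := right_ne_zero_of_mul hz
  field_simp
  ring

/-- The prime number theorem in Fejér-weighted form, with the error term that RH provides. -/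
theorem GeneralizedRH.norm_sum_vonMangoldt_sub_le (hGRH : GeneralizedRH) {b : ℝ} (hb : 1 / 2 < b)
    (hb1 : b ≤ 1) : ∃ C : ℝ, ∀ x : ℝ, 1 < x →
      |∑ n ∈ Finset.Icc 1 ⌊x⌋₊, ArithmeticFunction.vonMangoldt n * (1 - n / x) -
        x / 2 * (1 - 1 / x) ^ 2| ≤ C * x ^ b := by
  refine ⟨9 * (∫ y : ℝ, (1 + |y|) ^ (-(3 / 2) : ℝ)) *
    (180 / (b - 1 / 2) ^ 2 * (1 + Real.log 78)), fun x hx => ?_⟩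
  have := norm_sum_fejer_sub_le (f := fun n => (ArithmeticFunction.vonMangoldt n : ℂ)) (κ := 1)
    (D := fun s => -deriv riemannZeta₁ s / riemannZeta₁ s)
    (K := 180 / (b - 1 / 2) ^ 2 * (1 + Real.log 78)) hb.le hb1
    (by
      intro s hs
      have hs' : b ≤ s.re := hs
      refine DifferentiableAt.differentiableWithinAt (DifferentiableAt.div ?_
        (differentiable_riemannZeta₁ s) (hGRH.riemannZeta₁_ne_zero (by linarith)))
      exact (differentiable_riemannZeta₁.deriv s).neg)
    (by
      intro s h1 h2
      rw [neg_div, norm_neg]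
      refine norm_logDeriv_le_of_growth (by norm_num) hb hb1 differentiable_riemannZeta₁
        (fun z hz => hGRH.riemannZeta₁_ne_zero hz) ?_ ?_ h1 h2
      · intro z hz hz6
        refine (norm_riemannZeta₁_le (by linarith)).trans ?_
        have h1 : ‖z‖ ≤ 6 + |z.im| := by
          have := norm_le_abs_re_add_abs_im z
          rw [abs_of_pos (by linarith : 0 < z.re)] at this
          linarith
        have h2 : ‖z - 1‖ ≤ 6 + |z.im| := by
          have := norm_le_abs_re_add_abs_im (z - 1)
          simp only [sub_re, one_re, sub_im, one_im, sub_zero] at this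
          have h3 : |z.re - 1| ≤ 5 := abs_le.2 ⟨by linarith, by linarith⟩
          linarith
        have h3 : ‖z‖ * ‖z - 1‖ / z.re ≤ 2 * ((6 + |z.im|) * (6 + |z.im|)) := by
          rw [div_le_iff₀ (by linarith)]
          have : ‖z‖ * ‖z - 1‖ ≤ (6 + |z.im|) * (6 + |z.im|) := by gcongr
          nlinarith [mul_nonneg (norm_nonneg z) (norm_nonneg (z - 1))]
        nlinarith [abs_nonneg z.im]
      · intro z hz
        have hz1 : z ≠ 1 := by rintro rfl; norm_num at hz
        have e := riemannZeta_eq_inv_sub_mul hz1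
        have e' : riemannZeta₁ z = (z - 1) * riemannZeta z := by
          rw [e, mul_inv_cancel_left₀ (sub_ne_zero.2 hz1)]
        have h1 : 1 / 3 ≤ ‖riemannZeta z‖ := by
          refine (one_third_le_norm ?_).1
          rw [← LSeries_one_eq_riemannZeta (by linarith)]
          exact norm_LSeries_sub_one_le (by simp) (fun n => by simp) hz
        have h2 : 1 ≤ ‖z - 1‖ := by
          refine le_trans ?_ (abs_re_le_norm _)
          simp [hz]; norm_num
        rw [e', norm_mul]
        nlinarith)
    (by
      have : (0 : ℝ) ≤ Real.log 78 := Real.log_nonneg (by norm_num)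
      positivity)
    (fun s hs => ArithmeticFunction.LSeriesSummable_vonMangoldt hs)
    (fun s hs => neg_logDeriv_riemannZeta₁_eq hs) hx
  refine le_trans (le_of_eq ?_) this
  rw [one_mul, ← Real.norm_eq_abs, ← norm_real]
  push_cast
  rfl

end

/-! ### `log |L(s, χ)|` as a short sum over primes -/

section

open Complex Filter Topology MeasureTheory Set Metric
open ArithmeticFunction (vonMangoldt)

/-- A proper prime power `p ^ (k + 2)` contributes `p ^ (-2 σ)` times a factor decaying
geometrically in `k`. -/
theorem summable_primePow_not_prime {σ : ℝ} (hσ : 1 / 2 < σ) :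
    Summable fun n : ℕ => if IsPrimePow n ∧ ¬ n.Prime then (n : ℝ) ^ (-σ) else 0 := by
  set φ : Nat.Primes × ℕ → ℕ := fun pk => (pk.1 : ℕ) ^ (pk.2 + 2) with hφ
  have hinj : Function.Injective φ := by
    intro a b hab
    have h : Nat.Primes.prodNatEquiv (a.1, a.2 + 1) = Nat.Primes.prodNatEquiv (b.1, b.2 + 1) := by
      rw [Nat.Primes.prodNatEquiv_apply, Nat.Primes.prodNatEquiv_apply]
      exact Subtype.ext hab
    have h2 := Nat.Primes.prodNatEquiv.injective h
    rw [Prod.mk.injEq] at h2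
    exact Prod.ext h2.1 (by omega)
  rw [← hinj.summable_iff]
  · have h2σ : (2 : ℝ) ^ (-σ) < 1 :=
      Real.rpow_lt_one_of_one_lt_of_neg (by norm_num) (by linarith)
    have hs1 : Summable fun p : Nat.Primes => (p : ℝ) ^ (-(2 * σ)) :=
      Nat.Primes.summable_rpow.2 (by linarith)
    have hs2 : Summable fun k : ℕ => ((2 : ℝ) ^ (-σ)) ^ k :=
      summable_geometric_of_lt_one (by positivity) h2σ
    refine Summable.of_nonneg_of_le (fun pk => ?_) (fun pk => ?_)
      (hs1.mul_of_nonneg hs2 (fun _ => by positivity) (fun _ => by positivity))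
    · simp only [Function.comp]
      split_ifs <;> positivity
    · have hp2 : (2 : ℝ) ≤ (pk.1 : ℕ) := by exact_mod_cast pk.1.2.two_le
      have hp0 : (0 : ℝ) < (pk.1 : ℕ) := by linarith
      have hle : ((φ pk : ℕ) : ℝ) ^ (-σ) ≤
          ((pk.1 : ℕ) : ℝ) ^ (-(2 * σ)) * ((2 : ℝ) ^ (-σ)) ^ pk.2 := by
        have : ((φ pk : ℕ) : ℝ) ^ (-σ) =
            ((pk.1 : ℕ) : ℝ) ^ (-(2 * σ)) * (((pk.1 : ℕ) : ℝ) ^ (-σ)) ^ pk.2 := by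
          simp only [hφ]
          push_cast
          rw [← Real.rpow_natCast, ← Real.rpow_mul hp0.le, ← Real.rpow_natCast,
            ← Real.rpow_mul hp0.le, ← Real.rpow_add hp0]
          congr 1
          push_cast
          ring
        rw [this]
        have h5 := Real.rpow_le_rpow_of_nonpos (z := -σ) two_pos hp2 (by linarith)
        exact mul_le_mul_of_nonneg_left (pow_le_pow_left₀ (by positivity) h5 _) (by positivity)
      simp only [Function.comp]
      split_ifs
      · exact hle
      · positivity
  · intro n hn
    rw [if_neg]
    rintro ⟨h1, h2⟩
    obtain ⟨p, k, hp, hk, rfl⟩ := (isPrimePow_nat_iff n).1 h1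
    rcases Nat.lt_or_ge k 2 with h | h
    · have : k = 1 := by omega
      subst this
      simp [hp] at h2
    · exact hn ⟨(⟨p, hp⟩, k - 2), by simp only [hφ]; congr 1; omega⟩

theorem hasDerivAt_log_norm {f : ℂ → ℂ} {f' : ℂ} {u : ℝ} (hf : HasDerivAt f f' u)
    (h0 : f u ≠ 0) : HasDerivAt (fun v : ℝ => Real.log ‖f v‖) (f' / f u).re u := by
  have h1 : HasDerivAt (fun v : ℝ => ‖f v‖ ^ 2) (2 * inner ℝ (f u) f') u :=
    hf.comp_ofReal.norm_sq
  have hn : ‖f u‖ ^ 2 ≠ 0 := by simpa using h0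
  have h2 := (h1.log hn).const_mul (1 / 2)
  have hfun : (fun v : ℝ => Real.log ‖f v‖) = fun v : ℝ => 1 / 2 * Real.log (‖f v‖ ^ 2) := by
    funext v
    rw [Real.log_pow]; push_cast; ring
  rw [hfun]
  refine h2.congr_deriv ?_
  rw [Complex.inner, div_eq_mul_inv f', Complex.inv_def, ← mul_assoc, re_mul_ofReal,
    ← normSq_eq_norm_sq, mul_comm f']
  field_simp

/-- Under GRH, `log |L(s, χ)|` is approximated to the right of the critical line by a short
Fejér-weighted sum over primes, with an error uniform in `χ`. -/
theorem GeneralizedRH.abs_log_norm_LFunction_sub_le (hGRH : GeneralizedRH) {σ : ℝ}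
    (hσ : 1 / 2 < σ) (hσ1 : σ < 1) (t : ℝ) : ∃ C a : ℝ, 0 < a ∧ 0 ≤ C ∧
      ∀ (N : ℕ) [NeZero N] (χ : DirichletCharacter ℂ N), χ ≠ 1 → ∀ x : ℝ, 1 ≤ x →
        |Real.log ‖DirichletCharacter.LFunction χ (σ + t * I)‖ -
          ∑ q ∈ (Finset.Icc 1 ⌊x⌋₊).filter Nat.Prime,
            (χ (q : ZMod N) * (q : ℂ) ^ (-((σ : ℂ) + t * I))).re * (1 - q / x)| ≤
        C * (1 + (1 + Real.log N) * x ^ (-a)) := by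
  set a : ℝ := (σ - 1 / 2) / 2 with ha
  set b : ℝ := σ - a with hb
  have ha0 : 0 < a := by linarith
  have hb0 : 1 / 2 < b := by linarith
  set C₁ : ℝ := ((1 + a) / a) ^ 2 * (∫ y : ℝ, (1 + |y|) ^ (-(3 / 2) : ℝ)) *
    (1 + |t|) ^ (1 / 2 : ℝ) * (720 / (b - 1 / 2) ^ 2) with hC₁
  have hJ0 : 0 ≤ ∫ y : ℝ, (1 + |y|) ^ (-(3 / 2) : ℝ) := integral_nonneg fun y => by positivity
  have hC₁0 : 0 ≤ C₁ := by positivity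
  set S : ℝ := ∑' n : ℕ, if IsPrimePow n ∧ ¬ n.Prime then (n : ℝ) ^ (-σ) else 0 with hS
  have hS0 : 0 ≤ S := tsum_nonneg fun n => by split_ifs <;> positivity
  refine ⟨4 + S + 3 * C₁, a, ha0, by positivity, fun N _ χ hχ x hx => ?_⟩
  have hx0 : 0 < x := by linarith
  have hN : (1 : ℝ) ≤ N := by exact_mod_cast Nat.pos_of_neZero N
  have hlN := Real.log_nonneg hN
  set I₀ := Finset.Icc 1 ⌊x⌋₊ with hI₀
  have hw : ∀ n ∈ I₀, 0 ≤ 1 - (n : ℝ) / x ∧ 1 - (n : ℝ) / x ≤ 1 := by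
    intro n hn
    have h1 : (n : ℝ) ≤ x := (Nat.le_floor_iff hx0.le).1 (Finset.mem_Icc.1 hn).2
    have h2 : (n : ℝ) / x ≤ 1 := (div_le_one hx0).2 h1
    exact ⟨by linarith, by linarith [show 0 ≤ (n : ℝ) / x by positivity]⟩
  have hn0 : ∀ n ∈ I₀, (n : ℂ) ≠ 0 := by
    intro n hn
    have := (Finset.mem_Icc.1 hn).1
    exact_mod_cast (by omega : n ≠ 0)
  set A : ℕ → ℂ := fun n => χ (n : ZMod N) * ((vonMangoldt n / Real.log n : ℝ) : ℂ) *
    ((1 - n / x : ℝ) : ℂ) with hA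
  set Ψ : ℂ → ℂ := fun w => ∑ n ∈ I₀, A n * (n : ℂ) ^ (-(w + t * I)) with hΨ
  set Φ : ℝ → ℝ := fun u => Real.log ‖DirichletCharacter.LFunction χ (u + t * I)‖ -
    (Ψ u).re with hΦ
  have hAlog : ∀ n ∈ I₀, A n * Complex.log n = χ (n : ZMod N) * vonMangoldt n *
      ((1 - n / x : ℝ) : ℂ) := by
    intro n hn
    have h1 := (Finset.mem_Icc.1 hn).1
    simp only [hA]
    rw [← ofReal_natCast, ← ofReal_log (Nat.cast_nonneg n)]
    rcases eq_or_ne n 1 with rfl | hne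
    · simp
    · have hl : Real.log n ≠ 0 := by
        have : (1 : ℝ) < n := by exact_mod_cast (by omega : 1 < n)
        exact (Real.log_pos this).ne'
      have hl' : ((Real.log n : ℝ) : ℂ) ≠ 0 := by exact_mod_cast hl
      rw [ofReal_div]
      field_simp
  have hΨd : ∀ w : ℂ, HasDerivAt Ψ (-∑ n ∈ I₀, χ (n : ZMod N) * vonMangoldt n /
      (n : ℂ) ^ (w + t * I) * ((1 - n / x : ℝ) : ℂ)) w := by
    intro w
    rw [← Finset.sum_neg_distrib]
    refine HasDerivAt.fun_sum fun n hn => ?_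
    have h1 : HasDerivAt (fun v : ℂ => -(v + t * I)) (-1) w :=
      ((hasDerivAt_id w).add_const _).neg
    have h2 := (h1.const_cpow (Or.inl (hn0 n hn))).const_mul (A n)
    refine h2.congr_deriv ?_
    rw [cpow_neg]
    linear_combination (-((n : ℂ) ^ (w + t * I))⁻¹) * hAlog n hn
  have hLd : Differentiable ℂ fun w : ℂ => DirichletCharacter.LFunction χ (w + t * I) :=
    (DirichletCharacter.differentiable_LFunction hχ).comp (by fun_prop)
  have hΦd : ∀ u ∈ Icc σ 3, HasDerivWithinAt Φ
      (deriv (DirichletCharacter.LFunction χ) (u + t * I) /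
        DirichletCharacter.LFunction χ (u + t * I) - -∑ n ∈ I₀, χ (n : ZMod N) * vonMangoldt n /
      (n : ℂ) ^ ((u : ℂ) + t * I) * ((1 - n / x : ℝ) : ℂ)).re (Icc σ 3) u := by
    intro u hu
    have hne : DirichletCharacter.LFunction χ (u + t * I) ≠ 0 :=
      hGRH.LFunction_ne_zero hχ (by simp; linarith [hu.1])
    have h1 : HasDerivAt (fun w : ℂ => DirichletCharacter.LFunction χ (w + t * I))
        (deriv (DirichletCharacter.LFunction χ) (u + t * I)) u := by
      have h2 := ((DirichletCharacter.differentiable_LFunction hχ) (u + t * I)).hasDerivAt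
      exact h2.comp_add_const _ _
    have h3 := (hasDerivAt_log_norm h1 hne).sub (hΨd u).real_of_complex
    rw [sub_re]
    exact h3.hasDerivWithinAt
  -- integrate `L'/L` from `3`, where `log |L|` is bounded, down to `σ`
  have hmv := (convex_Icc σ 3).norm_image_sub_le_of_norm_hasDerivWithin_le hΦd
    (C := C₁ * (1 + Real.log N) * x ^ (-a)) (fun u hu => by
      rw [Real.norm_eq_abs]
      refine (abs_re_le_norm _).trans ?_
      have := hGRH.norm_sum_cpow_add_logDeriv_le hχ ha0 (by linarith) hb0 (by linarith)
        (s := u + t * I) (by simp; linarith [hu.1]) (by simpa using hu.2) hx0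
      rw [sub_neg_eq_add, add_comm]
      refine this.trans (le_of_eq ?_)
      simp [hC₁])
    (x := 3) (y := σ) ⟨by linarith, le_rfl⟩ ⟨le_rfl, by linarith⟩
  have hb1 : ‖σ - 3‖ ≤ 3 := by
    rw [Real.norm_eq_abs, abs_le]; constructor <;> linarith
  have hratio : ∀ n : ℕ, 0 ≤ vonMangoldt n / Real.log n ∧ vonMangoldt n / Real.log n ≤ 1 := by
    intro n
    have h1 : 0 ≤ Real.log n := Real.log_natCast_nonneg n
    refine ⟨div_nonneg ArithmeticFunction.vonMangoldt_nonneg h1, ?_⟩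
    exact div_le_one_of_le₀ ArithmeticFunction.vonMangoldt_le_log h1
  have hAn : ∀ n ∈ I₀, ‖A n‖ ≤ 1 := by
    intro n hn
    simp only [hA, norm_mul, norm_real, Real.norm_eq_abs]
    rw [abs_of_nonneg (hratio n).1, abs_of_nonneg (hw n hn).1]
    have e1 := χ.norm_le_one (n : ZMod N)
    have e2 := (hratio n).1
    have e3 := (hratio n).2
    have e4 := hw n hn
    exact mul_le_one₀ (mul_le_one₀ e1 e2 e3) e4.1 e4.2
  have hpownorm : ∀ n ∈ I₀, ∀ u : ℝ, ‖(n : ℂ) ^ (-((u : ℂ) + t * I))‖ = (n : ℝ) ^ (-u) := by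
    intro n hn u
    have h1 : (0 : ℝ) < n := by exact_mod_cast (Finset.mem_Icc.1 hn).1
    rw [← ofReal_natCast, norm_cpow_eq_rpow_re_of_pos h1]
    simp
  have hΨ3 : ‖Ψ (3 : ℝ)‖ ≤ 2 := by
    have hsum : Summable fun n : ℕ => 1 / (n : ℝ) ^ 2 := hasSum_zeta_two.summable
    calc ‖Ψ (3 : ℝ)‖ ≤ ∑ n ∈ I₀, 1 / (n : ℝ) ^ 2 := by
          refine (norm_sum_le _ _).trans (Finset.sum_le_sum fun n hn => ?_)
          have h1 : (1 : ℝ) ≤ n := by exact_mod_cast (Finset.mem_Icc.1 hn).1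
          rw [norm_mul, hpownorm n hn]
          calc ‖A n‖ * (n : ℝ) ^ (-(3 : ℝ)) ≤ 1 * (n : ℝ) ^ (-(2 : ℝ)) := by
                gcongr
                · exact hAn n hn
                · norm_num
            _ = 1 / (n : ℝ) ^ 2 := by
                rw [one_mul, Real.rpow_neg (by linarith), Real.rpow_two, one_div]
      _ ≤ ∑' n : ℕ, 1 / (n : ℝ) ^ 2 := hsum.sum_le_tsum _ (fun n _ => by positivity)
      _ = Real.pi ^ 2 / 6 := hasSum_zeta_two.tsum_eq
      _ ≤ 2 := by nlinarith [Real.pi_lt_d4, Real.pi_gt_three]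
  have hL3 : |Real.log ‖DirichletCharacter.LFunction χ ((3 : ℝ) + t * I)‖| ≤ 2 := by
    obtain ⟨h1, h2⟩ := one_third_le_norm (norm_LFunction_sub_one_le χ
      (s := ((3 : ℝ) : ℂ) + t * I) (by simp))
    have e3 : Real.log 3 ≤ 2 * Real.log 2 := by
      rw [show 2 * Real.log 2 = Real.log (2 ^ 2) by rw [Real.log_pow]; push_cast; ring]
      exact Real.log_le_log (by norm_num) (by norm_num)
    have e2 := Real.log_two_lt_d9
    rw [abs_le]
    constructor
    · have := Real.log_le_log (by norm_num) h1
      rw [one_div, Real.log_inv] at this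
      linarith
    · have := Real.log_le_log (by linarith) h2
      linarith
  have hΦ3 : |Φ 3| ≤ 4 := by
    have h1 := abs_re_le_norm (Ψ (3 : ℝ))
    have h2 : |Φ 3| ≤ |Real.log ‖DirichletCharacter.LFunction χ ((3 : ℝ) + t * I)‖| +
        |(Ψ (3 : ℝ)).re| := abs_sub _ _
    linarith
  -- prime powers that are not primes contribute a bounded amount
  have hprime : |(Ψ σ).re - ∑ q ∈ I₀.filter Nat.Prime,
      (χ (q : ZMod N) * (q : ℂ) ^ (-((σ : ℂ) + t * I))).re * (1 - q / x)| ≤ S := by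
    have hterm : ∀ n ∈ I₀, n.Prime → (A n * (n : ℂ) ^ (-((σ : ℂ) + t * I))).re =
        (χ (n : ZMod N) * (n : ℂ) ^ (-((σ : ℂ) + t * I))).re * (1 - n / x) := by
      intro n hn hp
      have hl : Real.log n ≠ 0 := by
        have : (1 : ℝ) < n := by exact_mod_cast hp.one_lt
        exact (Real.log_pos this).ne'
      simp only [hA]
      rw [ArithmeticFunction.vonMangoldt_apply_prime hp, div_self hl, ofReal_one, mul_one,
        mul_right_comm, re_mul_ofReal]
    rw [hΨ]
    simp only [re_sum]
    rw [← Finset.sum_filter_add_sum_filter_not I₀ Nat.Prime,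
      Finset.sum_congr rfl fun n hn =>
        hterm n (Finset.mem_filter.1 hn).1 (Finset.mem_filter.1 hn).2,
      add_sub_cancel_left]
    refine (Finset.abs_sum_le_sum_abs _ _).trans ?_
    refine le_trans (Finset.sum_le_sum fun n hn => ?_)
      ((summable_primePow_not_prime hσ).sum_le_tsum _
        (fun n _ => by split_ifs <;> positivity))
    obtain ⟨h1, h2⟩ := Finset.mem_filter.1 hn
    refine (abs_re_le_norm _).trans ?_
    rw [norm_mul, hpownorm n h1]
    by_cases hpp : IsPrimePow n
    · rw [if_pos ⟨hpp, h2⟩]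
      exact mul_le_of_le_one_left (by positivity) (hAn n h1)
    · rw [if_neg (fun h => hpp h.1)]
      have : A n = 0 := by
        simp [hA, ArithmeticFunction.vonMangoldt_eq_zero_iff.2 hpp]
      rw [this, norm_zero, zero_mul]
  have hE : 0 ≤ C₁ * (1 + Real.log N) * x ^ (-a) := by positivity
  have hfin : |Φ σ| ≤ 4 + 3 * (C₁ * (1 + Real.log N) * x ^ (-a)) := by
    rw [Real.norm_eq_abs] at hmv
    have h1 : |Φ σ| ≤ |Φ σ - Φ 3| + |Φ 3| := by
      have := abs_add_le (Φ σ - Φ 3) (Φ 3); simpa using this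
    have h2 : C₁ * (1 + Real.log N) * x ^ (-a) * ‖σ - 3‖ ≤
        C₁ * (1 + Real.log N) * x ^ (-a) * 3 := by gcongr
    linarith
  have hdecomp := abs_add_le (Φ σ) ((Ψ σ).re - ∑ q ∈ I₀.filter Nat.Prime,
      (χ (q : ZMod N) * (q : ℂ) ^ (-((σ : ℂ) + t * I))).re * (1 - q / x))
  rw [show Φ σ + ((Ψ σ).re - ∑ q ∈ I₀.filter Nat.Prime,
      (χ (q : ZMod N) * (q : ℂ) ^ (-((σ : ℂ) + t * I))).re * (1 - q / x)) =
      Real.log ‖DirichletCharacter.LFunction χ (σ + t * I)‖ - ∑ q ∈ I₀.filter Nat.Prime,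
      (χ (q : ZMod N) * (q : ℂ) ^ (-((σ : ℂ) + t * I))).re * (1 - q / x) by
    simp only [hΦ]; ring] at hdecomp
  refine hdecomp.trans ?_
  have hQ : 0 ≤ (1 + Real.log N) * x ^ (-a) := by positivity
  nlinarith [mul_nonneg hS0 hQ]

end

/-! ### The Jacobi symbol as a character in its denominator -/

section

open MeasureTheory
open ArithmeticFunction (vonMangoldt)
open scoped NumberTheorySymbols

/-- For an odd prime factor `l` of `m`, the Chinese remainder theorem gives an `a` that is a
nonresidue modulo `l` and `1` modulo `4 m / l`; quadratic reciprocity then computes `(m / a)`.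
Without such a factor `m = 2`, and `a = 3` works. -/
theorem exists_jacobiSym_eq_neg_one {m : ℕ} (hm : Squarefree m) (h1 : 1 < m) :
    ∃ a : ℕ, Odd a ∧ J(m | a) = -1 := by
  by_cases h : ∃ l : ℕ, l.Prime ∧ l ∣ m ∧ l ≠ 2
  · obtain ⟨l, hl, hlm, hl2⟩ := h
    obtain ⟨j, rfl⟩ := hlm
    have : Fact l.Prime := ⟨hl⟩
    have hj0 : 0 < j := Nat.pos_of_ne_zero (by rintro rfl; simp at h1)
    have hcop : Nat.Coprime l j := Nat.coprime_of_squarefree_mul hm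
    have hlodd : Odd l := hl.odd_of_ne_two hl2
    have hcop4 : Nat.Coprime l (4 * j) := by
      refine Nat.Coprime.mul_right ?_ hcop
      have : Nat.Coprime l (2 ^ 2) :=
        Nat.Coprime.pow_right 2 ((Nat.coprime_primes hl Nat.prime_two).2 hl2)
      simpa using this
    obtain ⟨r, hr⟩ := quadraticChar_exists_neg_one' (F := ZMod l) (by
      rw [ZMod.ringChar_zmod_n]; exact hl2)
    obtain ⟨a, ha1, ha2⟩ := Nat.chineseRemainder hcop4 (r : ZMod l).val 1
    have hmod : a % (4 * j) = 1 := by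
      have : a % (4 * j) = 1 % (4 * j) := ha2
      rwa [Nat.mod_eq_of_lt (by omega : 1 < 4 * j)] at this
    have ha4 : a % 4 = 1 := by
      have := Nat.mod_mul_right_mod a 4 j
      rw [hmod] at this
      omega
    have hodd : Odd a := Nat.odd_iff.2 (by omega)
    refine ⟨a, hodd, ?_⟩
    push_cast
    rw [jacobiSym.mul_left, jacobiSym.mod_right' j hodd, hmod, jacobiSym.one_right, mul_one,
      jacobiSym.quadratic_reciprocity_one_mod_four' hlodd ha4, ← jacobiSym.legendreSym.to_jacobiSym,
      legendreSym]
    have har : (a : ZMod l) = r := by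
      have := (ZMod.natCast_eq_natCast_iff _ _ _).2 ha1
      simpa using this
    push_cast
    rw [har]
    exact hr
  · push Not at h
    have hpow := Nat.eq_prime_pow_of_unique_prime_dvd (p := 2) (n := m) (by omega)
      (fun {d} hd hdm => h d hd hdm)
    set k := m.primeFactorsList.length with hk
    have hk1 : k = 1 := by
      rcases Nat.lt_or_ge k 2 with h' | h'
      · interval_cases k
        · omega
        · rfl
      · exfalso
        have h4 : 2 * 2 ∣ m := by
          rw [hpow]
          exact pow_dvd_pow 2 h'
        have := hm 2 h4
        norm_num [Nat.isUnit_iff] at this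
    rw [hk1, pow_one] at hpow
    subst hpow
    refine ⟨3, by decide, ?_⟩
    have := jacobiSym.at_two (b := 3) (by decide)
    push_cast
    rw [this]
    decide

/-- The Dirichlet character `n ↦ (m / n)` (Jacobi symbol) modulo `4 m`, which quadratic
reciprocity makes periodic; it vanishes at even `n`. -/
noncomputable def jacobiChar (m : ℕ) [NeZero m] : DirichletCharacter ℂ (4 * m) where
  toFun a := open Classical in if IsUnit a then ((J(m | a.val) : ℤ) : ℂ) else 0
  map_one' := by
    have h : (1 : ZMod (4 * m)).val = 1 := by
      have : Fact (1 < 4 * m) := ⟨by have := Nat.pos_of_neZero m; omega⟩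
      exact ZMod.val_one _
    rw [if_pos isUnit_one, h, jacobiSym.one_right]
    simp
  map_mul' a b := by
    have hpos := Nat.pos_of_neZero m
    by_cases ha : IsUnit a
    · by_cases hb : IsUnit b
      · have hab := ha.mul hb
        have hodd : ∀ c : ZMod (4 * m), IsUnit c → Odd c.val := by
          intro c hc
          have h1 : Nat.Coprime c.val (4 * m) := by
            rw [← ZMod.isUnit_iff_coprime]; simpa using hc
          have h2 : Nat.Coprime c.val 2 :=
            h1.coprime_dvd_right (Dvd.dvd.mul_right (by norm_num) m)
          exact (Nat.coprime_two_right.1 h2)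
        have hne : ∀ c : ZMod (4 * m), IsUnit c → c.val ≠ 0 := by
          intro c hc h0
          have := hodd c hc
          rw [h0] at this
          simp at this
        simp only [if_pos ha, if_pos hb, if_pos hab]
        rw [ZMod.val_mul, ← jacobiSym.mod_right' m ((hodd a ha).mul (hodd b hb)),
          jacobiSym.mul_right' _ (hne a ha) (hne b hb)]
        push_cast
        rfl
      · have hab : ¬ IsUnit (a * b) := fun h => hb (isUnit_of_mul_isUnit_right h)
        simp only [if_neg hb, if_neg hab, mul_zero]
    · have hab : ¬ IsUnit (a * b) := fun h => ha (isUnit_of_mul_isUnit_left h)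
      simp only [if_neg ha, if_neg hab, zero_mul]
  map_nonunit' a ha := by
    simp only [if_neg ha]

theorem jacobiChar_natCast (m : ℕ) [NeZero m] (n : ℕ) :
    jacobiChar m (n : ZMod (4 * m)) = if Odd n then ((J(m | n) : ℤ) : ℂ) else 0 := by
  have hdef : jacobiChar m (n : ZMod (4 * m)) = open Classical in
      if IsUnit (n : ZMod (4 * m)) then ((J(m | (n : ZMod (4 * m)).val) : ℤ) : ℂ) else 0 := rfl
  rw [hdef]
  by_cases hodd : Odd n
  · rw [if_pos hodd, ZMod.val_natCast, ← jacobiSym.mod_right' m hodd]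
    split_ifs with hu
    · rfl
    · have hn0 : n ≠ 0 := by rintro rfl; simp at hodd
      have hz : J(m | n) = 0 := by
        refine jacobiSym.eq_zero_iff.2 ⟨hn0, fun hg => hu ?_⟩
        rw [ZMod.isUnit_iff_coprime]
        refine Nat.Coprime.mul_right ?_ ?_
        · have : Nat.Coprime n (2 ^ 2) := Nat.Coprime.pow_right 2 (Nat.coprime_two_right.2 hodd)
          simpa using this
        · have hg' : Nat.gcd m n = 1 := by simpa [Int.gcd] using hg
          exact Nat.Coprime.symm hg'
      rw [hz]; simp
  · rw [if_neg hodd, if_neg]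
    rw [ZMod.isUnit_iff_coprime]
    intro h1
    exact hodd (Nat.coprime_two_right.1
      (h1.coprime_dvd_right (Dvd.dvd.mul_right (by norm_num) m)))

theorem jacobiChar_ne_one {m : ℕ} [NeZero m] (hm : Squarefree m) (h1 : 1 < m) :
    jacobiChar m ≠ 1 := by
  obtain ⟨a, ha, hJ⟩ := exists_jacobiSym_eq_neg_one hm h1
  intro h
  have h2 := jacobiChar_natCast m a
  rw [if_pos ha, hJ, h] at h2
  by_cases hu : IsUnit (a : ZMod (4 * m))
  · rw [MulChar.one_apply hu] at h2
    norm_num at h2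
  · rw [MulChar.map_nonunit _ hu] at h2
    norm_num at h2

/-- Under GRH the symbols `(m / n)`, weighted by `Λ n (1 - n / x)`, cancel for squarefree `m > 1`,
with only a logarithmic loss in `m`. -/
theorem GeneralizedRH.abs_sum_jacobiSym_le (hGRH : GeneralizedRH) {b : ℝ} (hb : 1 / 2 < b)
    (hb1 : b ≤ 1) : ∃ C : ℝ, 0 ≤ C ∧ ∀ m : ℕ, Squarefree m → 1 < m → ∀ x : ℝ, 1 < x →
      |∑ n ∈ (Finset.Icc 1 ⌊x⌋₊).filter Odd, vonMangoldt n * (1 - n / x) * (J(m | n) : ℝ)| ≤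
        C * (1 + Real.log m) * x ^ b := by
  have hJ0 : 0 ≤ ∫ y : ℝ, (1 + |y|) ^ (-(3 / 2) : ℝ) := integral_nonneg fun y => by positivity
  refine ⟨9 * (∫ y : ℝ, (1 + |y|) ^ (-(3 / 2) : ℝ)) * (720 / (b - 1 / 2) ^ 2) * 3, by positivity,
    fun m hm h1 x hx => ?_⟩
  have : NeZero m := ⟨by omega⟩
  have hm1 : (1 : ℝ) < m := by exact_mod_cast h1
  have hlm := Real.log_pos hm1
  have key := hGRH.norm_sum_mul_vonMangoldt_le (jacobiChar_ne_one hm h1) hb hb1 hx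
  have e : ∑ n ∈ Finset.Icc 1 ⌊x⌋₊, jacobiChar m n * vonMangoldt n * ((1 - n / x : ℝ) : ℂ) =
      ((∑ n ∈ (Finset.Icc 1 ⌊x⌋₊).filter Odd, vonMangoldt n * (1 - n / x) * (J(m | n) : ℝ) : ℝ) :
        ℂ) := by
    rw [Finset.sum_filter, Complex.ofReal_sum]
    refine Finset.sum_congr rfl fun n _ => ?_
    rw [jacobiChar_natCast]
    split_ifs
    · push_cast; ring
    · simp
  rw [e, Complex.norm_real, Real.norm_eq_abs] at key
  refine key.trans ?_
  have hlog : 1 + Real.log ((4 * m : ℕ) : ℝ) ≤ 3 * (1 + Real.log m) := by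
    push_cast
    rw [Real.log_mul (by norm_num) (by linarith)]
    have : Real.log 4 = 2 * Real.log 2 := by
      rw [show (4 : ℝ) = 2 ^ 2 by norm_num, Real.log_pow]; push_cast; ring
    linarith [Real.log_two_lt_d9]
  have hx0 : 0 < x := by linarith
  calc _ ≤ 9 * (∫ y : ℝ, (1 + |y|) ^ (-(3 / 2) : ℝ)) * (720 / (b - 1 / 2) ^ 2) *
        (3 * (1 + Real.log m)) * x ^ b := by gcongr
    _ = _ := by ring

end

/-! ### Moments of a product detecting sign patterns -/

section

open MeasureTheory Filter Topology
open ArithmeticFunction (vonMangoldt)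
open scoped NumberTheorySymbols

section Moments

/-! The values `j q n` stand for the symbols `(q / n)`, the signs `e q` for the prescribed values.
For `j q n = ±1` the product `∏ q ∈ Q, (1 + e q * j q n)` is `2 ^ #Q` or `0`, according to
whether the prescription is met at `n` or not. -/

variable {ι : Type*} {M : Finset ι} {w : ι → ℝ} {j : ℕ → ι → ℝ} {Q Q' : Finset ℕ}
  {e a : ℕ → ℝ} {E : ℝ}

theorem abs_sum_mul_sum_prod_le (he : ∀ q, |e q| = 1) (S : Finset (Finset ℕ)) (v : ι → ℝ)
    (h : ∀ R ∈ S, |∑ n ∈ M, v n * ∏ q ∈ R, j q n| ≤ E) :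
    |∑ n ∈ M, v n * ∑ R ∈ S, ∏ q ∈ R, (e q * j q n)| ≤ S.card * E := by
  have h1 : ∑ n ∈ M, v n * ∑ R ∈ S, ∏ q ∈ R, (e q * j q n) =
      ∑ R ∈ S, (∏ q ∈ R, e q) * ∑ n ∈ M, v n * ∏ q ∈ R, j q n := by
    simp_rw [Finset.mul_sum]
    rw [Finset.sum_comm]
    refine Finset.sum_congr rfl fun R _ => Finset.sum_congr rfl fun n _ => ?_
    rw [Finset.prod_mul_distrib]; ring
  rw [h1]
  refine (Finset.abs_sum_le_sum_abs _ _).trans ?_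
  refine (Finset.sum_le_sum fun R hR => ?_).trans (by rw [Finset.sum_const, nsmul_eq_mul])
  rw [abs_mul, Finset.abs_prod, Finset.prod_congr rfl fun q _ => he q, Finset.prod_const_one,
    one_mul]
  exact h R hR

/-- First moment: only the empty subset of `Q` gives a main term when the product is expanded. -/
theorem abs_sum_mul_prod_one_add_sub_le (he : ∀ q, |e q| = 1) (hE : 0 ≤ E)
    (h : ∀ R ⊆ Q, R.Nonempty → |∑ n ∈ M, w n * ∏ q ∈ R, j q n| ≤ E) :
    |∑ n ∈ M, w n * ∏ q ∈ Q, (1 + e q * j q n) - ∑ n ∈ M, w n| ≤ 2 ^ Q.card * E := by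
  have h1 : ∑ n ∈ M, w n * ∏ q ∈ Q, (1 + e q * j q n) - ∑ n ∈ M, w n =
      ∑ n ∈ M, w n * ∑ R ∈ Q.powerset.erase ∅, ∏ q ∈ R, (e q * j q n) := by
    rw [← Finset.sum_sub_distrib]
    refine Finset.sum_congr rfl fun n _ => ?_
    rw [Finset.prod_one_add,
      ← Finset.add_sum_erase _ _ (Finset.empty_mem_powerset Q), Finset.prod_empty]
    ring
  rw [h1]
  refine (abs_sum_mul_sum_prod_le (E := E) he _ w fun R hR => ?_).trans ?_
  · obtain ⟨h2, h3⟩ := Finset.mem_erase.1 hR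
    exact h R (Finset.mem_powerset.1 h3) (Finset.nonempty_iff_ne_empty.2 h2)
  · gcongr
    calc ((Q.powerset.erase ∅).card : ℝ) ≤ (Q.powerset.card : ℝ) := by
          exact_mod_cast Finset.card_le_card (Finset.erase_subset _ _)
      _ = 2 ^ Q.card := by rw [Finset.card_powerset]; push_cast; rfl

/-- Second moment: the sum over `Q'` has bounded mean square on the set that the product detects,
since only its diagonal terms survive. -/
theorem sum_mul_prod_one_add_mul_sq_le (hw : ∀ n ∈ M, 0 ≤ w n) (he : ∀ q, |e q| = 1)
    (hj : ∀ q, ∀ n ∈ M, |j q n| ≤ 1) (hE : 0 ≤ E)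
    (h : ∀ R ⊆ Q, ∀ q₁ ∈ Q', ∀ q₂ ∈ Q', q₁ ≠ q₂ →
      |∑ n ∈ M, w n * (j q₁ n * j q₂ n) * ∏ q ∈ R, j q n| ≤ E) :
    ∑ n ∈ M, w n * (∏ q ∈ Q, (1 + e q * j q n)) * (∑ q ∈ Q', a q * j q n) ^ 2 ≤
      (∑ q ∈ Q', a q ^ 2) * ∑ n ∈ M, w n * ∏ q ∈ Q, (1 + e q * j q n) +
        (∑ q ∈ Q', |a q|) ^ 2 * (2 ^ Q.card * E) := by
  set P : ι → ℝ := fun n => ∏ q ∈ Q, (1 + e q * j q n) with hP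
  have hP0 : ∀ n ∈ M, 0 ≤ P n := by
    intro n hn
    refine Finset.prod_nonneg fun q _ => ?_
    have : |e q * j q n| ≤ 1 := by rw [abs_mul, he, one_mul]; exact hj q n hn
    linarith [(abs_le.1 this).1]
  have hexp : ∑ n ∈ M, w n * P n * (∑ q ∈ Q', a q * j q n) ^ 2 =
      ∑ q₁ ∈ Q', ∑ q₂ ∈ Q', a q₁ * a q₂ * ∑ n ∈ M, w n * (j q₁ n * j q₂ n) * P n := by
    simp_rw [sq, Finset.sum_mul_sum, Finset.mul_sum]
    rw [Finset.sum_comm]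
    refine Finset.sum_congr rfl fun q₁ _ => ?_
    rw [Finset.sum_comm]
    refine Finset.sum_congr rfl fun q₂ _ => Finset.sum_congr rfl fun n _ => ?_
    ring
  have hterm : ∀ q₁ ∈ Q', ∀ q₂ ∈ Q', a q₁ * a q₂ * ∑ n ∈ M, w n * (j q₁ n * j q₂ n) * P n ≤
      (if q₁ = q₂ then a q₁ ^ 2 * ∑ n ∈ M, w n * P n else 0) +
        |a q₁| * |a q₂| * (2 ^ Q.card * E) := by
    intro q₁ h₁ q₂ h₂
    have hnn : 0 ≤ |a q₁| * |a q₂| * (2 ^ Q.card * E) := by positivity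
    split_ifs with heq
    · subst heq
      have : ∑ n ∈ M, w n * (j q₁ n * j q₁ n) * P n ≤ ∑ n ∈ M, w n * P n := by
        refine Finset.sum_le_sum fun n hn => ?_
        have h1 : j q₁ n * j q₁ n ≤ 1 := by
          have := hj q₁ n hn
          rw [← abs_mul_abs_self]
          nlinarith [abs_nonneg (j q₁ n)]
        have h2 := mul_nonneg (hw n hn) (hP0 n hn)
        nlinarith
      nlinarith [mul_le_mul_of_nonneg_left this (sq_nonneg (a q₁))]
    · have h3 : |∑ n ∈ M, w n * (j q₁ n * j q₂ n) * P n| ≤ 2 ^ Q.card * E := by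
        simp only [hP, Finset.prod_one_add]
        refine (abs_sum_mul_sum_prod_le (E := E) he _ _ fun R hR => ?_).trans (le_of_eq ?_)
        · exact h R (Finset.mem_powerset.1 hR) q₁ h₁ q₂ h₂ heq
        · rw [Finset.card_powerset]; push_cast; rfl
      rw [zero_add]
      refine (le_abs_self _).trans ?_
      rw [abs_mul, abs_mul]
      gcongr
  rw [hexp]
  refine (Finset.sum_le_sum fun q₁ h₁ => Finset.sum_le_sum fun q₂ h₂ => hterm q₁ h₁ q₂ h₂).trans ?_
  refine le_of_eq ?_
  simp_rw [Finset.sum_add_distrib]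
  congr 1
  · rw [Finset.sum_mul]
    refine Finset.sum_congr rfl fun q₁ h₁ => ?_
    rw [Finset.sum_ite_eq, if_pos h₁]
  · rw [sq, Finset.sum_mul_sum, Finset.sum_mul]
    refine Finset.sum_congr rfl fun q₁ _ => ?_
    rw [Finset.sum_mul]

end Moments

/-- Cancellation of `∏ q ∈ R, (q / n)`, by multiplicativity of the symbol in its numerator. -/
theorem abs_sum_prod_jacobiSym_le {b C x z : ℝ} (hC : 0 ≤ C)
    (h : ∀ m : ℕ, Squarefree m → 1 < m →
      |∑ n ∈ (Finset.Icc 1 ⌊x⌋₊).filter Odd, vonMangoldt n * (1 - n / x) * (J(m | n) : ℝ)| ≤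
        C * (1 + Real.log m) * x ^ b) (hx : 1 < x) {R : Finset ℕ}
    (hR : ∀ q ∈ R, q.Prime ∧ (q : ℝ) ≤ z) (hne : R.Nonempty) :
    |∑ n ∈ (Finset.Icc 1 ⌊x⌋₊).filter Odd,
      vonMangoldt n * (1 - n / x) * ∏ q ∈ R, (J(q | n) : ℝ)| ≤
        C * (1 + R.card * Real.log z) * x ^ b := by
  set m := ∏ q ∈ R, q with hm
  have hsq : Squarefree m := by
    refine Finset.squarefree_prod_of_pairwise_isCoprime (fun p hp q hq hpq => ?_)
      fun q hq => (hR q hq).1.prime.squarefree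
    have : Nat.Coprime p q := (Nat.coprime_primes (hR p hp).1 (hR q hq).1).2 hpq
    exact Nat.coprime_iff_isRelPrime.1 this
  have h1 : 1 < m := by
    obtain ⟨q, hq⟩ := hne
    have hdvd : q ∣ m := Finset.dvd_prod_of_mem _ hq
    have hm0 : 0 < m := Finset.prod_pos fun q hq => (hR q hq).1.pos
    exact (hR q hq).1.one_lt.trans_le (Nat.le_of_dvd hm0 hdvd)
  have hprod : ∀ n : ℕ, (J(m | n) : ℝ) = ∏ q ∈ R, (J(q | n) : ℝ) := by
    intro n
    have : ∀ R : Finset ℕ, J(((∏ q ∈ R, q : ℕ) : ℤ) | n) = ∏ q ∈ R, J(q | n) := by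
      intro R
      induction R using Finset.induction_on with
      | empty => simp
      | insert q R hq ih =>
        rw [Finset.prod_insert hq, Finset.prod_insert hq, Nat.cast_mul, jacobiSym.mul_left, ih]
    rw [hm, this R]
    push_cast
    rfl
  have key := h m hsq h1
  simp_rw [hprod] at key
  refine key.trans ?_
  have hlog : Real.log m ≤ R.card * Real.log z := by
    rw [hm]
    push_cast
    rw [Real.log_prod (fun q hq => by exact_mod_cast (hR q hq).1.ne_zero), ← nsmul_eq_mul]
    refine Finset.sum_le_card_nsmul _ _ _ fun q hq => ?_
    exact Real.log_le_log (by exact_mod_cast (hR q hq).1.pos) (hR q hq).2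
  have hx0 : 0 < x := by linarith
  gcongr

end

/-! ### Many primes with prescribed symbols -/

section

open MeasureTheory Filter Topology
open ArithmeticFunction (vonMangoldt)
open scoped NumberTheorySymbols

/-- Prime powers that are not prime contribute little to `ψ(x)`. -/
theorem sum_vonMangoldt_not_prime_le {x : ℝ} (hx : 1 ≤ x) :
    ∑ n ∈ (Finset.Icc 1 ⌊x⌋₊).filter (fun n => ¬ n.Prime), vonMangoldt n ≤
      2 * √x * Real.log x := by
  have := Chebyshev.psi_sub_theta_le hx
  rwa [Chebyshev.psi_sub_theta_eq_sum_not_prime] at this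

theorem abs_jacobiSym_le_one (a : ℤ) (n : ℕ) : |(J(a | n) : ℝ)| ≤ 1 := by
  rcases jacobiSym.trichotomy a n with h | h | h <;> simp [h]

theorem jacobiSym_eq_of_ne_neg {q p : ℕ} (hq : q.Prime) (hp : p.Prime) (hqp : q < p) {e : ℝ}
    (he : |e| = 1) (h : 1 + e * (J(q | p) : ℝ) ≠ 0) : (J(q | p) : ℝ) = e := by
  have hcop : Int.gcd (q : ℤ) p = 1 := by
    rw [Int.gcd_natCast_natCast]
    exact (Nat.coprime_primes hq hp).2 hqp.ne
  rcases jacobiSym.eq_one_or_neg_one hcop with h1 | h1 <;>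
    rcases (abs_eq zero_le_one).1 he with h2 | h2 <;> simp [h1, h2] at h ⊢

/-- The first moment is bounded by the number of primes with the prescribed symbols and small `T`,
by the second moment of `T`, and by negligible contributions of proper prime powers
and of `n ≤ √x`. -/
theorem sum_odd_mul_prod_le {x y : ℝ} (hx : 1 ≤ x) (hy : y ≤ √x) {e : ℕ → ℝ}
    (he : ∀ q, |e q| = 1) (T : ℕ → ℝ) {K : ℝ} (hK : 0 < K) {Q : Finset ℕ}
    (hQ : ∀ q ∈ Q, q.Prime ∧ (q : ℝ) ≤ y) :
    ∑ n ∈ (Finset.Icc 1 ⌊x⌋₊).filter Odd,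
        vonMangoldt n * (1 - n / x) * ∏ q ∈ Q, (1 + e q * (J(q | n) : ℝ)) ≤
      ((Finset.Icc 1 ⌊x⌋₊).filter fun p => p.Prime ∧ p ≠ 2 ∧
          (∀ q ∈ Q, (J(q | p) : ℝ) = e q) ∧ |T p| ≤ K).card * (2 ^ Q.card * Real.log x) +
        (∑ n ∈ (Finset.Icc 1 ⌊x⌋₊).filter Odd,
          vonMangoldt n * (1 - n / x) * (∏ q ∈ Q, (1 + e q * (J(q | n) : ℝ))) * T n ^ 2) / K ^ 2 +
        2 ^ Q.card * (2 * √x * Real.log x) + 2 ^ Q.card * ((Real.log 4 + 4) * √x) := by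
  have hx0 : 0 < x := by linarith
  set I := Finset.Icc 1 ⌊x⌋₊ with hI
  set P : ℕ → ℝ := fun n => ∏ q ∈ Q, (1 + e q * (J(q | n) : ℝ)) with hP
  set good : ℕ → Prop := fun p => p.Prime ∧ p ≠ 2 ∧ (∀ q ∈ Q, (J(q | p) : ℝ) = e q) ∧ |T p| ≤ K
    with hgood
  have hej : ∀ q n, |e q * (J(q | n) : ℝ)| ≤ 1 := fun q n => by
    rw [abs_mul, he, one_mul]; exact abs_jacobiSym_le_one _ _
  have hP0 : ∀ n, 0 ≤ P n := fun n => Finset.prod_nonneg fun q _ => by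
    linarith [(abs_le.1 (hej q n)).1]
  have hPD : ∀ n, P n ≤ 2 ^ Q.card := fun n => by
    refine (Finset.prod_le_prod (g := fun _ => (2 : ℝ)) (fun q _ => ?_) fun q _ => ?_).trans
      (by rw [Finset.prod_const])
    · linarith [(abs_le.1 (hej q n)).1]
    · linarith [(abs_le.1 (hej q n)).2]
  have hle : ∀ n ∈ I, (n : ℝ) ≤ x := fun n hn => by
    have := (Finset.mem_Icc.1 hn).2
    exact (Nat.cast_le.2 this).trans (Nat.floor_le hx0.le)
  have hw0 : ∀ n ∈ I, 0 ≤ vonMangoldt n * (1 - n / x) := fun n hn => by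
    have : (n : ℝ) / x ≤ 1 := (div_le_one hx0).2 (hle n hn)
    exact mul_nonneg ArithmeticFunction.vonMangoldt_nonneg (by linarith)
  have hwL : ∀ n ∈ I, vonMangoldt n * (1 - n / x) ≤ vonMangoldt n := fun n hn => by
    have : 0 ≤ (n : ℝ) / x := by positivity
    have := ArithmeticFunction.vonMangoldt_nonneg (n := n)
    nlinarith
  have hsqrt : ∑ n ∈ I.filter (fun n : ℕ => (n : ℝ) ≤ √x), vonMangoldt n ≤
      (Real.log 4 + 4) * √x := by
    refine le_trans ?_ (Chebyshev.psi_le_const_mul_self (Real.sqrt_nonneg x))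
    refine Finset.sum_le_sum_of_subset_of_nonneg (fun n hn => ?_)
      fun _ _ _ => ArithmeticFunction.vonMangoldt_nonneg
    obtain ⟨h1, h2⟩ := Finset.mem_filter.1 hn
    exact Finset.mem_Ioc.2 ⟨(Finset.mem_Icc.1 h1).1, Nat.le_floor h2⟩
  have hpt : ∀ n ∈ I.filter Odd, vonMangoldt n * (1 - n / x) * P n ≤
      (if good n then 2 ^ Q.card * Real.log x else 0) +
      vonMangoldt n * (1 - n / x) * P n * T n ^ 2 / K ^ 2 +
      2 ^ Q.card * (if ¬ n.Prime then vonMangoldt n else 0) +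
      2 ^ Q.card * (if (n : ℝ) ≤ √x then vonMangoldt n else 0) := by
    intro n hn
    obtain ⟨hnI, hodd⟩ := Finset.mem_filter.1 hn
    have hΛ := ArithmeticFunction.vonMangoldt_nonneg (n := n)
    have hwP : vonMangoldt n * (1 - n / x) * P n ≤ 2 ^ Q.card * vonMangoldt n := by
      rw [mul_comm ((2 : ℝ) ^ _)]
      exact mul_le_mul (hwL n hnI) (hPD n) (hP0 n) hΛ
    have hlog : 0 ≤ Real.log x := Real.log_nonneg hx
    have h1 : 0 ≤ (if good n then 2 ^ Q.card * Real.log x else 0) := by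
      split_ifs <;> positivity
    have hwP0 := mul_nonneg (hw0 n hnI) (hP0 n)
    have h2 : 0 ≤ vonMangoldt n * (1 - n / x) * P n * T n ^ 2 / K ^ 2 := by positivity
    have h3 : 0 ≤ 2 ^ Q.card * (if ¬ n.Prime then vonMangoldt n else 0) := by
      split_ifs <;> positivity
    have h4 : 0 ≤ 2 ^ Q.card * (if (n : ℝ) ≤ √x then vonMangoldt n else 0) := by
      split_ifs <;> positivity
    by_cases c1 : n.Prime
    swap
    · rw [if_pos c1] at h3 ⊢
      linarith
    by_cases c2 : (n : ℝ) ≤ √x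
    · rw [if_pos c2] at h4 ⊢
      linarith
    by_cases c3 : |T n| ≤ K
    swap
    · have : 1 ≤ T n ^ 2 / K ^ 2 := by
        rw [one_le_div (by positivity), ← sq_abs (T n)]
        push Not at c3
        gcongr
      have : vonMangoldt n * (1 - n / x) * P n ≤
          vonMangoldt n * (1 - n / x) * P n * T n ^ 2 / K ^ 2 := by
        rw [mul_div_assoc]
        exact le_mul_of_one_le_right hwP0 this
      linarith
    by_cases c4 : P n = 0
    · rw [c4] at h2 ⊢
      linarith
    have hg : good n := by
      refine ⟨c1, fun h => ?_, fun q hq => ?_, c3⟩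
      · subst h; revert hodd; decide
      · have hqn : q < n := by
          have := (hQ q hq).2
          push Not at c2
          exact_mod_cast (this.trans hy).trans_lt c2
        exact jacobiSym_eq_of_ne_neg (hQ q hq).1 c1 hqn (he q) (Finset.prod_ne_zero_iff.1 c4 q hq)
    rw [if_pos hg]
    have : vonMangoldt n ≤ Real.log x := ArithmeticFunction.vonMangoldt_le_log.trans
      (Real.log_le_log (by exact_mod_cast c1.pos) (hle n hnI))
    have : (2 : ℝ) ^ Q.card * vonMangoldt n ≤ 2 ^ Q.card * Real.log x := by gcongr
    linarith
  refine (Finset.sum_le_sum hpt).trans ?_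
  rw [Finset.sum_add_distrib, Finset.sum_add_distrib, Finset.sum_add_distrib, ← Finset.mul_sum,
    ← Finset.mul_sum, Finset.sum_div]
  have hsub : ∀ f : ℕ → ℝ, (∀ n, 0 ≤ f n) → ∑ n ∈ I.filter Odd, f n ≤ ∑ n ∈ I, f n := fun f hf =>
    Finset.sum_le_sum_of_subset_of_nonneg (Finset.filter_subset _ _) fun n _ _ => hf n
  have hlog : 0 ≤ Real.log x := Real.log_nonneg hx
  gcongr
  · refine (hsub _ fun n => by split_ifs <;> positivity).trans ?_
    rw [← Finset.sum_filter, Finset.sum_const, nsmul_eq_mul]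
  · refine (hsub _ fun n => by
      split_ifs <;> first | exact le_rfl | exact ArithmeticFunction.vonMangoldt_nonneg).trans ?_
    rw [← Finset.sum_filter]
    exact sum_vonMangoldt_not_prime_le hx
  · refine (hsub _ fun n => by
      split_ifs <;> first | exact le_rfl | exact ArithmeticFunction.vonMangoldt_nonneg).trans ?_
    rw [← Finset.sum_filter]
    exact hsqrt

/-- Powers of `log x` are negligible against powers of `x`. -/
theorem eventually_mul_log_rpow_mul_rpow_le (r C : ℝ) {a b : ℝ} (hab : a < b) :
    ∀ᶠ x : ℝ in atTop, C * Real.log x ^ r * x ^ a ≤ x ^ b := by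
  have h := ((isLittleO_log_rpow_rpow_atTop r (sub_pos.2 hab)).const_mul_left C).bound one_pos
  filter_upwards [h, eventually_gt_atTop 0] with x hx h0
  have h1 := (le_abs_self _).trans hx
  rw [one_mul, Real.norm_of_nonneg (Real.rpow_nonneg h0.le _)] at h1
  calc C * Real.log x ^ r * x ^ a ≤ x ^ (b - a) * x ^ a := by gcongr
    _ = x ^ b := by rw [← Real.rpow_add h0, sub_add_cancel]

theorem GeneralizedRH.eventually_le_sum_odd (hGRH : GeneralizedRH) :
    ∀ᶠ x : ℝ in atTop, x / 8 ≤
      ∑ n ∈ (Finset.Icc 1 ⌊x⌋₊).filter Odd, vonMangoldt n * (1 - n / x) := by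
  obtain ⟨C, hC⟩ := hGRH.norm_sum_vonMangoldt_sub_le (b := 3 / 4) (by norm_num) (by norm_num)
  have h1 : ∀ᶠ x : ℝ in atTop, C * x ^ (3 / 4 : ℝ) ≤ x / 8 := by
    filter_upwards [eventually_mul_log_rpow_mul_rpow_le 0 (8 * C)
      (show (3 / 4 : ℝ) < 1 by norm_num)] with x hx
    rw [Real.rpow_zero, Real.rpow_one] at hx
    linarith
  have h2 : ∀ᶠ x : ℝ in atTop, 2 * √x * Real.log x + Real.log 2 ≤ x / 8 := by
    have h := (isLittleO_log_rpow_atTop (show (0 : ℝ) < 1 / 2 by norm_num)).bound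
      (show (0 : ℝ) < 1 / 32 by norm_num)
    filter_upwards [h, eventually_ge_atTop 16] with x hx h1
    have h0 : 0 < x := by linarith
    rw [← Real.sqrt_eq_rpow, Real.norm_of_nonneg (Real.log_nonneg (by linarith)),
      Real.norm_of_nonneg (Real.sqrt_nonneg x)] at hx
    have h3 : √x * √x = x := Real.mul_self_sqrt h0.le
    have h4 : 2 * √x * Real.log x ≤ x / 16 := by nlinarith [Real.sqrt_nonneg x]
    linarith [Real.log_two_lt_d9]
  filter_upwards [h1, h2, eventually_ge_atTop 16] with x h1 h2 hx
  have hx0 : 0 < x := by linarith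
  have hmain := (abs_le.1 (hC x (by linarith))).1
  have hsq : x / 4 + x / 8 ≤ x / 2 * (1 - 1 / x) ^ 2 := by
    have : 1 / x ≤ 1 / 16 := one_div_le_one_div_of_le (by norm_num) hx
    have : 3 / 4 ≤ (1 - 1 / x) ^ 2 := by nlinarith
    nlinarith
  have heven : ∑ n ∈ (Finset.Icc 1 ⌊x⌋₊).filter (fun n => ¬ Odd n), vonMangoldt n * (1 - n / x) ≤
      2 * √x * Real.log x + Real.log 2 := by
    have hpt : ∀ n ∈ Finset.Icc 1 ⌊x⌋₊, (if ¬ Odd n then vonMangoldt n * (1 - n / x) else 0) ≤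
        (if ¬ n.Prime then vonMangoldt n else 0) + (if n = 2 then Real.log 2 else 0) := by
      intro n hn
      have hΛ := ArithmeticFunction.vonMangoldt_nonneg (n := n)
      have hw : vonMangoldt n * (1 - n / x) ≤ vonMangoldt n := by
        have : 0 ≤ (n : ℝ) / x := by positivity
        nlinarith
      have hl2 : 0 ≤ Real.log 2 := Real.log_nonneg (by norm_num)
      by_cases c1 : Odd n
      · rw [if_neg (not_not.2 c1)]
        split_ifs <;> linarith
      rw [if_pos c1]
      by_cases c2 : n.Prime
      · have : n = 2 := by
          by_contra h; exact c1 (c2.odd_of_ne_two h)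
        rw [if_neg (not_not.2 c2), if_pos this, zero_add]
        refine hw.trans ?_
        subst this
        rw [ArithmeticFunction.vonMangoldt_apply_prime c2]
        norm_num
      · rw [if_pos c2]
        split_ifs <;> linarith
    rw [Finset.sum_filter]
    refine (Finset.sum_le_sum hpt).trans ?_
    rw [Finset.sum_add_distrib, ← Finset.sum_filter]
    refine add_le_add (sum_vonMangoldt_not_prime_le (by linarith)) ?_
    rw [Finset.sum_ite_eq']
    split_ifs
    · exact le_rfl
    · exact Real.log_nonneg (by norm_num)
  have hsplit := Finset.sum_filter_add_sum_filter_not (Finset.Icc 1 ⌊x⌋₊) (fun n => Odd n)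
    (fun n => vonMangoldt n * (1 - n / x))
  linarith

set_option maxHeartbeats 800000 in
/-- Under GRH the values `J(q | p)` at the primes `q ≤ y` can be prescribed for at least `√x` primes
`p ≤ x`, as long as there are at most `x ^ (1 / 2 - δ)` sign patterns; moreover the primes can be
chosen so that a given sum over `y < q ≤ z` stays bounded, with `z` any power of `log x`. -/
theorem GeneralizedRH.exists_eventually_le_card (hGRH : GeneralizedRH) {σ : ℝ} (hσ : 1 / 2 < σ) :
    ∃ K : ℝ, ∀ δ : ℝ, 0 < δ → δ ≤ 1 → ∀ A : ℝ, 0 ≤ A → ∀ᶠ x : ℝ in atTop,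
      ∀ y : ℝ, y ≤ Real.log x ^ A →
      (2 : ℝ) ^ ((Finset.Icc 1 ⌊y⌋₊).filter Nat.Prime).card ≤ x ^ (1 / 2 - δ) →
      ∀ e a : ℕ → ℝ, (∀ q, |e q| = 1) →
      (∀ q : ℕ, 1 ≤ q → (q : ℝ) ≤ Real.log x ^ A → |a q| ≤ (q : ℝ) ^ (-σ)) →
      x ^ (1 / 2 : ℝ) ≤ ((Finset.Icc 1 ⌊x⌋₊).filter fun p => p.Prime ∧ p ≠ 2 ∧
        (∀ q ∈ (Finset.Icc 1 ⌊y⌋₊).filter Nat.Prime, (J(q | p) : ℝ) = e q) ∧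
        |∑ q ∈ (Finset.Ioc ⌊y⌋₊ ⌊Real.log x ^ A⌋₊).filter Nat.Prime, a q * (J(q | p) : ℝ)| ≤ K).card
    := by
  have hsum : Summable fun n : ℕ => ((n : ℝ) ^ (-σ)) ^ 2 := by
    have : Summable fun n : ℕ => (n : ℝ) ^ (-(2 * σ)) :=
      Real.summable_nat_rpow.2 (by linarith)
    refine this.congr fun n => ?_
    rw [← Real.rpow_natCast, ← Real.rpow_mul (Nat.cast_nonneg n)]
    congr 1; push_cast; ring
  set B : ℝ := ∑' n : ℕ, ((n : ℝ) ^ (-σ)) ^ 2 with hB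
  have hB0 : 0 ≤ B := tsum_nonneg fun n => sq_nonneg _
  set K : ℝ := √(2 * B + 1) with hK
  have hK2 : K ^ 2 = 2 * B + 1 := Real.sq_sqrt (by linarith)
  have hK0 : 0 < K := Real.sqrt_pos.2 (by linarith)
  refine ⟨K, fun δ hδ hδ1 A hA => ?_⟩
  obtain ⟨C, hC0, hC⟩ := hGRH.abs_sum_jacobiSym_le (b := 1 / 2 + δ / 2) (by linarith) (by linarith)
  filter_upwards [hGRH.eventually_le_sum_odd,
    eventually_mul_log_rpow_mul_rpow_le (4 * A) (32 * (12 * C)) (show 1 - δ / 2 < 1 by linarith),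
    eventually_mul_log_rpow_mul_rpow_le 1 (32 * 18) (show 1 - δ < 1 by linarith),
    eventually_mul_log_rpow_mul_rpow_le 1 32 (show 1 / 2 < 1 / 2 + δ by linarith),
    eventually_mul_log_rpow_mul_rpow_le A 1 (show (0 : ℝ) < 1 / 2 by norm_num),
    eventually_ge_atTop (Real.exp 1)] with x hW hl1 hl2 hl3 hl4 hxe
  intro y hyz hD e a he ha
  have hL : 1 ≤ Real.log x := (Real.le_log_iff_exp_le ((Real.exp_pos 1).trans_le hxe)).2 hxe
  have hx1 : 1 < x := (Real.one_lt_exp_iff.2 one_pos).trans_le hxe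
  have hx0 : 0 < x := by linarith
  set z := Real.log x ^ A with hz
  have hz1 : 1 ≤ z := Real.one_le_rpow hL hA
  set Q := (Finset.Icc 1 ⌊y⌋₊).filter Nat.Prime with hQ
  set Q' := (Finset.Ioc ⌊y⌋₊ ⌊z⌋₊).filter Nat.Prime with hQ'
  set M := (Finset.Icc 1 ⌊x⌋₊).filter Odd with hM
  set T : ℕ → ℝ := fun n => ∑ q ∈ Q', a q * (J(q | n) : ℝ) with hT
  have hQmem : ∀ q ∈ Q, q.Prime ∧ (q : ℝ) ≤ y := fun q hq => by
    obtain ⟨h1, h2⟩ := Finset.mem_filter.1 hq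
    obtain ⟨h3, h4⟩ := Finset.mem_Icc.1 h1
    exact ⟨h2, (Nat.le_floor_iff' (by omega)).1 h4⟩
  have hQ'mem : ∀ q ∈ Q', q.Prime ∧ (q : ℝ) ≤ z ∧ q ∉ Q := fun q hq => by
    obtain ⟨h1, h2⟩ := Finset.mem_filter.1 hq
    obtain ⟨h3, h4⟩ := Finset.mem_Ioc.1 h1
    refine ⟨h2, (Nat.le_floor_iff' (by omega)).1 h4, fun h => ?_⟩
    have := (Finset.mem_Icc.1 (Finset.mem_filter.1 h).1).2
    omega
  have hlogz : 0 ≤ Real.log z := Real.log_nonneg hz1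
  have hlogz' : Real.log z ≤ z := (Real.log_le_sub_one_of_pos (by linarith)).trans (by linarith)
  have hQcard : (Q.card : ℝ) ≤ z := by
    have h1 : Q.card ≤ ⌊z⌋₊ := (Finset.card_filter_le _ _).trans (by
      rw [Nat.card_Icc]; simpa using Nat.floor_le_floor hyz)
    exact (Nat.cast_le.2 h1).trans (Nat.floor_le (by linarith))
  have hQ'card : (Q'.card : ℝ) ≤ z := by
    have h1 : Q'.card ≤ ⌊z⌋₊ := (Finset.card_filter_le _ _).trans (by
      rw [Nat.card_Ioc]; omega)
    exact (Nat.cast_le.2 h1).trans (Nat.floor_le (by linarith))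
  set E : ℝ := C * (1 + (z + 2) * z) * x ^ (1 / 2 + δ / 2) with hE
  have hE0 : 0 ≤ E := by positivity
  have hJ : ∀ R : Finset ℕ, (∀ q ∈ R, q.Prime ∧ (q : ℝ) ≤ z) → R.Nonempty → (R.card : ℝ) ≤ z + 2 →
      |∑ n ∈ M, vonMangoldt n * (1 - n / x) * ∏ q ∈ R, (J(q | n) : ℝ)| ≤ E := by
    intro R hR hne hcard
    refine (abs_sum_prod_jacobiSym_le hC0 (fun m h1 h2 => hC m h1 h2 x hx1) hx1 hR hne).trans ?_
    have : (R.card : ℝ) * Real.log z ≤ (z + 2) * z := by gcongr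
    exact mul_le_mul_of_nonneg_right
      (mul_le_mul_of_nonneg_left (by linarith only [this]) hC0) (Real.rpow_nonneg hx0.le _)
  have hw0 : ∀ n ∈ M, 0 ≤ vonMangoldt n * (1 - n / x) := fun n hn => by
    have h1 := (Finset.mem_Icc.1 (Finset.mem_filter.1 hn).1).2
    have h2 : (n : ℝ) / x ≤ 1 := (div_le_one hx0).2
      ((Nat.cast_le.2 h1).trans (Nat.floor_le hx0.le))
    exact mul_nonneg ArithmeticFunction.vonMangoldt_nonneg (by linarith)
  set S := ∑ n ∈ M, vonMangoldt n * (1 - n / x) * ∏ q ∈ Q, (1 + e q * (J(q | n) : ℝ)) with hS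
  have hS0 : 0 ≤ S := by
    refine Finset.sum_nonneg fun n hn => mul_nonneg (hw0 n hn) (Finset.prod_nonneg fun q _ => ?_)
    have : |e q * (J(q | n) : ℝ)| ≤ 1 := by
      rw [abs_mul, he, one_mul]; exact abs_jacobiSym_le_one _ _
    linarith [(abs_le.1 this).1]
  have hfirst := abs_sum_mul_prod_one_add_sub_le (M := M)
    (w := fun n : ℕ => vonMangoldt n * (1 - n / x)) (j := fun q n => (J(q | n) : ℝ)) (Q := Q) he hE0
    (fun R hR hne => hJ R (fun q hq => ⟨(hQmem q (hR hq)).1, (hQmem q (hR hq)).2.trans hyz⟩) hne (by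
      have : (R.card : ℝ) ≤ Q.card := by exact_mod_cast Finset.card_le_card hR
      linarith))
  have hsecond := sum_mul_prod_one_add_mul_sq_le (M := M)
    (w := fun n : ℕ => vonMangoldt n * (1 - n / x)) (j := fun q n => (J(q | n) : ℝ)) (Q := Q)
    (Q' := Q') (e := e) (a := a) (E := E) hw0 he (fun q n _ => abs_jacobiSym_le_one _ _) hE0
    (fun R hR q₁ h₁ q₂ h₂ hne => by
      have hn2 : q₂ ∉ R := fun h => (hQ'mem q₂ h₂).2.2 (hR h)
      have hn1 : q₁ ∉ insert q₂ R := fun h => by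
        rcases Finset.mem_insert.1 h with h | h
        · exact hne h
        · exact (hQ'mem q₁ h₁).2.2 (hR h)
      refine le_of_eq_of_le ?_ (hJ (insert q₁ (insert q₂ R)) (fun q hq => ?_)
        (Finset.insert_nonempty _ _) ?_)
      · congr 1
        refine Finset.sum_congr rfl fun n _ => ?_
        rw [Finset.prod_insert hn1, Finset.prod_insert hn2]
        ring
      · rcases Finset.mem_insert.1 hq with rfl | hq
        · exact ⟨(hQ'mem q h₁).1, (hQ'mem q h₁).2.1⟩
        rcases Finset.mem_insert.1 hq with rfl | hq
        · exact ⟨(hQ'mem q h₂).1, (hQ'mem q h₂).2.1⟩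
        · exact ⟨(hQmem q (hR hq)).1, (hQmem q (hR hq)).2.trans hyz⟩
      · rw [Finset.card_insert_of_notMem hn1, Finset.card_insert_of_notMem hn2]
        have : (R.card : ℝ) ≤ Q.card := by exact_mod_cast Finset.card_le_card hR
        push_cast
        linarith)
  have hyx : y ≤ √x := by
    rw [one_mul, Real.rpow_zero, mul_one, ← Real.sqrt_eq_rpow] at hl4
    exact hyz.trans hl4
  have hcount := sum_odd_mul_prod_le hx1.le hyx he T hK0 hQmem
  set G := (Finset.Icc 1 ⌊x⌋₊).filter fun p => p.Prime ∧ p ≠ 2 ∧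
          (∀ q ∈ Q, (J(q | p) : ℝ) = e q) ∧ |T p| ≤ K with hG
  set D : ℝ := 2 ^ Q.card with hDdef
  have hD1 : 1 ≤ D := one_le_pow₀ (by norm_num)
  have hA2 : ∑ q ∈ Q', a q ^ 2 ≤ B := by
    refine (Finset.sum_le_sum fun q hq => ?_).trans
      (hsum.sum_le_tsum Q' fun n _ => sq_nonneg _)
    rw [← sq_abs]
    have := ha q (hQ'mem q hq).1.one_le (hQ'mem q hq).2.1
    gcongr
  have hA1 : ∑ q ∈ Q', |a q| ≤ z := by
    refine (Finset.sum_le_card_nsmul _ _ 1 fun q hq => ?_).trans (by simpa using hQ'card)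
    refine (ha q (hQ'mem q hq).1.one_le (hQ'mem q hq).2.1).trans ?_
    exact Real.rpow_le_one_of_one_le_of_nonpos (by exact_mod_cast (hQ'mem q hq).1.one_le)
      (by linarith)
  have hA10 : 0 ≤ ∑ q ∈ Q', |a q| := Finset.sum_nonneg fun q _ => abs_nonneg _
  have hDE0 : 0 ≤ D * E := by positivity
  -- the second moment, divided by `K ^ 2`, is at most half of the main term
  have hS2 : (∑ n ∈ M, vonMangoldt n * (1 - n / x) * (∏ q ∈ Q, (1 + e q * (J(q | n) : ℝ))) *
      T n ^ 2) / K ^ 2 ≤ S / 2 + z ^ 2 * (D * E) := by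
    rw [div_le_iff₀ (by positivity), hK2]
    refine hsecond.trans ?_
    have h1 : (∑ q ∈ Q', a q ^ 2) * S ≤ B * S := by gcongr
    have h2 : (∑ q ∈ Q', |a q|) ^ 2 * (D * E) ≤ z ^ 2 * (D * E) := by gcongr
    have h3 : 0 ≤ z ^ 2 * (D * E) := by positivity
    nlinarith
  have hDE : D * E * (1 + 2 * z ^ 2) ≤ x / 32 := by
    have hz4 : (1 + (z + 2) * z) * (1 + 2 * z ^ 2) ≤ 12 * z ^ 4 := by
      have h1 : 1 + (z + 2) * z ≤ 4 * z ^ 2 := by nlinarith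
      have h2 : 1 + 2 * z ^ 2 ≤ 3 * z ^ 2 := by nlinarith
      calc (1 + (z + 2) * z) * (1 + 2 * z ^ 2) ≤ 4 * z ^ 2 * (3 * z ^ 2) := by gcongr
        _ = 12 * z ^ 4 := by ring
    have hz4' : z ^ 4 = Real.log x ^ (4 * A) := by
      rw [hz, ← Real.rpow_natCast, ← Real.rpow_mul (by linarith)]
      congr 1; push_cast; ring
    calc D * E * (1 + 2 * z ^ 2)
        ≤ x ^ (1 / 2 - δ) * E * (1 + 2 * z ^ 2) := by gcongr
      _ = C * ((1 + (z + 2) * z) * (1 + 2 * z ^ 2)) *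
          (x ^ (1 / 2 - δ) * x ^ (1 / 2 + δ / 2)) := by rw [hE]; ring
      _ ≤ C * (12 * z ^ 4) * x ^ (1 - δ / 2) := by
          rw [← Real.rpow_add hx0, show 1 / 2 - δ + (1 / 2 + δ / 2) = 1 - δ / 2 by ring]
          gcongr
      _ ≤ x / 32 := by
          rw [Real.rpow_one] at hl1
          rw [hz4']
          linarith
  have hsmall : D * (2 * √x * Real.log x) + D * ((Real.log 4 + 4) * √x) ≤ x / 64 := by
    have h4 : Real.log 4 ≤ 3 := by
      have := Real.log_le_sub_one_of_pos (show (0 : ℝ) < 4 by norm_num)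
      linarith
    have h5 : D * √x ≤ x ^ (1 - δ) := by
      rw [show 1 - δ = 1 / 2 - δ + 1 / 2 by ring, Real.rpow_add hx0, ← Real.sqrt_eq_rpow]
      gcongr
    have h6 : D * √x * (2 * Real.log x + Real.log 4 + 4) ≤ x ^ (1 - δ) * (9 * Real.log x) := by
      have : 0 ≤ Real.log 4 := Real.log_nonneg (by norm_num)
      gcongr
      linarith
    rw [Real.rpow_one, Real.rpow_one] at hl2
    have h7 : 0 ≤ x ^ (1 - δ) * Real.log x := by positivity
    linarith only [h6, hl2, h7]
  have hWS : ∑ n ∈ M, vonMangoldt n * (1 - n / x) - D * E ≤ S := by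
    linarith [(abs_le.1 hfirst).1]
  have hS1 : S ≤ G.card * (D * Real.log x) + (S / 2 + z ^ 2 * (D * E)) + x / 64 :=
    calc S ≤ _ := hcount
      _ ≤ _ := by rw [add_assoc]; exact add_le_add (add_le_add le_rfl hS2) hsmall
  have hmain : x / 32 ≤ G.card * (D * Real.log x) := by
    linarith only [hW, hWS, hS1, hDE]
  have hfin : x ^ (1 / 2 : ℝ) * (D * Real.log x) ≤ x / 32 := by
    rw [Real.rpow_one] at hl3
    have h1 : x ^ (1 / 2 : ℝ) * (D * Real.log x) ≤
        x ^ (1 / 2 : ℝ) * (x ^ (1 / 2 - δ) * Real.log x) := by gcongr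
    have h2 : x ^ (1 / 2 - δ) * x ^ (1 / 2 + δ) = x := by
      rw [← Real.rpow_add hx0]; norm_num
    have h3 := mul_le_mul_of_nonneg_left hl3 (Real.rpow_nonneg hx0.le (1 / 2 - δ))
    linarith
  exact le_of_mul_le_mul_right (hfin.trans hmain) (by positivity)

end

/-! ### The prime number theorem and the main term -/

section

open MeasureTheory Filter Topology
open ArithmeticFunction (vonMangoldt)

/-- The weighted sum `∑ Λ(n) (v - n)` over `n ≤ v` is convex in `v`, with slope `ψ`. -/
theorem mul_psi_le_sub (x v : ℝ) :
    (v - x) * Chebyshev.psi x ≤ ∑ n ∈ Finset.Icc 1 ⌊v⌋₊, vonMangoldt n * (v - n) -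
      ∑ n ∈ Finset.Icc 1 ⌊x⌋₊, vonMangoldt n * (x - n) := by
  have h1 : (v - x) * Chebyshev.psi x + ∑ n ∈ Finset.Icc 1 ⌊x⌋₊, vonMangoldt n * (x - n) =
      ∑ n ∈ Finset.Icc 1 ⌊x⌋₊, vonMangoldt n * (v - n) := by
    have : Chebyshev.psi x = ∑ n ∈ Finset.Icc 1 ⌊x⌋₊, vonMangoldt n := rfl
    rw [this, Finset.mul_sum, ← Finset.sum_add_distrib]
    refine Finset.sum_congr rfl fun n _ => by ring
  have h2 : ∑ n ∈ Finset.Icc 1 ⌊x⌋₊, vonMangoldt n * (v - n) ≤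
      ∑ n ∈ Finset.Icc 1 ⌊v⌋₊, vonMangoldt n * (v - n) := by
    rcases le_total x v with h | h
    · refine Finset.sum_le_sum_of_subset_of_nonneg
        (Finset.Icc_subset_Icc_right (Nat.floor_le_floor h)) fun n hn _ => ?_
      have := (Nat.le_floor_iff' (by have := (Finset.mem_Icc.1 hn).1; omega)).1
        (Finset.mem_Icc.1 hn).2
      exact mul_nonneg ArithmeticFunction.vonMangoldt_nonneg (by linarith)
    · rw [← Finset.sum_sdiff (Finset.Icc_subset_Icc_right (Nat.floor_le_floor h))]
      refine add_le_of_nonpos_left (Finset.sum_nonpos fun n hn => ?_)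
      obtain ⟨h3, h4⟩ := Finset.mem_sdiff.1 hn
      have h5 : v < n := by
        by_contra! h6
        exact h4 (Finset.mem_Icc.2 ⟨(Finset.mem_Icc.1 h3).1, Nat.le_floor h6⟩)
      exact mul_nonpos_of_nonneg_of_nonpos ArithmeticFunction.vonMangoldt_nonneg (by linarith)
  linarith

/-- The prime number theorem, deduced here from GRH through the smoothed sum of `Λ`. -/
theorem GeneralizedRH.eventually_abs_psi_sub_le (hGRH : GeneralizedRH) {η : ℝ} (hη : 0 < η)
    (hη1 : η < 1) : ∀ᶠ x : ℝ in atTop, |Chebyshev.psi x - x| ≤ η * x := by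
  obtain ⟨C, hC⟩ := hGRH.norm_sum_vonMangoldt_sub_le (b := 3 / 4) (by norm_num) (by norm_num)
  have hF : ∀ x : ℝ, 1 < x →
      |∑ n ∈ Finset.Icc 1 ⌊x⌋₊, vonMangoldt n * (x - n) - (x - 1) ^ 2 / 2| ≤
        |C| * (x * x ^ (3 / 4 : ℝ)) := by
    intro x hx
    have hx0 : 0 < x := by linarith
    have h1 : ∑ n ∈ Finset.Icc 1 ⌊x⌋₊, vonMangoldt n * (x - n) - (x - 1) ^ 2 / 2 =
        x * (∑ n ∈ Finset.Icc 1 ⌊x⌋₊, vonMangoldt n * (1 - n / x) - x / 2 * (1 - 1 / x) ^ 2) := by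
      rw [mul_sub, Finset.mul_sum]
      congr 1
      · refine Finset.sum_congr rfl fun n _ => by field_simp
      · field_simp
    rw [h1, abs_mul, abs_of_pos hx0]
    have := hC x hx
    have h2 : C * x ^ (3 / 4 : ℝ) ≤ |C| * x ^ (3 / 4 : ℝ) := by gcongr; exact le_abs_self C
    nlinarith
  filter_upwards [eventually_mul_log_rpow_mul_rpow_le 0 (12 * |C| / η ^ 2)
      (show (3 / 4 : ℝ) < 1 by norm_num), eventually_ge_atTop (4 / η),
      eventually_gt_atTop (1 / (1 - η))] with x hx1 hx2 hx3
  rw [Real.rpow_zero, Real.rpow_one, mul_one] at hx1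
  have hη' : 0 < 1 - η := by linarith
  have hx4 : 1 < (1 - η) * x := by rwa [div_lt_iff₀' hη'] at hx3
  have hx2' : 4 ≤ η * x := by rwa [div_le_iff₀' hη] at hx2
  have hx0 : 0 < x := by nlinarith
  have hxone : 1 < x := by nlinarith
  have hX : 12 * (|C| * x ^ (3 / 4 : ℝ)) ≤ η ^ 2 * x := by
    rw [div_mul_eq_mul_div, div_le_iff₀' (by positivity)] at hx1
    linarith
  set X := |C| * x ^ (3 / 4 : ℝ) with hXdef
  have hFx := abs_le.1 (hF x hxone)
  have hup := abs_le.1 (hF ((1 + η) * x) (by nlinarith))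
  have hlo := abs_le.1 (hF ((1 - η) * x) hx4)
  have hbup : |C| * ((1 + η) * x * ((1 + η) * x) ^ (3 / 4 : ℝ)) ≤ 4 * (x * X) := by
    have h1 : ((1 + η) * x) ^ (3 / 4 : ℝ) ≤ 2 * x ^ (3 / 4 : ℝ) := by
      rw [Real.mul_rpow (by linarith) hx0.le]
      gcongr
      calc (1 + η) ^ (3 / 4 : ℝ) ≤ (1 + η) ^ (1 : ℝ) :=
            Real.rpow_le_rpow_of_exponent_le (by linarith) (by norm_num)
        _ ≤ 2 := by rw [Real.rpow_one]; linarith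
    calc |C| * ((1 + η) * x * ((1 + η) * x) ^ (3 / 4 : ℝ))
        ≤ |C| * (2 * x * (2 * x ^ (3 / 4 : ℝ))) := by gcongr; linarith
      _ = 4 * (x * X) := by rw [hXdef]; ring
  have hblo : |C| * ((1 - η) * x * ((1 - η) * x) ^ (3 / 4 : ℝ)) ≤ x * X := by
    calc |C| * ((1 - η) * x * ((1 - η) * x) ^ (3 / 4 : ℝ))
        ≤ |C| * (x * x ^ (3 / 4 : ℝ)) := by gcongr <;> nlinarith
      _ = x * X := by rw [hXdef]; ring
  have hbx : |C| * (x * x ^ (3 / 4 : ℝ)) = x * X := by rw [hXdef]; ring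
  have h1 := mul_psi_le_sub x ((1 + η) * x)
  have h2 := mul_psi_le_sub x ((1 - η) * x)
  set ψ := Chebyshev.psi x
  have hηx : 0 < η * x := by positivity
  rw [abs_le]
  constructor
  · refine le_of_mul_le_mul_left ?_ hηx
    nlinarith
  · refine le_of_mul_le_mul_left ?_ hηx
    nlinarith

theorem GeneralizedRH.eventually_abs_theta_sub_le (hGRH : GeneralizedRH) {η : ℝ} (hη : 0 < η)
    (hη1 : η < 1) : ∀ᶠ x : ℝ in atTop, |Chebyshev.theta x - x| ≤ η * x := by
  obtain ⟨C, hC⟩ := Chebyshev.psi_sub_theta_le_mul_sqrt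
  filter_upwards [hGRH.eventually_abs_psi_sub_le (half_pos hη) (by linarith),
    eventually_mul_log_rpow_mul_rpow_le 0 (2 / η * C) (show (1 / 2 : ℝ) < 1 by norm_num)]
    with x h1 h2
  rw [Real.rpow_zero, Real.rpow_one, mul_one, ← Real.sqrt_eq_rpow] at h2
  have h3 := hC x
  have h4 := Chebyshev.theta_le_psi x
  have h5 : C * √x ≤ η / 2 * x := by
    rw [mul_assoc, div_mul_eq_mul_div, div_le_iff₀ hη] at h2
    linarith
  rw [abs_le] at h1 ⊢
  constructor <;> linarith [h1.1, h1.2]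

theorem GeneralizedRH.exists_abs_theta_sub_le (hGRH : GeneralizedRH) {η : ℝ} (hη : 0 < η)
    (hη1 : η < 1) : ∃ D, 0 ≤ D ∧ ∀ x : ℝ, 0 ≤ x → |Chebyshev.theta x - x| ≤ η * x + D := by
  obtain ⟨B, hB⟩ := eventually_atTop.1 (hGRH.eventually_abs_theta_sub_le hη hη1)
  refine ⟨Chebyshev.theta |B| + |B|, by positivity [Chebyshev.theta_nonneg |B|], fun x hx => ?_⟩
  have h0 := Chebyshev.theta_nonneg |B|
  rcases le_total B x with h | h
  · linarith [hB x h, abs_nonneg B]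
  · have h1 := Chebyshev.theta_mono (h.trans (le_abs_self B))
    have h2 := Chebyshev.theta_nonneg x
    have h3 := h.trans (le_abs_self B)
    have h4 : 0 ≤ η * x := by positivity
    rw [abs_le]
    constructor <;> linarith

theorem GeneralizedRH.eventually_card_primes_le (hGRH : GeneralizedRH) {η : ℝ} (hη : 0 < η)
    (hη1 : η < 1) : ∀ᶠ x : ℝ in atTop,
      (((Finset.Icc 1 ⌊x⌋₊).filter Nat.Prime).card : ℝ) ≤ (1 + η) * (x / Real.log x) := by
  obtain ⟨C, hC⟩ := Chebyshev.primeCounting_sub_theta_div_log_isBigO.bound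
  have hlog := Real.tendsto_log_atTop.eventually_ge_atTop (max 1 (2 * |C| / η))
  filter_upwards [hC, hGRH.eventually_abs_theta_sub_le (half_pos hη) (by linarith), hlog,
    eventually_gt_atTop 0] with x h1 h2 h3 h4
  have hL1 : 1 ≤ Real.log x := (le_max_left _ _).trans h3
  have hL2 : 2 * |C| / η ≤ Real.log x := (le_max_right _ _).trans h3
  have hcard : ((Finset.Icc 1 ⌊x⌋₊).filter Nat.Prime).card = Nat.primeCounting ⌊x⌋₊ := by
    rw [Nat.primeCounting, Nat.primeCounting', Nat.count_eq_card_filter_range]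
    congr 1
    ext p
    simp only [Finset.mem_filter, Finset.mem_Icc, Finset.mem_range, Nat.lt_succ_iff]
    exact ⟨fun h => ⟨h.1.2, h.2⟩, fun h => ⟨⟨h.2.one_le, h.1⟩, h.2⟩⟩
  have hq : 0 ≤ x / Real.log x := by positivity
  have h5 : |C| * ‖x / Real.log x ^ 2‖ ≤ η / 2 * (x / Real.log x) := by
    rw [Real.norm_of_nonneg (by positivity), sq, ← div_div, div_eq_mul_inv _ (Real.log x)]
    have : |C| * (Real.log x)⁻¹ ≤ η / 2 := by
      rw [← div_eq_mul_inv, div_le_iff₀ (by linarith)]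
      rw [div_le_iff₀ hη] at hL2
      linarith
    calc |C| * (x / Real.log x * (Real.log x)⁻¹) = (|C| * (Real.log x)⁻¹) * (x / Real.log x) := by
          ring
      _ ≤ _ := by gcongr
  have h6 : C * ‖x / Real.log x ^ 2‖ ≤ |C| * ‖x / Real.log x ^ 2‖ := by
    gcongr; exact le_abs_self C
  have h7 := (le_abs_self _).trans h1
  have h8 : Chebyshev.theta x / Real.log x ≤ (1 + η / 2) * (x / Real.log x) := by
    rw [← mul_div_assoc]
    have := (abs_le.1 h2).2
    gcongr
    linarith
  rw [hcard]
  linarith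

/-- The constant `γ(σ, t)` such that `∑ cos² (t log q) q ^ (-σ)`, over the primes `q ≤ y`, is at
least `(γ(σ, t) + o(1)) y ^ (1 - σ) / log y`. -/
noncomputable def cosSqConst (σ t : ℝ) : ℝ :=
  if t = 0 then 1 / (1 - σ) else 1 / (1 - σ) * (t ^ 2 / ((1 - σ) ^ 2 + 4 * t ^ 2))

theorem cosSqConst_pos {σ : ℝ} (hσ1 : σ < 1) (t : ℝ) : 0 < cosSqConst σ t := by
  have : 0 < 1 - σ := by linarith
  unfold cosSqConst
  split_ifs with h
  · positivity
  · have : 0 < t ^ 2 := by positivity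
    positivity

/-- A primitive of `u ↦ cos² (t log u) u ^ (-σ)`. -/
noncomputable def cosSqPrimitive (σ t u : ℝ) : ℝ :=
  1 / 2 * (u ^ (1 - σ) / (1 - σ) + u ^ (1 - σ) * ((1 - σ) * Real.cos (2 * t * Real.log u) +
    2 * t * Real.sin (2 * t * Real.log u)) / ((1 - σ) ^ 2 + 4 * t ^ 2))

theorem hasDerivAt_cosSqPrimitive {σ : ℝ} (hσ1 : σ < 1) (t : ℝ) {u : ℝ} (hu : 0 < u) :
    HasDerivAt (cosSqPrimitive σ t) (Real.cos (t * Real.log u) ^ 2 * u ^ (-σ)) u := by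
  have ha : 0 < 1 - σ := by linarith
  have hd : (1 - σ) ^ 2 + 4 * t ^ 2 ≠ 0 := by positivity
  have h1 : HasDerivAt (fun u : ℝ => u ^ (1 - σ)) ((1 - σ) * u ^ (1 - σ - 1)) u :=
    Real.hasDerivAt_rpow_const (Or.inl hu.ne')
  have h2 : HasDerivAt (fun u : ℝ => 2 * t * Real.log u) (2 * t * u⁻¹) u :=
    (Real.hasDerivAt_log hu.ne').const_mul _
  have h3 := (((h1.div_const (1 - σ)).add ((h1.mul ((h2.cos.const_mul (1 - σ)).add
    (h2.sin.const_mul (2 * t)))).div_const ((1 - σ) ^ 2 + 4 * t ^ 2))).const_mul (1 / 2))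
  refine h3.congr_deriv ?_
  have h4 : u ^ (1 - σ) = u * u ^ (-σ) := by
    rw [show 1 - σ = 1 + -σ by ring, Real.rpow_add hu, Real.rpow_one]
  rw [h4, show 1 - σ - 1 = -σ by ring, show 2 * t * Real.log u = 2 * (t * Real.log u) by ring,
    Real.cos_two_mul, Real.sin_two_mul]
  simp only [Pi.add_apply]
  rw [show 2 * t * Real.log u = 2 * (t * Real.log u) by ring, Real.cos_two_mul, Real.sin_two_mul]
  field_simp
  ring

theorem cosSqConst_mul_le_cosSqPrimitive {σ : ℝ} (hσ1 : σ < 1) (t : ℝ) {u : ℝ} (hu : 0 < u) :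
    cosSqConst σ t * u ^ (1 - σ) ≤ cosSqPrimitive σ t u := by
  have ha : 0 < 1 - σ := by linarith
  unfold cosSqConst cosSqPrimitive
  split_ifs with h
  · subst h
    refine le_of_eq ?_
    simp only [mul_zero, zero_mul, Real.cos_zero, Real.sin_zero]
    field_simp
    ring
  · set a := 1 - σ
    set φ := 2 * t * Real.log u
    set s := √(a ^ 2 + 4 * t ^ 2) with hs
    have hs2 : s ^ 2 = a ^ 2 + 4 * t ^ 2 := Real.sq_sqrt (by positivity)
    have has : a ≤ s := Real.le_sqrt_of_sq_le (by nlinarith [sq_nonneg t])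
    have hs0 : 0 < s := ha.trans_le has
    -- Cauchy-Schwarz for `(a, 2 t)` against the unit vector `(cos φ, sin φ)`
    have hcs : -s ≤ a * Real.cos φ + 2 * t * Real.sin φ := by
      refine (abs_le_of_sq_le_sq' ?_ hs0.le).1
      rw [hs2]
      nlinarith [sq_nonneg (a * Real.sin φ - 2 * t * Real.cos φ), Real.sin_sq_add_cos_sq φ]
    have ht : t ^ 2 = (s ^ 2 - a ^ 2) / 4 := by rw [hs2]; ring
    rw [← hs2, ht]
    have hU : 0 < u ^ a := Real.rpow_pos_of_pos hu a
    calc 1 / a * ((s ^ 2 - a ^ 2) / 4 / s ^ 2) * u ^ a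
        ≤ 1 / 2 * (1 / a + -s / s ^ 2) * u ^ a := by
          refine mul_le_mul_of_nonneg_right ?_ hU.le
          have h1 : 1 / 2 * (1 / a + -s / s ^ 2) - 1 / a * ((s ^ 2 - a ^ 2) / 4 / s ^ 2) =
              (s - a) ^ 2 / (4 * a * s ^ 2) := by field_simp; ring
          have h2 : 0 ≤ (s - a) ^ 2 / (4 * a * s ^ 2) := by positivity
          linarith
      _ = 1 / 2 * (u ^ a / a + u ^ a * -s / s ^ 2) := by ring
      _ ≤ _ := by gcongr

theorem hasDerivAt_cos_sq_mul_rpow (σ t : ℝ) {u : ℝ} (hu : 0 < u) :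
    HasDerivAt (fun u : ℝ => Real.cos (t * Real.log u) ^ 2 * u ^ (-σ))
      (-(2 * t * Real.cos (t * Real.log u) * Real.sin (t * Real.log u) +
        σ * Real.cos (t * Real.log u) ^ 2) * u ^ (-σ - 1)) u := by
  have h1 : HasDerivAt (fun u : ℝ => u ^ (-σ)) (-σ * u ^ (-σ - 1)) u :=
    Real.hasDerivAt_rpow_const (Or.inl hu.ne')
  have h2 : HasDerivAt (fun u : ℝ => t * Real.log u) (t * u⁻¹) u :=
    (Real.hasDerivAt_log hu.ne').const_mul _
  refine ((h2.cos.pow 2).mul h1).congr_deriv ?_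
  have h4 : u ^ (-σ - 1) = u ^ (-σ) * u⁻¹ := by
    rw [Real.rpow_sub hu, Real.rpow_one, div_eq_mul_inv]
  rw [h4]
  simp only [Pi.pow_apply, Nat.cast_ofNat, Nat.add_one_sub_one, pow_one]
  ring

/-- Partial summation against `θ(u) ~ u`: the sum, with an additional factor `log q ≤ log y`, is
asymptotically the integral of `cos² (t log u) u ^ (-σ)`. -/
theorem GeneralizedRH.eventually_le_sum_cos_sq (hGRH : GeneralizedRH) {σ : ℝ} (hσ : 0 < σ)
    (hσ1 : σ < 1) (t : ℝ) {η : ℝ} (hη : 0 < η) : ∀ᶠ y : ℝ in atTop,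
      (cosSqConst σ t - η) * (y ^ (1 - σ) / Real.log y) ≤
        ∑ q ∈ (Finset.Icc 1 ⌊y⌋₊).filter Nat.Prime,
          Real.cos (t * Real.log q) ^ 2 * (q : ℝ) ^ (-σ) := by
  have ha : 0 < 1 - σ := by linarith
  set f : ℝ → ℝ := fun u => Real.cos (t * Real.log u) ^ 2 * u ^ (-σ) with hf
  set f' : ℝ → ℝ := fun u => -(2 * t * Real.cos (t * Real.log u) * Real.sin (t * Real.log u) +
        σ * Real.cos (t * Real.log u) ^ 2) * u ^ (-σ - 1) with hf'
  have hderiv : ∀ u : ℝ, 0 < u → HasDerivAt f (f' u) u := fun u hu =>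
    hasDerivAt_cos_sq_mul_rpow σ t hu
  have hf'c : ContinuousOn f' (Set.Ioi 0) := by
    intro u hu
    have hu : u ≠ 0 := (Set.mem_Ioi.1 hu).ne'
    refine ContinuousAt.continuousWithinAt ?_
    have h1 := Real.continuousAt_log hu
    have h2 := Real.continuousAt_rpow_const u (-σ - 1) (Or.inl hu)
    fun_prop
  have hfc : ContinuousOn f (Set.Ioi 0) := fun u hu =>
    (hderiv u hu).continuousAt.continuousWithinAt
  have hf'le : ∀ u : ℝ, 0 < u → |f' u| ≤ (2 * |t| + 1) * u ^ (-σ - 1) := by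
    intro u hu
    rw [hf', abs_mul, abs_neg, abs_of_nonneg (Real.rpow_nonneg hu.le _)]
    refine mul_le_mul_of_nonneg_right ?_ (Real.rpow_nonneg hu.le _)
    set φ := t * Real.log u
    refine (abs_add_le _ _).trans (add_le_add ?_ ?_)
    · rw [abs_mul, abs_mul, abs_mul, abs_two]
      have h1 := Real.abs_cos_le_one φ
      have h2 := Real.abs_sin_le_one φ
      calc 2 * |t| * |Real.cos φ| * |Real.sin φ| ≤ 2 * |t| * 1 * 1 := by gcongr
        _ = 2 * |t| := by ring
    · rw [abs_of_nonneg (by positivity)]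
      have := Real.cos_sq_le_one φ
      nlinarith [sq_nonneg (Real.cos φ)]
  -- the error `|θ(u) - u| ≤ η' u + D` with `η'` so small that partial summation loses `η / 2`
  set κ : ℝ := 1 + (2 * |t| + 1) / (1 - σ) with hκ
  have hκ1 : 1 ≤ κ := by
    have : 0 ≤ (2 * |t| + 1) / (1 - σ) := by positivity
    linarith
  set η' : ℝ := min (1 / 2) (η / (2 * κ)) with hη'
  have hη'0 : 0 < η' := lt_min (by norm_num) (by positivity)
  have hη'κ : η' * κ ≤ η / 2 := by
    have : η' ≤ η / (2 * κ) := min_le_right _ _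
    rw [le_div_iff₀ (by positivity)] at this
    linarith
  obtain ⟨D, hD0, hD⟩ := hGRH.exists_abs_theta_sub_le hη'0
    ((min_le_left _ _).trans_lt (by norm_num))
  set W : ℝ := D + |1 - cosSqPrimitive σ t 1| + (2 * |t| + 1) * (D / σ) with hW
  have hY := (tendsto_rpow_atTop ha).eventually_ge_atTop (2 * W / η)
  filter_upwards [hY, eventually_gt_atTop 1] with y hy hy1
  have hy0 : 0 < y := by linarith
  set c : ℕ → ℝ := fun n => if n.Prime then Real.log n else 0 with hc
  have hθ : ∀ u : ℝ, ∑ k ∈ Finset.Icc 0 ⌊u⌋₊, c k = Chebyshev.theta u := fun u => by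
    rw [Chebyshev.theta_eq_sum_Icc, Finset.sum_filter]
  have hsub : Set.Icc 1 y ⊆ Set.Ioi 0 := fun u hu => zero_lt_one.trans_le hu.1
  have h0 : (0 : ℝ) ∉ Set.Icc 1 y := fun h => absurd h.1 (by norm_num)
  have hderiv_eq : Set.EqOn (deriv f) f' (Set.Icc 1 y) := fun u hu => (hderiv u (hsub hu)).deriv
  have habel := sum_mul_eq_sub_integral_mul₀ (f := f) c (by simp [hc]) y
    (fun u hu => (hderiv u (hsub hu)).differentiableAt)
    (((hf'c.mono hsub).integrableOn_Icc).congr_fun hderiv_eq.symm measurableSet_Icc)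
  have hint_eq : ∫ u in Set.Ioc 1 y, deriv f u * ∑ k ∈ Finset.Icc 0 ⌊u⌋₊, c k =
      ∫ u in (1 : ℝ)..y, f' u * Chebyshev.theta u := by
    rw [intervalIntegral.integral_of_le hy1.le]
    refine setIntegral_congr_fun measurableSet_Ioc fun u hu => ?_
    simp only [hθ]
    rw [hderiv_eq (Set.Ioc_subset_Icc_self hu)]
  rw [hint_eq, hθ] at habel
  have huIcc : Set.uIcc 1 y = Set.Icc 1 y := Set.uIcc_of_le hy1.le
  have hθint : IntervalIntegrable (fun u => f' u * Chebyshev.theta u) volume 1 y :=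
    (Chebyshev.theta_mono.intervalIntegrable).continuousOn_mul (by
      rw [huIcc]; exact hf'c.mono hsub)
  have hidint : IntervalIntegrable (fun u => f' u * u) volume 1 y := by
    refine ContinuousOn.intervalIntegrable ?_
    rw [huIcc]
    exact (hf'c.mono hsub).mul continuousOn_id
  have hid : ∫ u in (1 : ℝ)..y, f' u * u =
      (y * f y - cosSqPrimitive σ t y) - (1 * f 1 - cosSqPrimitive σ t 1) := by
    refine intervalIntegral.integral_eq_sub_of_hasDerivAt
      (f := fun u => u * f u - cosSqPrimitive σ t u)
      (fun u hu => ?_) hidint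
    rw [huIcc] at hu
    have hu0 : 0 < u := hsub hu
    refine (((hasDerivAt_id u).mul (hderiv u hu0)).sub
      (hasDerivAt_cosSqPrimitive hσ1 t hu0)).congr_deriv ?_
    simp only [id, hf]
    ring
  have hsplit : ∫ u in (1 : ℝ)..y, f' u * Chebyshev.theta u =
      (∫ u in (1 : ℝ)..y, f' u * u) + ∫ u in (1 : ℝ)..y, f' u * (Chebyshev.theta u - u) := by
    rw [← intervalIntegral.integral_add hidint]
    · refine intervalIntegral.integral_congr fun u _ => by ring
    · refine (hθint.sub hidint).congr ?_
      exact fun u _ => (mul_sub _ _ _).symm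
  set Y := y ^ (1 - σ) with hYdef
  have hrp1 : ∫ u in (1 : ℝ)..y, u ^ (-σ) = (Y - 1) / (1 - σ) := by
    rw [integral_rpow (Or.inl (by linarith)), Real.one_rpow, show -σ + 1 = 1 - σ by ring]
  have hrp2 : ∫ u in (1 : ℝ)..y, u ^ (-σ - 1) ≤ 1 / σ := by
    rw [integral_rpow (Or.inr ⟨by linarith, by
      rw [huIcc]; exact h0⟩), Real.one_rpow,
      show -σ - 1 + 1 = -σ by ring, div_neg, ← neg_div, neg_sub]
    have := Real.rpow_nonneg hy0.le (-σ)
    gcongr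
    linarith
  have hI1 : IntervalIntegrable (fun u : ℝ => u ^ (-σ)) volume 1 y :=
    intervalIntegral.intervalIntegrable_rpow (Or.inr (by
      rw [huIcc]; exact h0))
  have hI2 : IntervalIntegrable (fun u : ℝ => u ^ (-σ - 1)) volume 1 y :=
    intervalIntegral.intervalIntegrable_rpow (Or.inr (by
      rw [huIcc]; exact h0))
  have herr : |∫ u in (1 : ℝ)..y, f' u * (Chebyshev.theta u - u)| ≤
      (2 * |t| + 1) * (η' * (Y / (1 - σ)) + D / σ) := by
    have hb : ‖∫ u in (1 : ℝ)..y, f' u * (Chebyshev.theta u - u)‖ ≤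
        ∫ u in (1 : ℝ)..y, (2 * |t| + 1) * (η' * u ^ (-σ) + D * u ^ (-σ - 1)) := by
      refine intervalIntegral.norm_integral_le_of_norm_le hy1.le
        (Filter.Eventually.of_forall fun u hu => ?_)
        (((hI1.const_mul _).add (hI2.const_mul _)).const_mul _)
      have hu0 : 0 < u := zero_lt_one.trans hu.1
      rw [norm_mul, Real.norm_eq_abs, Real.norm_eq_abs]
      have h1 : u ^ (-σ) = u ^ (-σ - 1) * u := by
        rw [Real.rpow_sub hu0, Real.rpow_one, div_mul_cancel₀ _ hu0.ne']
      calc |f' u| * |Chebyshev.theta u - u|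
          ≤ ((2 * |t| + 1) * u ^ (-σ - 1)) * (η' * u + D) :=
            mul_le_mul (hf'le u hu0) (hD u hu0.le) (abs_nonneg _) (by positivity)
        _ = _ := by rw [h1]; ring
    rw [Real.norm_eq_abs] at hb
    refine hb.trans ?_
    rw [intervalIntegral.integral_const_mul, intervalIntegral.integral_add (hI1.const_mul _)
      (hI2.const_mul _), intervalIntegral.integral_const_mul, intervalIntegral.integral_const_mul,
      hrp1]
    have h2 : D * ∫ u in (1 : ℝ)..y, u ^ (-σ - 1) ≤ D / σ := by
      rw [div_eq_mul_one_div D σ]; gcongr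
    gcongr
    linarith
  have hfy : 0 ≤ f y ∧ f y ≤ y ^ (-σ) := by
    have := Real.rpow_nonneg hy0.le (-σ)
    exact ⟨by positivity, mul_le_of_le_one_left this (Real.cos_sq_le_one _)⟩
  have hbdry : |f y * (Chebyshev.theta y - y)| ≤ η' * Y + D := by
    rw [abs_mul, abs_of_nonneg hfy.1]
    have h1 : y ^ (-σ) * y = Y := by
      rw [hYdef, show 1 - σ = -σ + 1 by ring, Real.rpow_add hy0, Real.rpow_one]
    have h2 : y ^ (-σ) ≤ 1 := Real.rpow_le_one_of_one_le_of_nonpos hy1.le (by linarith)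
    calc f y * |Chebyshev.theta y - y| ≤ y ^ (-σ) * (η' * y + D) :=
          mul_le_mul hfy.2 (hD y hy0.le) (abs_nonneg _) (Real.rpow_nonneg hy0.le _)
      _ = η' * (y ^ (-σ) * y) + y ^ (-σ) * D := by ring
      _ ≤ η' * Y + 1 * D := by rw [h1]; gcongr
      _ = _ := by rw [one_mul]
  have hG := cosSqConst_mul_le_cosSqPrimitive hσ1 t hy0
  have hf1 : f 1 = 1 := by simp [hf]
  have hS : (cosSqConst σ t - η) * Y ≤ ∑ k ∈ Finset.Icc 0 ⌊y⌋₊, f k * c k := by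
    rw [habel, hsplit, hid, hf1]
    have h1 := (abs_le.1 hbdry).1
    have h2 := (abs_le.1 herr).2
    have h3 := neg_abs_le (1 - cosSqPrimitive σ t 1)
    have h4 : W ≤ η / 2 * Y := by
      rw [div_le_iff₀ hη] at hy
      linarith
    have hY0 : 0 < Y := Real.rpow_pos_of_pos hy0 _
    have h5 : η' * Y + (2 * |t| + 1) * (η' * (Y / (1 - σ))) ≤ η / 2 * Y := by
      have : η' * Y + (2 * |t| + 1) * (η' * (Y / (1 - σ))) = η' * κ * Y := by rw [hκ]; ring
      rw [this]
      gcongr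
    linarith
  have hlog : 0 < Real.log y := Real.log_pos hy1
  rw [← mul_div_assoc, div_le_iff₀ hlog]
  refine hS.trans ?_
  have hconv : ∑ k ∈ Finset.Icc 0 ⌊y⌋₊, f k * c k =
      ∑ q ∈ (Finset.Icc 1 ⌊y⌋₊).filter Nat.Prime, f q * Real.log q := by
    rw [Finset.sum_filter, ← Finset.sum_subset
      (Finset.Icc_subset_Icc_left (Nat.zero_le 1) : Finset.Icc 1 ⌊y⌋₊ ⊆ Finset.Icc 0 ⌊y⌋₊)]
    · refine Finset.sum_congr rfl fun q _ => by simp only [hc, mul_ite, mul_zero]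
    · intro q h1 h2
      have : q = 0 := by
        simp only [Finset.mem_Icc] at h1 h2
        omega
      simp [hc, this]
  rw [hconv, Finset.sum_mul]
  refine Finset.sum_le_sum fun q hq => ?_
  obtain ⟨h1, h2⟩ := Finset.mem_filter.1 hq
  have h3 : (q : ℝ) ≤ y := (Nat.le_floor_iff hy0.le).1 (Finset.mem_Icc.1 h1).2
  have h4 : 0 < (q : ℝ) := by exact_mod_cast h2.pos
  have h5 : 0 ≤ f q := by positivity
  exact mul_le_mul_of_nonneg_left (Real.log_le_log h4 h3) h5

end

/-! ### Large values of `log |L(s, χ_p)|` -/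

section

open Filter Topology
open scoped NumberTheorySymbols

/-- A property that holds eventually for every fixed `e > 0` holds eventually along some
`ε(x) → 0`. -/
theorem exists_tendsto_zero_of_forall_eventually {P : ℝ → ℝ → Prop}
    (h : ∀ e : ℝ, 0 < e → ∀ᶠ x : ℝ in atTop, P e x) :
    ∃ ε : ℝ → ℝ, Tendsto ε atTop (𝓝 0) ∧ ∀ᶠ x : ℝ in atTop, P (ε x) x := by
  have h1 : ∀ n : ℕ, ∃ X : ℝ, ∀ x ≥ X, P (1 / ((n : ℝ) + 1)) x := fun n =>
    eventually_atTop.1 (h _ Nat.one_div_pos_of_nat)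
  choose X hX using h1
  classical
  set N : ℝ → ℕ := fun x => Nat.findGreatest (fun n => X n ≤ x) ⌊x⌋₊ with hN
  have hNtop : Tendsto N atTop atTop := by
    refine tendsto_atTop.2 fun n => ?_
    filter_upwards [eventually_ge_atTop (X n), eventually_ge_atTop (n : ℝ)] with x h2 h3
    exact Nat.le_findGreatest (Nat.le_floor h3) h2
  refine ⟨fun x => 1 / ((N x : ℝ) + 1), tendsto_one_div_add_atTop_nhds_zero_nat.comp hNtop, ?_⟩
  filter_upwards [eventually_ge_atTop (X 0)] with x hx
  exact hX _ _ (Nat.findGreatest_spec (P := fun n => X n ≤ x) (Nat.zero_le _) hx)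

theorem legendreChar_natCast (p : ℕ) [Fact p.Prime] (q : ℕ) :
    legendreChar p (q : ZMod p) = (J(q | p) : ℂ) := by
  rw [← jacobiSym.legendreSym.to_jacobiSym, ← legendreChar_intCast, Int.cast_natCast]

theorem legendreChar_ne_one {p : ℕ} [Fact p.Prime] (hp : p ≠ 2) : legendreChar p ≠ 1 := by
  rw [legendreChar, Ne, MulChar.ringHomComp_eq_one_iff (RingHom.injective_int _)]
  exact quadraticChar_ne_one (by rwa [ZMod.ringChar_zmod_n])

theorem natCast_cpow_neg_re {q : ℕ} (hq : 0 < q) (σ t : ℝ) :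
    ((q : ℂ) ^ (-((σ : ℂ) + t * Complex.I))).re =
      (q : ℝ) ^ (-σ) * Real.cos (t * Real.log q) := by
  have hq0 : (0 : ℝ) < q := by exact_mod_cast hq
  have h1 : (q : ℂ) ^ (-((σ : ℂ) + t * Complex.I)) =
      Complex.exp (((-σ * Real.log q : ℝ) : ℂ) + ((-(t * Real.log q) : ℝ) : ℂ) * Complex.I) := by
    rw [Complex.cpow_def_of_ne_zero (by exact_mod_cast hq.ne'), ← Complex.natCast_log]
    push_cast
    ring_nf
  rw [h1, Complex.exp_re, Real.rpow_def_of_pos hq0]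
  generalize Real.log q = l
  simp [mul_comm]

/-- If the values `J(q | p)` at `q ≤ y` are `s` times the signs of `cos (t log q)`, and the
contribution of `y < q ≤ z` is bounded, then `s log |L(σ + it, χ_p)|` is large. -/
theorem GeneralizedRH.exists_le_log_norm_LFunction (hGRH : GeneralizedRH) {σ : ℝ} (hσ : 1 / 2 < σ)
    (hσ1 : σ < 1) (t : ℝ) : ∃ C a : ℝ, 0 < a ∧ 0 ≤ C ∧ ∀ (p : ℕ) [Fact p.Prime], p ≠ 2 →
      ∀ s y z K : ℝ, |s| = 1 → 0 ≤ y → y ≤ z → 1 ≤ z →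
      (∀ q ∈ (Finset.Icc 1 ⌊y⌋₊).filter Nat.Prime,
        (J(q | p) : ℝ) = s * (if 0 ≤ Real.cos (t * Real.log q) then 1 else -1)) →
      |∑ q ∈ (Finset.Ioc ⌊y⌋₊ ⌊z⌋₊).filter Nat.Prime,
        (q : ℝ) ^ (-σ) * Real.cos (t * Real.log q) * (1 - q / z) * (J(q | p) : ℝ)| ≤ K →
      (1 - y / z) * (∑ q ∈ (Finset.Icc 1 ⌊y⌋₊).filter Nat.Prime,
          Real.cos (t * Real.log q) ^ 2 * (q : ℝ) ^ (-σ)) -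
        K - C * (1 + (1 + Real.log p) * z ^ (-a)) ≤
        s * Real.log ‖DirichletCharacter.LFunction (legendreChar p) ((σ : ℂ) + t * Complex.I)‖ := by
  obtain ⟨C, a, ha, hC, h⟩ := hGRH.abs_log_norm_LFunction_sub_le hσ hσ1 t
  refine ⟨C, a, ha, hC, fun p _ hp s y z K hs hy hyz hz hJ hK => ?_⟩
  have hz0 : 0 < z := by linarith
  have h1 := h p (legendreChar p) (legendreChar_ne_one hp) z hz
  set ℓ := Real.log ‖DirichletCharacter.LFunction (legendreChar p) ((σ : ℂ) + t * Complex.I)‖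
  set g : ℕ → ℝ := fun q =>
    (q : ℝ) ^ (-σ) * Real.cos (t * Real.log q) * (1 - q / z) * (J(q | p) : ℝ) with hg
  have h2 : ∑ q ∈ (Finset.Icc 1 ⌊z⌋₊).filter Nat.Prime,
      (legendreChar p (q : ZMod p) * (q : ℂ) ^ (-((σ : ℂ) + t * Complex.I))).re * (1 - q / z) =
      ∑ q ∈ (Finset.Icc 1 ⌊y⌋₊).filter Nat.Prime, g q +
        ∑ q ∈ (Finset.Ioc ⌊y⌋₊ ⌊z⌋₊).filter Nat.Prime, g q := by
    rw [← Finset.sum_union]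
    · have hun : (Finset.Icc 1 ⌊y⌋₊).filter Nat.Prime ∪ (Finset.Ioc ⌊y⌋₊ ⌊z⌋₊).filter Nat.Prime =
          (Finset.Icc 1 ⌊z⌋₊).filter Nat.Prime := by
        rw [← Finset.filter_union]
        congr 1
        have := Nat.floor_le_floor hyz
        ext q
        simp only [Finset.mem_union, Finset.mem_Icc, Finset.mem_Ioc]
        omega
      rw [hun]
      refine Finset.sum_congr rfl fun q hq => ?_
      have hq0 := (Finset.mem_filter.1 hq).2.pos
      have : (J(q | p) : ℂ) = ((J(q | p) : ℝ) : ℂ) := by push_cast; rfl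
      rw [legendreChar_natCast, this, Complex.re_ofReal_mul, natCast_cpow_neg_re hq0, hg]
      ring
    · refine Finset.disjoint_filter_filter (Finset.disjoint_left.2 fun q hq hq' => ?_)
      simp only [Finset.mem_Icc, Finset.mem_Ioc] at hq hq'
      omega
  rw [h2] at h1
  set S₂ := ∑ q ∈ (Finset.Ioc ⌊y⌋₊ ⌊z⌋₊).filter Nat.Prime, g q
  have hss : s * s = 1 := by rw [← abs_mul_abs_self, hs, one_mul]
  have h3 : (1 - y / z) * (∑ q ∈ (Finset.Icc 1 ⌊y⌋₊).filter Nat.Prime,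
      Real.cos (t * Real.log q) ^ 2 * (q : ℝ) ^ (-σ)) ≤
      s * ∑ q ∈ (Finset.Icc 1 ⌊y⌋₊).filter Nat.Prime, g q := by
    rw [Finset.mul_sum, Finset.mul_sum]
    refine Finset.sum_le_sum fun q hq => ?_
    have hqy : (q : ℝ) ≤ y :=
      (Nat.le_floor_iff hy).1 (Finset.mem_Icc.1 (Finset.mem_filter.1 hq).1).2
    have h4 : q / z ≤ y / z := by gcongr
    have h5 : y / z ≤ 1 := (div_le_one hz0).2 hyz
    set c := Real.cos (t * Real.log q) with hc
    have h6 : s * g q = (q : ℝ) ^ (-σ) * |c| * (1 - q / z) := by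
      simp only [hg]
      rw [hJ q hq, ← hc]
      have : c * (if 0 ≤ c then 1 else -1) = |c| := by
        split_ifs with h
        · rw [abs_of_nonneg h, mul_one]
        · rw [abs_of_neg (not_le.1 h), mul_neg_one]
      rw [← this]
      linear_combination ((q : ℝ) ^ (-σ) * c * (1 - q / z) * (if 0 ≤ c then 1 else -1)) * hss
    rw [h6]
    have h7 : c ^ 2 ≤ |c| := by
      rw [← sq_abs]
      have := Real.abs_cos_le_one (t * Real.log q)
      nlinarith [abs_nonneg c]
    have h8 : 0 ≤ (q : ℝ) ^ (-σ) := by positivity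
    calc (1 - y / z) * (c ^ 2 * (q : ℝ) ^ (-σ)) ≤ (1 - q / z) * (|c| * (q : ℝ) ^ (-σ)) := by
          have : q / z ≤ 1 := h4.trans h5
          gcongr
      _ = _ := by ring
  set S₁ := ∑ q ∈ (Finset.Icc 1 ⌊y⌋₊).filter Nat.Prime, g q
  have h9 : |s * (ℓ - (S₁ + S₂))| ≤ C * (1 + (1 + Real.log p) * z ^ (-a)) := by
    rwa [abs_mul, hs, one_mul]
  have h10 : |s * S₂| ≤ K := by rwa [abs_mul, hs, one_mul]
  have h11 := (abs_le.1 h9).1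
  have h12 := (abs_le.1 h10).1
  linarith

theorem tendsto_log_rpow_mul_log_log_rpow {σ : ℝ} (hσ1 : σ < 1) :
    Tendsto (fun x : ℝ => Real.log x ^ (1 - σ) * Real.log (Real.log x) ^ (-σ)) atTop atTop := by
  refine Tendsto.comp (g := fun u : ℝ => u ^ (1 - σ) * Real.log u ^ (-σ)) ?_ Real.tendsto_log_atTop
  refine tendsto_atTop.2 fun B => ?_
  filter_upwards [eventually_mul_log_rpow_mul_rpow_le σ B (show 0 < 1 - σ by linarith),
    eventually_gt_atTop 1] with u hu hu1
  have hlog := Real.log_pos hu1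
  rwa [Real.rpow_zero, mul_one, ← le_div_iff₀ (Real.rpow_pos_of_pos hlog σ), div_eq_mul_inv,
    ← Real.rpow_neg hlog.le] at hu

theorem betaConst_eq (σ t : ℝ) :
    betaConst σ t = cosSqConst σ t * (1 / (2 * Real.log 2)) ^ (1 - σ) := by
  have h : (2 * Real.log 2) ^ (σ - 1) = (1 / (2 * Real.log 2)) ^ (1 - σ) := by
    have h2 : 0 ≤ 2 * Real.log 2 := by positivity
    rw [one_div, Real.inv_rpow h2, ← Real.rpow_neg h2, neg_sub]
  unfold betaConst cosSqConst
  rw [h]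
  split_ifs <;> ring

/-- The parameter `δ` keeps the number of sign patterns below `x ^ (1 / 2)`; as `δ → 0` the constant
tends to `β`. -/
theorem exists_betaConst_sub_le {σ : ℝ} (hσ1 : σ < 1) (t : ℝ) {e : ℝ} (he : 0 < e) :
    ∃ δ : ℝ, 0 < δ ∧ δ < 1 / 8 ∧ δ < cosSqConst σ t ∧ betaConst σ t - e ≤
      (1 - δ) * (cosSqConst σ t - δ) * ((1 - 4 * δ) / (2 * Real.log 2)) ^ (1 - σ) / (1 + δ) := by
  set F : ℝ → ℝ := fun δ =>
    (1 - δ) * (cosSqConst σ t - δ) * ((1 - 4 * δ) / (2 * Real.log 2)) ^ (1 - σ) / (1 + δ) with hF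
  have hF0 : F 0 = betaConst σ t := by simp [hF, betaConst_eq]
  have hcont : ContinuousAt F 0 := by
    have h1 : ContinuousAt (fun δ : ℝ => ((1 - 4 * δ) / (2 * Real.log 2)) ^ (1 - σ)) 0 :=
      ContinuousAt.rpow_const (by fun_prop) (Or.inr (by linarith))
    have h2 : (1 : ℝ) + 0 ≠ 0 := by norm_num
    fun_prop (disch := assumption)
  have h1 : ∀ᶠ δ in 𝓝 0, betaConst σ t - e < F δ :=
    hcont.eventually (lt_mem_nhds (by rw [hF0]; linarith))
  have h2 : ∀ᶠ δ : ℝ in 𝓝 0, δ < 1 / 8 := gt_mem_nhds (by norm_num)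
  have h3 : ∀ᶠ δ : ℝ in 𝓝 0, δ < cosSqConst σ t := gt_mem_nhds (cosSqConst_pos hσ1 t)
  obtain ⟨δ, ⟨h4, h5, h6⟩, h7⟩ :=
    (((h1.and (h2.and h3)).filter_mono nhdsWithin_le_nhds).and
      (self_mem_nhdsWithin : Set.Ioi (0 : ℝ) ∈ 𝓝[>] 0)).exists
  exact ⟨δ, h7, h5, h6, h4.le⟩

set_option maxHeartbeats 1000000 in
/-- Both directions of the theorem, through the sign `s = ±1`, with a fixed `e > 0` in place of
`o(1)`. -/
theorem GeneralizedRH.eventually_le_ncard (hGRH : GeneralizedRH) {σ : ℝ} (hσ : 1 / 2 < σ)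
    (hσ1 : σ < 1) (t : ℝ) {s : ℝ} (hs : |s| = 1) {e : ℝ} (he : 0 < e) :
    ∀ᶠ x : ℝ in atTop, x ^ (1 / 2 : ℝ) ≤
      (Set.ncard {p : ℕ | (p : ℝ) ≤ x ∧ p ≠ 2 ∧ ∃ _ : Fact p.Prime,
        (betaConst σ t - e) * (Real.log x ^ (1 - σ) * Real.log (Real.log x) ^ (-σ)) ≤
          s * Real.log ‖DirichletCharacter.LFunction (legendreChar p)
            ((σ : ℂ) + (t : ℂ) * Complex.I)‖} : ℝ) := by
  obtain ⟨K, hK⟩ := hGRH.exists_eventually_le_card hσ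
  obtain ⟨C, a, ha, hC, hL⟩ := hGRH.exists_le_log_norm_LFunction hσ hσ1 t
  obtain ⟨δ, hδ0, hδ8, hδγ, hδ⟩ := exists_betaConst_sub_le hσ1 t (half_pos he)
  set γ := cosSqConst σ t
  set A : ℝ := max 2 (1 / a) with hA
  have hA2 : 2 ≤ A := le_max_left _ _
  have hAa : 1 ≤ A * a := by
    have : 1 / a ≤ A := le_max_right _ _
    rwa [div_le_iff₀ ha] at this
  have hlog2 : 0 < Real.log 2 := Real.log_pos (by norm_num)
  -- the primes up to `y = κ log x log log x` carry at most `x ^ (1 / 2 - δ)` sign patterns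
  set κ : ℝ := (1 - 4 * δ) / (2 * Real.log 2) with hκ
  have hκ0 : 0 < κ := div_pos (by linarith) (by positivity)
  have hκ1 : κ ≤ 1 := by
    rw [hκ, div_le_one (by positivity)]
    linarith [Real.log_two_gt_d9]
  have hκδ : (1 + δ) * κ * Real.log 2 ≤ 1 / 2 - δ := by
    have : (1 + δ) * κ * Real.log 2 = (1 + δ) * (1 - 4 * δ) / 2 := by rw [hκ]; field_simp
    rw [this]
    nlinarith
  have hlogtop := Real.tendsto_log_atTop
  have hlog2top := hlogtop.comp hlogtop
  have hytop : Tendsto (fun x : ℝ => κ * (Real.log x * Real.log (Real.log x))) atTop atTop :=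
    (hlogtop.atTop_mul_atTop₀ hlog2top).const_mul_atTop hκ0
  have hsmall := eventually_mul_log_rpow_mul_rpow_le 1 (1 / δ) (show (0 : ℝ) < 1 by norm_num)
  filter_upwards [hK δ hδ0 (by linarith) A (by linarith), hlogtop.eventually_ge_atTop 1,
    hlog2top.eventually_gt_atTop 0,
    hytop.eventually (hGRH.eventually_card_primes_le hδ0 (by linarith)),
    hytop.eventually (hGRH.eventually_le_sum_cos_sq (by linarith) hσ1 t hδ0),
    (hlogtop.comp hlog2top).eventually_ge_atTop (-Real.log κ),
    hlog2top.eventually hsmall, hlogtop.eventually hsmall,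
    (tendsto_log_rpow_mul_log_log_rpow hσ1).eventually_ge_atTop ((K + 3 * C) / (e / 2)),
    eventually_gt_atTop 0] with x hcard hL1 hL2 hpi hcos hlogκ hs2 hs1 hΦ hx0
  simp only [Function.comp_apply, Real.rpow_zero, Real.rpow_one, mul_one] at hL2 hlogκ hs2 hs1
  set L := Real.log x with hLdef
  set L₂ := Real.log L with hL₂def
  set y := κ * (L * L₂) with hy
  set z := L ^ A with hz
  set Φ := L ^ (1 - σ) * L₂ ^ (-σ) with hΦdef
  have hL0 : 0 < L := by linarith
  have hΦ0 : 0 < Φ := mul_pos (Real.rpow_pos_of_pos hL0 _) (Real.rpow_pos_of_pos hL2 _)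
  have hy0 : 0 < y := by positivity
  have hs1' : L₂ ≤ δ * L := by
    rw [div_mul_eq_mul_div, one_mul, div_le_iff₀ hδ0] at hs1; linarith
  have hs2' : Real.log L₂ ≤ δ * L₂ := by
    rw [div_mul_eq_mul_div, one_mul, div_le_iff₀ hδ0] at hs2; linarith
  have hlogy : Real.log y = Real.log κ + (L₂ + Real.log L₂) := by
    rw [hy, Real.log_mul hκ0.ne' (by positivity), Real.log_mul hL0.ne' hL2.ne']
  have hlogy1 : L₂ ≤ Real.log y := by linarith
  have hlogy2 : Real.log y ≤ (1 + δ) * L₂ := by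
    linarith [Real.log_nonpos hκ0.le hκ1]
  have hlogy0 : 0 < Real.log y := by linarith
  have hz1 : 1 ≤ z := Real.one_le_rpow hL1 (by linarith)
  have hz0 : 0 < z := by linarith
  have hyz : y ≤ δ * z := by
    have h1 : L ^ (2 : ℝ) ≤ z := Real.rpow_le_rpow_of_exponent_le hL1 hA2
    rw [Real.rpow_two] at h1
    calc y ≤ 1 * (L * (δ * L)) := by rw [hy]; gcongr
      _ = δ * L ^ 2 := by ring
      _ ≤ δ * z := by gcongr
  have hyz' : y ≤ z := hyz.trans (by nlinarith)
  have hpat : (2 : ℝ) ^ ((Finset.Icc 1 ⌊y⌋₊).filter Nat.Prime).card ≤ x ^ (1 / 2 - δ) := by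
    rw [← Real.rpow_natCast, Real.rpow_def_of_pos (by norm_num), Real.rpow_def_of_pos hx0]
    refine Real.exp_le_exp.2 ?_
    have h1 : y / Real.log y ≤ κ * L := by
      rw [div_le_iff₀ hlogy0]
      calc y = κ * L * L₂ := by rw [hy]; ring
        _ ≤ κ * L * Real.log y := by gcongr
    calc Real.log 2 * (((Finset.Icc 1 ⌊y⌋₊).filter Nat.Prime).card : ℝ)
        ≤ Real.log 2 * ((1 + δ) * (κ * L)) := by
          gcongr
          exact hpi.trans (by gcongr)
      _ = ((1 + δ) * κ * Real.log 2) * L := by ring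
      _ ≤ (1 / 2 - δ) * L := by gcongr
      _ = L * (1 / 2 - δ) := mul_comm _ _
  have hmain := hcard y hyz' hpat
    (fun q => s * (if 0 ≤ Real.cos (t * Real.log q) then 1 else -1))
    (fun q => (q : ℝ) ^ (-σ) * Real.cos (t * Real.log q) * (1 - q / z))
    (fun q => by
      rw [abs_mul, hs, one_mul]
      split_ifs <;> simp)
    (fun q hq hqz => by
      have h1 : (q : ℝ) / z ≤ 1 := (div_le_one hz0).2 hqz
      have h2 : 0 ≤ (q : ℝ) / z := by positivity
      rw [abs_mul, abs_mul, abs_of_nonneg (show 0 ≤ 1 - (q : ℝ) / z by linarith),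
        abs_of_nonneg (Real.rpow_nonneg (Nat.cast_nonneg q) (-σ)), mul_assoc]
      refine mul_le_of_le_one_right (Real.rpow_nonneg (Nat.cast_nonneg q) _) ?_
      exact mul_le_one₀ (Real.abs_cos_le_one _) (by linarith) (by linarith))
  refine hmain.trans ?_
  rw [Nat.cast_le, ← Set.ncard_coe_finset]
  refine Set.ncard_le_ncard (fun p hp => ?_) ((Finset.finite_toSet (Finset.Icc 0 ⌊x⌋₊)).subset
    fun p hp => ?_)
  swap
  · exact Finset.mem_coe.2 (Finset.mem_Icc.2 ⟨Nat.zero_le _, Nat.le_floor hp.1⟩)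
  obtain ⟨hpI, hp, hp2, hJ, hT⟩ := Finset.mem_filter.1 (Finset.mem_coe.1 hp)
  have hpx : (p : ℝ) ≤ x := (Nat.le_floor_iff hx0.le).1 (Finset.mem_Icc.1 hpI).2
  have : Fact p.Prime := ⟨hp⟩
  refine ⟨hpx, hp2, this, ?_⟩
  refine le_trans ?_ (hL p hp2 s y z K hs hy0.le hyz' hz1 hJ hT)
  have herr : C * (1 + (1 + Real.log p) * z ^ (-a)) ≤ 3 * C := by
    have h1 : z ^ (-a) ≤ 1 / L := by
      rw [hz, ← Real.rpow_mul hL0.le, one_div, ← Real.rpow_neg_one]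
      exact Real.rpow_le_rpow_of_exponent_le hL1 (by linarith)
    have h2 : Real.log p ≤ L := Real.log_le_log (by exact_mod_cast hp.pos) hpx
    have h3 : (1 + Real.log p) * z ^ (-a) ≤ 2 := by
      calc (1 + Real.log p) * z ^ (-a) ≤ (2 * L) * (1 / L) := by gcongr; linarith
        _ = 2 := by field_simp
    linarith only [mul_le_mul_of_nonneg_left h3 hC]
  have hYΦ : κ ^ (1 - σ) / (1 + δ) * Φ ≤ y ^ (1 - σ) / Real.log y := by
    have h1 : y ^ (1 - σ) = κ ^ (1 - σ) * Φ * L₂ := by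
      rw [hy, Real.mul_rpow hκ0.le (by positivity), Real.mul_rpow hL0.le hL2.le, hΦdef,
        show L₂ ^ (1 - σ) = L₂ ^ (-σ) * L₂ by
          rw [show 1 - σ = -σ + 1 by ring, Real.rpow_add hL2, Real.rpow_one]]
      ring
    rw [h1]
    calc κ ^ (1 - σ) / (1 + δ) * Φ = κ ^ (1 - σ) * Φ * L₂ / ((1 + δ) * L₂) := by
          field_simp
      _ ≤ _ := by gcongr
  have hmainterm : (betaConst σ t - e / 2) * Φ ≤
      (1 - y / z) * (∑ q ∈ (Finset.Icc 1 ⌊y⌋₊).filter Nat.Prime,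
          Real.cos (t * Real.log q) ^ 2 * (q : ℝ) ^ (-σ)) := by
    have h1 : y / z ≤ δ := (div_le_iff₀ hz0).2 hyz
    calc (betaConst σ t - e / 2) * Φ
        ≤ (1 - δ) * (γ - δ) * κ ^ (1 - σ) / (1 + δ) * Φ := by gcongr
      _ = (1 - δ) * ((γ - δ) * (κ ^ (1 - σ) / (1 + δ) * Φ)) := by ring
      _ ≤ (1 - δ) * ((γ - δ) * (y ^ (1 - σ) / Real.log y)) := by
          have : 0 ≤ 1 - δ := by linarith
          have : 0 ≤ γ - δ := by linarith
          gcongr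
      _ ≤ _ := by
          have : 0 ≤ 1 - y / z := by linarith
          have : 0 ≤ γ - δ := by linarith
          have : 0 ≤ y ^ (1 - σ) / Real.log y := by positivity
          gcongr
  rw [div_le_iff₀ (by positivity)] at hΦ
  linarith

end

theorem theorem1p8 (hGRH : GeneralizedRH) :
    ∃ c : ℝ, 0 < c ∧ ∀ σ t : ℝ, 1 / 2 < σ → σ < 1 →
      (∃ ε : ℝ → ℝ, Filter.Tendsto ε Filter.atTop (nhds 0) ∧
        ∀ᶠ x : ℝ in Filter.atTop,
          c * x ^ (1 / 2 : ℝ) ≤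
            (Set.ncard {p : ℕ | (p : ℝ) ≤ x ∧ p ≠ 2 ∧ ∃ _ : Fact p.Prime,
              (betaConst σ t + ε x) * Real.log x ^ (1 - σ) * Real.log (Real.log x) ^ (-σ) ≤
                Real.log ‖DirichletCharacter.LFunction (legendreChar p)
                  ((σ : ℂ) + (t : ℂ) * Complex.I)‖} : ℝ)) ∧
      (∃ ε : ℝ → ℝ, Filter.Tendsto ε Filter.atTop (nhds 0) ∧
        ∀ᶠ x : ℝ in Filter.atTop,
          c * x ^ (1 / 2 : ℝ) ≤
            (Set.ncard {q : ℕ | (q : ℝ) ≤ x ∧ q ≠ 2 ∧ ∃ _ : Fact q.Prime,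
              Real.log ‖DirichletCharacter.LFunction (legendreChar q)
                  ((σ : ℂ) + (t : ℂ) * Complex.I)‖ ≤
                -((betaConst σ t + ε x) * Real.log x ^ (1 - σ) *
                  Real.log (Real.log x) ^ (-σ))} : ℝ)) := by
  refine ⟨1, one_pos, fun σ t hσ hσ1 => ⟨?_, ?_⟩⟩
  · obtain ⟨ε, hε, h⟩ := exists_tendsto_zero_of_forall_eventually
      fun e he => hGRH.eventually_le_ncard hσ hσ1 t (s := 1) abs_one he
    refine ⟨fun x => -ε x, by simpa using hε.neg, ?_⟩
    filter_upwards [h] with x hx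
    simpa only [one_mul, mul_assoc, sub_eq_add_neg] using hx
  · obtain ⟨ε, hε, h⟩ := exists_tendsto_zero_of_forall_eventually
      fun e he => hGRH.eventually_le_ncard hσ hσ1 t (s := -1) (by simp) he
    refine ⟨fun x => -ε x, by simpa using hε.neg, ?_⟩
    filter_upwards [h] with x hx
    simpa only [one_mul, mul_assoc, sub_eq_add_neg, neg_mul, le_neg] using hx
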